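/- Let $G$ be a discrete group acting on a small category $I$ (a functor $a\colon G\to Cat$ with $a(\ast)=I$), and suppose that for every object $i$ of $I$ the nerve $N(I/i)$ of the over category is finite dimensional. A $G$-diagram of pointed spaces is a functor $X\colon I\to \mathrm{Top}_*$ with natural transformations $\phi_g\colon X\to X\circ g$ ($g\in G$) such that $\phi_1=\mathrm{id}$ and $\phi_{hg}=(\phi_h|_g)\circ\phi_g$; the stabilizer group $G_i$ of an object $i$ then acts on $X_i$. For a $G$-diagram $K$ of pointed spaces, the space $\mathrm{Hom}_*(K,X)$ of pointed natural transformations of underlying diagrams carries the conjugation action $g\cdot f=\phi_g\circ f|_{g^{-1}}\circ\phi_{g^{-1}}$, and similarly for unpointed natural transformations $\mathrm{Hom}$. A morphism $E\to B$ of pointed $G$-diagrams is an acyclic fibration if $E_i^H\to B_i^H$ is a Serre fibration and a weak homotopy equivalence for all objects $i$ and all $H\le G_i$; $K$ is cofibrant if $*\to K$ has the left lifting property against the acyclic fibrations. A space $Y$ is $n$-connected if it is non-empty (when $n\ge -1$) and $\pi_k(Y,y)$ is trivial for all $0\le k\le n$ and $y\in Y$; $\mathrm{conn}\,Y\in\mathbb{Z}\cup\{\infty\}$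 is the largest $n$ for which $Y$ is $n$-connected. We put $\infty-d=\infty$ for every $d\le\infty$, and the minimum (infimum) of the empty family is $\infty$. For $c\in\mathbb{Z}\cup\{\pm\infty\}$, "$c$-connected" means $n$-connected for every integer $n\le c$. (1) Let $K$ be a cofibrant $G$-diagram of pointed compactly generated Hausdorff spaces such that $K_i$ is a $G_i$-CW-complex for every object $i$. Then for every $G$-diagram $X$ of pointed spaces the fixed point space $\mathrm{Hom}_*(K,X)^G$ is $$\min_{i\in \mathrm{Ob}\, I}\ \min_{\substack{H\leq G_i\\ K^{H}_i\neq *}}\big(\mathrm{conn}\, X^{H}_i-\dim K_{i}^H\big)$$ connected. (2) For every $G$-diagram $X$ of pointed spaces, the fixed point space $(\mathrm{holim}_I X)^G$, where $\mathrm{holim}_I X=\mathrm{Hom}(B(I/ -),X)$, is $$\min_{i\in\mathrm{Ob}\, I}\ \min_{H\leq G_i}\big(\mathrm{conn}\, X^{H}_i-\dim N(I/i)^H\big)$$ connected. -/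

import Mathlib

open CategoryTheory Topology

universe u

noncomputable section

/-! ## Connectivity, weak equivalences, Serre fibrations -/

/-- `Y` is `n`-connected (`n : ℤ`): it is non-empty if `n ≥ -1`, and `π_k (Y, y)` is trivial for all
`0 ≤ k ≤ n` and all base points `y`.  Every space is `n`-connected for `n ≤ -2`. -/
def IsNConnected (n : ℤ) (Y : Type u) [TopologicalSpace Y] : Prop :=
  (-1 ≤ n → Nonempty Y) ∧ ∀ k : ℕ, (k : ℤ) ≤ n → ∀ y : Y, Subsingleton (HomotopyGroup.Pi k Y y)

/-- An integer as an extended real number. -/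
def intToEReal (n : ℤ) : EReal := ((n : ℝ) : EReal)

/-- `Y` is `c`-connected, for a bound `c` that may be infinite: it is `n`-connected for every
integer `n ≤ c`. -/
def IsConnectedUpTo (c : EReal) (Y : Type u) [TopologicalSpace Y] : Prop :=
  ∀ n : ℤ, intToEReal n ≤ c → IsNConnected n Y

/-- The connectivity `conn Y`: the largest `n` for which `Y` is `n`-connected
(`∞` if there is no largest one). -/
def conn (Y : Type u) [TopologicalSpace Y] : EReal :=
  ⨆ (n : ℤ) (_ : IsNConnected n Y), intToEReal n

/-- The difference `c - d` of a connectivity and a dimension, with the convention that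
`∞ - d = ∞` for every `d`, including `d = ∞`. -/
def connSub (c d : EReal) : EReal :=
  open Classical in if c = ⊤ then ⊤ else c - d

/-- The map induced by `f` on the sets (groups) `π_n`. -/
def homotopyGroupMap {Y Z : Type u} [TopologicalSpace Y] [TopologicalSpace Z] (f : C(Y, Z))
    (n : ℕ) (y : Y) : HomotopyGroup.Pi n Y y → HomotopyGroup.Pi n Z (f y) :=
  Quotient.map
    (fun γ => ⟨f.comp γ.1, fun t ht => congrArg f (γ.2 t ht)⟩)
    (fun _ _ h => Nonempty.map (fun F => F.compContinuousMap f) h)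

/-- Weak homotopy equivalences: bijective on `π_n` for all `n ≥ 0` and all base points
(and the target is empty if the source is). -/
def IsWeakEquiv {Y Z : Type u} [TopologicalSpace Y] [TopologicalSpace Z] (f : C(Y, Z)) : Prop :=
  (IsEmpty Y → IsEmpty Z) ∧ ∀ (n : ℕ) (y : Y), Function.Bijective (homotopyGroupMap f n y)

/-- Serre fibrations: the homotopy lifting property for all cubes. -/
def IsSerreFib {Y Z : Type u} [TopologicalSpace Y] [TopologicalSpace Z] (p : C(Y, Z)) : Prop :=
  ∀ (n : ℕ) (f : C(Fin n → unitInterval, Y)) (h : C((Fin n → unitInterval) × unitInterval, Z)), (∀ x, p (f x) = h (x, 0)) →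
    ∃ F : C((Fin n → unitInterval) × unitInterval, Y), (∀ x, F (x, 0) = f x) ∧ ∀ z, p (F z) = h z

/-! ## Categories with `G`-action and `G`-diagrams

A category with `G`-action is a functor `a : SingleObj G ⥤ Cat`. -/

section Action

variable {G : Type u} [Group G]

/-- The underlying category of a category with `G`-action. -/
def Idx (a : SingleObj G ⥤ Cat.{u, u}) : Type u := a.obj (SingleObj.star G)

instance (a : SingleObj G ⥤ Cat.{u, u}) : SmallCategory (Idx a) :=
  inferInstanceAs (Category (a.obj (SingleObj.star G)))

/-- The automorphism of the underlying category given by `g`. -/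
def act (a : SingleObj G ⥤ Cat.{u, u}) (g : G) : Idx a ⥤ Idx a :=
  (a.map (X := SingleObj.star G) (Y := SingleObj.star G) g).toFunctor

theorem act_one (a : SingleObj G ⥤ Cat.{u, u}) : act a 1 = 𝟭 (Idx a) :=
  congrArg Cat.Hom.toFunctor (a.map_id (SingleObj.star G))

theorem act_mul (a : SingleObj G ⥤ Cat.{u, u}) (h g : G) : act a (h * g) = act a g ⋙ act a h :=
  congrArg Cat.Hom.toFunctor
    (a.map_comp (X := SingleObj.star G) (Y := SingleObj.star G) (Z := SingleObj.star G) g h)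

instance (a : SingleObj G ⥤ Cat.{u, u}) : MulAction G (Idx a) where
  smul g i := (act a g).obj i
  one_smul i := Functor.congr_obj (act_one a) i
  mul_smul h g i := Functor.congr_obj (act_mul a h g) i

/-- The stabilizer group `G_i` of an object `i`. -/
abbrev Stab (a : SingleObj G ⥤ Cat.{u, u}) (i : Idx a) : Subgroup G := MulAction.stabilizer G i

/-- A `G`-diagram in `C`: a diagram `X : I ⥤ C` with a `G`-structure, that is, natural
transformations `φ_g : X ⟶ X ∘ g` with `φ_1 = id` and `φ_{hg} = φ_h|_g ∘ φ_g`.  The morphisms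
`eqToHom _` only identify `X_{1 i}` with `X_i` and `X_{h (g i)}` with `X_{(hg) i}`. -/
structure GDiagram (a : SingleObj G ⥤ Cat.{u, u}) (C : Type*) [Category C] where
  /-- the underlying diagram -/
  functor : Idx a ⥤ C
  /-- the `G`-structure -/
  φ (g : G) : functor ⟶ act a g ⋙ functor
  φ_one (i : Idx a) :
    (φ 1).app i = functor.map (eqToHom (one_smul G i).symm)
  φ_mul (h g : G) (i : Idx a) :
    (φ (h * g)).app i =
      (φ g).app i ≫ (φ h).app (g • i) ≫ functor.map (eqToHom (mul_smul h g i).symm)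

namespace GDiagram

variable {a : SingleObj G ⥤ Cat.{u, u}} {C : Type*} [Category C]

/-- The component `X_i ⟶ X_{g i}` of `φ_g`, with the target written `X_j` for `j = g i`. -/
def tr (X : GDiagram a C) (g : G) {i j : Idx a} (h : g • i = j) :
    X.functor.obj i ⟶ X.functor.obj j :=
  (X.φ g).app i ≫ X.functor.map (eqToHom h)

theorem tr_one (X : GDiagram a C) {i : Idx a} (h : (1 : G) • i = i) : X.tr 1 h = 𝟙 _ := by
  rw [tr, φ_one, ← X.functor.map_comp]
  simp

theorem tr_comp (X : GDiagram a C) {g g' : G} {i j k : Idx a} (h : g • i = j) (h' : g' • j = k) :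
    X.tr g h ≫ X.tr g' h' = X.tr (g' * g) (by rw [mul_smul, h, h']) := by
  subst h
  subst h'
  simp only [tr, φ_mul, eqToHom_refl, Category.assoc]
  rw [← X.functor.map_comp, eqToHom_trans, eqToHom_refl, X.functor.map_id]
  erw [Category.id_comp]

theorem map_tr (X : GDiagram a C) (g : G) {i i' j j' : Idx a} (α : i ⟶ i') (h : g • i = j)
    (h' : g • i' = j') :
    X.functor.map α ≫ X.tr g h' =
      X.tr g h ≫ X.functor.map (eqToHom h.symm ≫ (act a g).map α ≫ eqToHom h') := by
  subst h
  subst h'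
  have := (X.φ g).naturality α
  simp [tr, this]

/-- The `G`-diagram obtained by applying a functor pointwise. -/
def whisker (X : GDiagram a C) {D : Type*} [Category D] (F : C ⥤ D) : GDiagram a D where
  functor := X.functor ⋙ F
  φ g := Functor.whiskerRight (X.φ g) F
  φ_one i := by
    simp only [Functor.whiskerRight_app, φ_one]
    rfl
  φ_mul h g i := by
    simp only [Functor.whiskerRight_app, φ_mul, Functor.map_comp]
    rfl

/-- The stabilizer `G_i` acts on the space `X_i` of a `G`-diagram of spaces. -/
instance stabAction (X : GDiagram a TopCat.{u}) (i : Idx a) :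
    MulAction (Stab a i) (X.functor.obj i) where
  smul γ x := X.tr γ.1 (MulAction.mem_stabilizer_iff.1 γ.2) x
  one_smul x := by
    exact ConcreteCategory.congr_hom (X.tr_one (one_smul G i)) x
  mul_smul γ δ x := by
    exact (ConcreteCategory.congr_hom (X.tr_comp (MulAction.mem_stabilizer_iff.1 δ.2)
      (MulAction.mem_stabilizer_iff.1 γ.2)) x).symm

/-- The fixed point space `X_i^H` for `H ≤ G_i`. -/
abbrev Fixed (X : GDiagram a TopCat.{u}) (i : Idx a) (H : Subgroup (Stab a i)) :
    Set (X.functor.obj i) :=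
  MulAction.fixedPoints H (X.functor.obj i)

/-- The fixed simplicial subset `Z_i^H` for `H ≤ G_i`, for a `G`-diagram of simplicial sets. -/
def fixedSubcomplex (Z : GDiagram a SSet.{u}) (i : Idx a) (H : Subgroup (Stab a i)) :
    (Z.functor.obj i).Subcomplex where
  obj n := {x | ∀ γ ∈ H, (Z.tr γ.1 (MulAction.mem_stabilizer_iff.1 γ.2)).app n x = x}
  map {n m} f x hx γ hγ := by
    have := ConcreteCategory.congr_hom ((Z.tr γ.1 (MulAction.mem_stabilizer_iff.1 γ.2)).naturality f) x
    refine this.trans ?_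
    exact congrArg _ (hx γ hγ)

/-! ### Spaces of natural transformations -/

/-- The set of all natural transformations of underlying diagrams. -/
def HomSpace (K X : GDiagram a TopCat.{u}) : Type u := K.functor ⟶ X.functor

/-- The `G`-action by conjugation
`g · f = φ_g ∘ f|_{g⁻¹} ∘ φ_{g⁻¹}` on natural transformations. -/
def conj (K X : GDiagram a TopCat.{u}) (g : G) (f : K.functor ⟶ X.functor) :
    K.functor ⟶ X.functor where
  app i := K.tr g⁻¹ rfl ≫ f.app (g⁻¹ • i) ≫ X.tr g (smul_inv_smul g i)
  naturality i j α := by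
    have key : eqToHom (smul_inv_smul g i).symm ≫ (act a g).map ((act a g⁻¹).map α) ≫
        eqToHom (smul_inv_smul g j) = α := by
      have e : act a g⁻¹ ⋙ act a g = 𝟭 (Idx a) := by
        rw [← act_mul, mul_inv_cancel, act_one]
      have := Functor.congr_hom e α
      simp only [Functor.comp_map, Functor.id_map] at this
      rw [this]
      simp
    have h1 := K.map_tr g⁻¹ α rfl rfl
    have h2 := f.naturality ((act a g⁻¹).map α)
    have h3 := X.map_tr g ((act a g⁻¹).map α) (smul_inv_smul g i) (smul_inv_smul g j)
    rw [key] at h3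
    rw [eqToHom_refl, Category.id_comp, eqToHom_refl, Category.comp_id] at h1
    rw [reassoc_of% h1]
    erw [reassoc_of% h2, h3]
    simp only [Category.assoc]
    rfl

theorem conj_app (K X : GDiagram a TopCat.{u}) (g : G) (f : K.functor ⟶ X.functor) {i j : Idx a}
    (h : g • j = i) (h' : g⁻¹ • i = j) :
    (conj K X g f).app i = K.tr g⁻¹ h' ≫ f.app j ≫ X.tr g h := by
  subst h'
  rfl

instance (K X : GDiagram a TopCat.{u}) : MulAction G (HomSpace K X) where
  smul g f := conj K X g f
  one_smul f := by
    refine NatTrans.ext (funext fun i => ?_)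
    change (conj K X 1 f).app i = _
    rw [conj_app K X 1 f (one_smul G i) (by simp)]
    have : K.tr (1 : G)⁻¹ (i := i) (j := i) (by simp) = 𝟙 _ := by
      have := K.tr_one (one_smul G i)
      convert this using 2
      simp
    rw [this, tr_one]
    erw [Category.id_comp, Category.comp_id]
  mul_smul g h f := by
    refine NatTrans.ext (funext fun i => ?_)
    change (conj K X (g * h) f).app i = (conj K X g (conj K X h f)).app i
    have e1 : (g * h) • h⁻¹ • g⁻¹ • i = i := by simp [mul_smul]
    rw [conj_app K X (g * h) f (j := h⁻¹ • g⁻¹ • i) e1 (by simp [mul_smul])]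
    rw [conj_app K X g _ (j := g⁻¹ • i) (by simp) rfl]
    rw [conj_app K X h f (j := h⁻¹ • g⁻¹ • i) (by simp) rfl]
    simp only [Category.assoc]
    rw [X.tr_comp, ← Category.assoc, ← Category.assoc (K.tr g⁻¹ _), K.tr_comp]
    have : ∀ (k : G) (hk : k = (g * h)⁻¹) (hh : k • i = h⁻¹ • g⁻¹ • i)
        (hh' : (g * h)⁻¹ • i = h⁻¹ • g⁻¹ • i), K.tr k hh = K.tr (g * h)⁻¹ hh' := by
      rintro k rfl hh hh'
      rfl
    rw [this _ (mul_inv_rev g h).symm]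
    rw [Category.assoc]

/-- The space `Hom_I(K, X)` of natural transformations, a subspace of the product of the mapping
spaces `Map(K_i, X_i)` in compactly generated spaces: the compactly generated refinement of the
topology induced by the compact-open topologies. -/
instance (K X : GDiagram a TopCat.{u}) : TopologicalSpace (HomSpace K X) :=
  @TopologicalSpace.compactlyGenerated.{u} (HomSpace K X)
    (TopologicalSpace.induced
      (fun (f : K.functor ⟶ X.functor) (i : Idx a) =>
        ((f.app i).hom : C(K.functor.obj i, X.functor.obj i))) inferInstance)

end GDiagram

/-! ### Pointed `G`-diagrams of spaces -/

/-- A `G`-diagram of pointed spaces: all structure maps preserve the base points. -/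
structure PtGDiagram (a : SingleObj G ⥤ Cat.{u, u}) extends GDiagram a TopCat.{u} where
  /-- the base points -/
  pt (i : Idx a) : functor.obj i
  map_pt {i j : Idx a} (α : i ⟶ j) : functor.map α (pt i) = pt j
  φ_pt (g : G) (i : Idx a) : (φ g).app i (pt i) = pt (g • i)

namespace PtGDiagram

variable {a : SingleObj G ⥤ Cat.{u, u}}

theorem tr_pt (X : PtGDiagram a) (g : G) {i j : Idx a} (h : g • i = j) :
    X.tr g h (X.pt i) = X.pt j := by
  subst h
  change X.functor.map _ ((X.φ g).app i (X.pt i)) = _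
  rw [X.φ_pt]
  exact X.map_pt _

/-- All the spaces of the diagram are compactly generated Hausdorff spaces. -/
def IsCGHaus (X : PtGDiagram a) : Prop :=
  ∀ i, CompactlyGeneratedSpace (X.functor.obj i) ∧ T2Space (X.functor.obj i)

/-- Morphisms of pointed `G`-diagrams: pointed natural transformations compatible with the
`G`-structures. -/
structure Hom (K X : PtGDiagram a) where
  /-- the underlying natural transformation -/
  nat : K.functor ⟶ X.functor
  map_pt (i : Idx a) : nat.app i (K.pt i) = X.pt i
  comm (g : G) (i : Idx a) : nat.app i ≫ (X.φ g).app i = (K.φ g).app i ≫ nat.app (g • i)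

theorem Hom.tr_comm {K X : PtGDiagram a} (f : Hom K X) (g : G) {i j : Idx a} (h : g • i = j) :
    f.nat.app i ≫ X.tr g h = K.tr g h ≫ f.nat.app j := by
  subst h
  simpa [GDiagram.tr] using f.comm g i

/-- The restriction `K_i^H → X_i^H` of a morphism to fixed points, for `H ≤ G_i`. -/
def Hom.fixedMap {K X : PtGDiagram a} (f : Hom K X) (i : Idx a) (H : Subgroup (Stab a i)) :
    C(K.Fixed i H, X.Fixed i H) where
  toFun x := ⟨f.nat.app i x.1, fun γ => by
    have h1 := ConcreteCategory.congr_hom (f.tr_comm γ.1.1 γ.1.2) x.1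
    exact h1.trans (congrArg (f.nat.app i) (x.2 γ))⟩
  continuous_toFun :=
    ((f.nat.app i).hom.continuous.comp continuous_subtype_val).subtype_mk _

/-- Acyclic fibrations of pointed `G`-diagrams: for every object `i` the map at `i` is an acyclic
fibration of `G_i`-spaces, that is, its restriction to the `H`-fixed points is a Serre fibration
and a weak homotopy equivalence for all `H ≤ G_i`. -/
def Hom.IsAcyclicFibration {E B : PtGDiagram a} (p : Hom E B) : Prop :=
  ∀ (i : Idx a) (H : Subgroup (Stab a i)), IsSerreFib (p.fixedMap i H) ∧ IsWeakEquiv (p.fixedMap i H)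

/-- `K` is cofibrant: the map from the one-point diagram (the initial pointed diagram) to `K` has
the left lifting property against all acyclic fibrations of pointed `G`-diagrams of compactly
generated Hausdorff spaces. -/
def IsCofibrant (K : PtGDiagram a) : Prop :=
  ∀ (E B : PtGDiagram a), E.IsCGHaus → B.IsCGHaus → ∀ p : Hom E B, p.IsAcyclicFibration →
    ∀ f : Hom K B, ∃ l : Hom K E, l.nat ≫ p.nat = f.nat

/-- The space `Hom_*(K, X)` of pointed natural transformations. -/
def PtHomSpace (K X : PtGDiagram a) : Type u :=
  {f : GDiagram.HomSpace K.toGDiagram X.toGDiagram //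
    ∀ i, NatTrans.app (F := K.functor) (G := X.functor) f i (K.pt i) = X.pt i}

instance (K X : PtGDiagram a) : TopologicalSpace (PtHomSpace K X) :=
  inferInstanceAs (TopologicalSpace (Subtype _))

/-- Conjugation preserves pointed natural transformations. -/
instance (K X : PtGDiagram a) : MulAction G (PtHomSpace K X) where
  smul g f := ⟨g • f.1, fun i => by
    change X.tr g _ (NatTrans.app (F := K.functor) (G := X.functor) f.1 (g⁻¹ • i)
      (K.tr g⁻¹ rfl (K.pt i))) = X.pt i
    rw [K.tr_pt, f.2, X.tr_pt]⟩
  one_smul f := Subtype.ext (one_smul G f.1)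
  mul_smul g h f := Subtype.ext (mul_smul g h f.1)

end PtGDiagram

end Action

/-! ## `Γ`-CW complexes -/

/-- A `Γ`-CW structure on a `Γ`-space `K`, `Γ` a discrete group: a CW structure whose sets of
`n`-cells are `Γ`-sets (disjoint unions of orbits `Γ/L`) and whose characteristic maps
`cells × D^n → K` are `Γ`-equivariant. -/
structure GCWComplex (Γ : Type u) [Group Γ] (K : Type u) [TopologicalSpace K] [MulAction Γ K] where
  /-- the underlying CW structure -/
  cw : CWComplex (Set.univ : Set K)
  /-- the action on the cells -/
  cellAction (n : ℕ) : MulAction Γ (cw.cell n)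
  map_smul (n : ℕ) (γ : Γ) (e : cw.cell n) (x : Fin n → ℝ) (hx : x ∈ Metric.closedBall 0 1) :
    cw.map n ((cellAction n).smul γ e) x = γ • cw.map n e x

/-- The dimension of the fixed point complex `K^H`: its cells are the cells of `K` fixed by `H`. -/
def GCWComplex.dimFixed {Γ : Type u} [Group Γ] {K : Type u} [TopologicalSpace K] [MulAction Γ K]
    (c : GCWComplex Γ K) (H : Subgroup Γ) : EReal :=
  ⨆ (n : ℕ) (_ : ∃ e : c.cw.cell n, ∀ γ ∈ H, (c.cellAction n).smul γ e = e), (n : EReal)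

/-- The dimension of a simplicial set: the supremum of the dimensions of its nondegenerate
simplices. -/
def simplicialDim (Z : SSet.{u}) : EReal :=
  ⨆ (n : ℕ) (_ : (Z.nonDegenerate n).Nonempty), (n : EReal)

/-! ## The homotopy limit -/

section Holim

variable {G : Type u} [Group G]

theorem over_post_eq {J : Type u} [SmallCategory J] {F F' : J ⥤ J} (h : F = F') (i : J) :
    Over.post F' = Over.post (X := i) F ⋙ Over.map (eqToHom (Functor.congr_obj h i)) := by
  subst h
  rw [eqToHom_refl, Over.mapId_eq]
  rfl

theorem over_map_post {J : Type u} [SmallCategory J] (F : J ⥤ J) {i j : J} (α : i ⟶ j) :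
    Over.map α ⋙ Over.post F = Over.post F ⋙ Over.map (F.map α) := by
  have hobj : ∀ x : Over i, (Over.map α ⋙ Over.post F).obj x =
      (Over.post F ⋙ Over.map (F.map α)).obj x := fun x => by
    change Over.mk (F.map (x.hom ≫ α)) = Over.mk (F.map x.hom ≫ F.map α)
    rw [F.map_comp]
  refine CategoryTheory.Functor.ext hobj (fun x y f => ?_)
  ext
  simp only [Over.comp_left, Over.eqToHom_left]
  change F.map f.left = 𝟙 _ ≫ F.map f.left ≫ 𝟙 _
  simp

/-- The `G`-diagram of categories `I/(-)`, with `G`-structure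
`(α : j ⟶ i) ↦ (g α : g j ⟶ g i)`. -/
def overDiagram (a : SingleObj G ⥤ Cat.{u, u}) : GDiagram a Cat.{u, u} where
  functor := Over.mapFunctor (Idx a)
  φ g :=
    { app := fun i => (Over.post (X := i) (act a g)).toCatHom
      naturality := fun _ _ α => Cat.ext (over_map_post (act a g) α) }
  φ_one i := Cat.ext (over_post_eq (act_one a).symm i)
  φ_mul h g i := Cat.ext (over_post_eq (act_mul a h g).symm i)

/-- The `G`-diagram of simplicial sets `N(I/(-))`. -/
def nerveOver (a : SingleObj G ⥤ Cat.{u, u}) : GDiagram a SSet.{u} :=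
  (overDiagram a).whisker nerveFunctor

/-- The `G`-diagram of spaces `B(I/(-))`. -/
def classifyingOver (a : SingleObj G ⥤ Cat.{u, u}) : GDiagram a TopCat.{u} :=
  (nerveOver a).whisker SSet.toTop

/-- The `G`-homotopy limit `holim_I X = Hom_I(B(I/(-)), X)`, a `G`-space. -/
abbrev Holim {a : SingleObj G ⥤ Cat.{u, u}} (X : GDiagram a TopCat.{u}) : Type u :=
  GDiagram.HomSpace (classifyingOver a) X

end Holim

end

noncomputable section

open Set unitInterval

/-! ## Extension of maps from the boundary of a pair -/

section PairExt

variable {P Q Y : Type*} [TopologicalSpace P] [TopologicalSpace Q] [TopologicalSpace Y]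

/-- Every continuous map from the subspace `bP` of `P` to `Y` extends to `P`. -/
def PairExt (P : Type*) [TopologicalSpace P] (bP : Set P) (Y : Type*) [TopologicalSpace Y] : Prop :=
  ∀ f : P → Y, ContinuousOn f bP → ∃ F : P → Y, Continuous F ∧ EqOn F f bP

theorem PairExt.of_homeomorph {bP : Set P} {bQ : Set Q} (e : P ≃ₜ Q)
    (he : ∀ p, e p ∈ bQ ↔ p ∈ bP) (h : PairExt Q bQ Y) : PairExt P bP Y := by
  intro f hf
  obtain ⟨F, hF, hFf⟩ := h (f ∘ e.symm) (hf.comp e.symm.continuous.continuousOn fun q hq => by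
    rw [← he]; simpa using hq)
  refine ⟨F ∘ e, hF.comp e.continuous, fun p hp => ?_⟩
  have := hFf ((he p).2 hp)
  simpa using this

/-- The boundary of a product of pairs. -/
def bdProd (bP : Set P) (bQ : Set Q) : Set (P × Q) := {z | z.1 ∈ bP ∨ z.2 ∈ bQ}

theorem isClosed_bdProd {bP : Set P} {bQ : Set Q} (hP : IsClosed bP) (hQ : IsClosed bQ) :
    IsClosed (bdProd bP bQ) :=
  (hP.preimage continuous_fst).union (hQ.preimage continuous_snd)

end PairExt

/-- The unit ball of `ℝ ^ n` for the maximum norm. -/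
abbrev Ball (n : ℕ) : Type := Metric.closedBall (0 : Fin n → ℝ) 1

theorem Ball.norm_le {n : ℕ} (v : Ball n) : ‖v.1‖ ≤ 1 := mem_closedBall_zero_iff.1 v.2

/-- The boundary of the unit ball. -/
def Ball.bd (n : ℕ) : Set (Ball n) := {v | ‖v.1‖ = 1}

theorem Ball.isClosed_bd (n : ℕ) : IsClosed (Ball.bd n) :=
  isClosed_eq (by fun_prop) continuous_const

theorem Ball.abs_le {n : ℕ} (v : Ball n) (i : Fin n) : |v.1 i| ≤ 1 :=
  (norm_le_pi_norm v.1 i).trans v.norm_le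

/-- The ball for the maximum norm is a cube. -/
def ballCube (n : ℕ) : Ball n ≃ₜ (Fin n → I) where
  toFun v i := ⟨(v.1 i + 1) / 2, by
    have := _root_.abs_le.1 (v.abs_le i)
    constructor <;> linarith⟩
  invFun c := ⟨fun i => 2 * (c i : ℝ) - 1, by
    rw [mem_closedBall_zero_iff, pi_norm_le_iff_of_nonneg zero_le_one]
    intro i
    have h0 := (c i).2.1
    have h1 := (c i).2.2
    rw [Real.norm_eq_abs, _root_.abs_le]
    constructor <;> linarith⟩
  left_inv v := by ext i; simp; ring
  right_inv c := by ext i; simp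
  continuous_toFun := continuous_pi fun i => Continuous.subtype_mk
    ((((continuous_apply i).comp continuous_subtype_val).add continuous_const).div_const 2) _
  continuous_invFun := Continuous.subtype_mk (by fun_prop) _

theorem ballCube_mem_boundary {n : ℕ} (v : Ball n) :
    ballCube n v ∈ Cube.boundary (Fin n) ↔ v ∈ Ball.bd n := by
  constructor
  · rintro ⟨i, hi⟩
    refine le_antisymm v.norm_le ?_
    refine le_trans ?_ (norm_le_pi_norm v.1 i)
    rw [Real.norm_eq_abs]
    rcases hi with h | h
    · have h' : (v.1 i + 1) / 2 = 0 := congrArg Subtype.val h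
      have : v.1 i = -1 := by linarith
      simp [this]
    · have h' : (v.1 i + 1) / 2 = 1 := congrArg Subtype.val h
      have : v.1 i = 1 := by linarith
      simp [this]
  · intro h
    have h : ‖v.1‖ = 1 := h
    by_contra hc
    have : ∀ i, ‖v.1 i‖ < 1 := by
      intro i
      refine lt_of_le_of_ne (v.abs_le i) fun hi => hc ⟨i, ?_⟩
      rw [Real.norm_eq_abs] at hi
      rcases (abs_eq zero_le_one).1 hi with h | h
      · right; ext; simp [ballCube, h]
      · left; ext; simp [ballCube, h]
    have := (pi_norm_lt_iff zero_lt_one).2 this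
    exact this.ne h

theorem isClosed_cubeBoundary (n : ℕ) : IsClosed (Cube.boundary (Fin n)) := by
  have : Cube.boundary (Fin n) = ⋃ i : Fin n, {y : Fin n → I | y i = 0 ∨ y i = 1} := by
    ext y; simp [Cube.boundary]
  rw [this]
  exact isClosed_iUnion_of_finite fun i =>
    (isClosed_eq (continuous_apply i) continuous_const).union
      (isClosed_eq (continuous_apply i) continuous_const)

/-- Maps from the boundary of the `n`-cube to `Y` extend to the `n`-cube. -/
abbrev CubeExt (n : ℕ) (Y : Type*) [TopologicalSpace Y] : Prop :=
  PairExt (Fin n → I) (Cube.boundary (Fin n)) Y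

theorem CubeExt.of_ball {n : ℕ} {Y : Type*} [TopologicalSpace Y]
    (h : PairExt (Ball n) (Ball.bd n) Y) : CubeExt n Y :=
  h.of_homeomorph (ballCube n).symm fun c => by
    rw [← ballCube_mem_boundary]; simp

/-- The homotopy extension data of the pair formed by the cube and its boundary. -/
theorem exists_cube_retraction (n : ℕ) :
    ∃ (q : C(Fin n → I, Fin n → I)) (s : C(Fin n → I, I)) (h : C(I × (Fin n → I), Fin n → I)),
      (∀ p ∈ Cube.boundary (Fin n), q p = p ∧ s p = 0) ∧
      (∀ p, s p = 1 ∨ q p ∈ Cube.boundary (Fin n)) ∧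
      (∀ p, h (0, p) = q p) ∧ (∀ p, h (1, p) = p) ∧
      ∀ t, ∀ p ∈ Cube.boundary (Fin n), h (t, p) = p := by
  have hmax : ∀ v : Ball n, 0 < max ‖v.1‖ (1 / 2) := fun v => lt_max_of_lt_right (by norm_num)
  -- `q` doubles the inner ball of radius `1/2` and pushes the outer shell radially to the sphere;
  -- `s` is `1` on the inner ball and decreases to `0` across the shell; `h` is the straight line
  -- homotopy from `q` to the identity.
  let q : C(Ball n, Ball n) :=
    ⟨fun v => ⟨(max ‖v.1‖ (1 / 2))⁻¹ • v.1, by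
      rw [mem_closedBall_zero_iff, norm_smul, norm_inv, Real.norm_eq_abs, abs_of_pos (hmax v),
        inv_mul_le_iff₀ (hmax v), mul_one]
      exact le_max_left _ _⟩, by
      refine Continuous.subtype_mk (Continuous.smul (Continuous.inv₀ (by fun_prop) fun v => (hmax v).ne') (by fun_prop)) _⟩
  let s : C(Ball n, I) := ⟨fun v => ⟨min 1 (2 - 2 * ‖v.1‖), by
    have := v.norm_le
    constructor
    · refine le_min zero_le_one (by linarith)
    · exact min_le_left _ _⟩, by fun_prop⟩
  let h : C(I × Ball n, Ball n) := ⟨fun z => ⟨(z.1 : ℝ) • z.2.1 + (1 - (z.1 : ℝ)) • (q z.2).1, by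
    exact (convex_closedBall (0 : Fin n → ℝ) 1) z.2.2 (q z.2).2 z.1.2.1 (by linarith [z.1.2.2])
      (by ring)⟩, by fun_prop⟩
  have hq : ∀ v ∈ Ball.bd n, q v = v := by
    intro v hv
    have hv : ‖v.1‖ = 1 := hv
    ext i
    simp only [q, ContinuousMap.coe_mk, hv]
    norm_num
  let e := ballCube n
  have hb : ∀ c ∈ Cube.boundary (Fin n), e.symm c ∈ Ball.bd n := fun c hc => by
    rw [← ballCube_mem_boundary]; simpa [e] using hc
  refine ⟨(e : C(_, _)).comp (q.comp (e.symm : C(_, _))), s.comp (e.symm : C(_, _)),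
    (e : C(_, _)).comp (h.comp ⟨fun z => (z.1, e.symm z.2), by fun_prop⟩), ?_, ?_, ?_, ?_, ?_⟩
  · intro p hp
    refine ⟨?_, ?_⟩
    · have := hq _ (hb p hp)
      simp [this]
    · have : ‖(e.symm p).1‖ = 1 := hb p hp
      ext
      simp [s, this]
  · intro p
    by_cases hp : ‖(e.symm p).1‖ ≤ 1 / 2
    · left
      ext
      simp only [s, ContinuousMap.comp_apply, ContinuousMap.coe_mk, Set.Icc.coe_one]
      refine min_eq_left ?_
      change (1 : ℝ) ≤ 2 - 2 * ‖(e.symm p).1‖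
      linarith
    · right
      push Not at hp
      refine (ballCube_mem_boundary _).2 ?_
      change ‖(max ‖(e.symm p).1‖ (1 / 2))⁻¹ • (e.symm p).1‖ = 1
      rw [max_eq_left hp.le, norm_smul, norm_inv, norm_norm]
      exact inv_mul_cancel₀ (by linarith)
  · intro p
    change e (h (0, e.symm p)) = e (q (e.symm p))
    congr 1
    ext i
    simp [h]
  · intro p
    change e (h (1, e.symm p)) = p
    rw [← e.eq_symm_apply]
    ext i
    simp [h]
  · intro t p hp
    change e (h (t, e.symm p)) = p
    rw [← e.eq_symm_apply]
    ext i
    simp only [h, ContinuousMap.coe_mk, hq _ (hb p hp)]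
    simp
    ring

/-- Homotopy extension for a pair with retraction data `q`, `s`. -/
theorem continuous_hep {P Y : Type*} [TopologicalSpace P] [TopologicalSpace Y] {bP : Set P}
    (hbP : IsClosed bP) (q : C(P, P)) (s : C(P, I)) (hqs : ∀ p, s p = 1 ∨ q p ∈ bP)
    {B : P → Y} (hB : Continuous B) {D : P × I → Y} (hD : ContinuousOn D (bP ×ˢ univ))
    (hDB : ∀ p ∈ bP, D (p, 1) = B p) :
    Continuous fun p => open Classical in if s p = 1 then B (q p) else D (q p, s p) := by
  classical
  have c1 : IsClosed {p | s p = 1} := isClosed_eq s.continuous continuous_const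
  have c2 : IsClosed {p | q p ∈ bP} := hbP.preimage q.continuous
  rw [← continuousOn_univ]
  have : (univ : Set P) = {p | s p = 1} ∪ {p | q p ∈ bP} := by
    ext p; simpa using hqs p
  rw [this]
  refine ContinuousOn.union_of_isClosed ?_ ?_ c1 c2
  · refine (hB.comp q.continuous).continuousOn.congr fun p hp => ?_
    exact if_pos hp
  · have : ContinuousOn (fun p => D (q p, s p)) {p | q p ∈ bP} :=
      hD.comp (by fun_prop) fun p hp => ⟨hp, mem_univ _⟩
    refine this.congr fun p hp => ?_
    -- The two closed pieces overlap where `s p = 1` and `q p ∈ bP`; there `hDB` identifies the two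
    -- formulas.
    by_cases h : s p = 1
    · simp [h, hDB _ hp]
    · simp [h]

/-! ## Homotopy groups and extension of maps from boundaries of cubes -/

section Pi

variable {Y : Type*} [TopologicalSpace Y]

theorem cons_mem_boundary {q : ℕ} (t : I) (c : Fin q → I) :
    (Fin.cons t c : Fin (q + 1) → I) ∈ Cube.boundary (Fin (q + 1)) ↔
      (t = 0 ∨ t = 1) ∨ c ∈ Cube.boundary (Fin q) := by
  simp only [Cube.boundary, mem_ofPred_eq, Fin.exists_fin_succ, Fin.cons_zero, Fin.cons_succ]

theorem continuous_finCons {q : ℕ} :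
    Continuous fun z : I × (Fin q → I) => (Fin.cons z.1 z.2 : Fin (q + 1) → I) := by
  refine continuous_pi fun i => ?_
  refine Fin.cases ?_ (fun j => ?_) i
  · simpa using continuous_fst
  · simp only [Fin.cons_succ]
    fun_prop

theorem continuous_finTail {q : ℕ} : Continuous fun x : Fin (q + 1) → I => (Fin.tail x : Fin q → I) :=
  continuous_pi fun i => continuous_apply i.succ

/-- The map on the boundary of the cube that is `f` at the bottom, `g` at the top, and `y` on the
remaining faces. -/
def bottomTop {q : ℕ} (f g : (Fin q → I) → Y) (y : Y) (x : Fin (q + 1) → I) : Y :=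
  open Classical in if x 0 = 0 then f (Fin.tail x) else if x 0 = 1 then g (Fin.tail x) else y

theorem continuousOn_bottomTop {q : ℕ} {y : Y} {f g : (Fin q → I) → Y} (hf : Continuous f)
    (hg : Continuous g) (hfy : ∀ c ∈ Cube.boundary (Fin q), f c = y)
    (hgy : ∀ c ∈ Cube.boundary (Fin q), g c = y) :
    ContinuousOn (bottomTop f g y) (Cube.boundary (Fin (q + 1))) := by
  have hu : Cube.boundary (Fin (q + 1)) =
      ({x | x 0 = 0} ∪ {x | x 0 = 1}) ∪ {x : Fin (q + 1) → I | (Fin.tail x : Fin q → I) ∈ Cube.boundary (Fin q)} := by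
    ext x
    rw [← Fin.cons_self_tail x, cons_mem_boundary]
    simp
  have c0 : IsClosed {x : Fin (q + 1) → I | x 0 = 0} :=
    isClosed_eq (continuous_apply 0) continuous_const
  have c1 : IsClosed {x : Fin (q + 1) → I | x 0 = 1} :=
    isClosed_eq (continuous_apply 0) continuous_const
  have c2 : IsClosed {x : Fin (q + 1) → I | (Fin.tail x : Fin q → I) ∈ Cube.boundary (Fin q)} :=
    (isClosed_cubeBoundary q).preimage continuous_finTail
  rw [hu]
  refine ContinuousOn.union_of_isClosed (ContinuousOn.union_of_isClosed ?_ ?_ c0 c1) ?_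
    (c0.union c1) c2
  · refine (hf.comp continuous_finTail).continuousOn.congr fun x hx => ?_
    have hx : x 0 = 0 := hx
    simp [bottomTop, hx]
  · refine (hg.comp continuous_finTail).continuousOn.congr fun x hx => ?_
    have hx : x 0 = 1 := hx
    simp [bottomTop, hx]
  · refine (continuous_const (y := y)).continuousOn.congr fun x hx => ?_
    simp only [bottomTop, hfy _ hx, hgy _ hx]
    simp

/-- The first coordinate of the cube is the homotopy parameter; the side faces carry the value `y`,
so the homotopy is relative to the boundary. -/
theorem GenLoop.homotopic_of_extension {q : ℕ} {y : Y} {f g : GenLoop (Fin q) Y y}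
    {F : (Fin (q + 1) → I) → Y} (hF : Continuous F)
    (h : EqOn F (bottomTop f g y) (Cube.boundary (Fin (q + 1)))) : GenLoop.Homotopic f g := by
  refine ⟨⟨⟨⟨fun z => F (Fin.cons z.1 z.2), hF.comp continuous_finCons⟩, fun c => ?_, fun c => ?_⟩,
    fun t c hc => ?_⟩⟩
  · change F _ = f c
    rw [h ((cons_mem_boundary _ _).2 (Or.inl (Or.inl rfl)))]
    simp [bottomTop]
  · change F _ = g c
    rw [h ((cons_mem_boundary _ _).2 (Or.inl (Or.inr rfl)))]
    simp [bottomTop]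
  · change F _ = f c
    rw [h ((cons_mem_boundary _ _).2 (Or.inr hc))]
    have h1 : f c = y := f.2 c hc
    have h2 : g c = y := g.2 c hc
    simp [bottomTop, h1, h2]

theorem CubeExt.subsingleton {q : ℕ} (h : CubeExt (q + 1) Y) (y : Y) :
    Subsingleton (HomotopyGroup.Pi q Y y) := by
  refine ⟨fun a b => ?_⟩
  induction a using Quotient.inductionOn with | _ f =>
  induction b using Quotient.inductionOn with | _ g =>
  obtain ⟨F, hF, hFb⟩ := h _ (continuousOn_bottomTop f.1.continuous g.1.continuous f.2 g.2)
  exact Quotient.sound (GenLoop.homotopic_of_extension hF hFb)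

end Pi

/-! ### Wrapping a ball around the boundary of the next ball -/

section Pi

variable {Y : Type*} [TopologicalSpace Y]

theorem norm_finCons {q : ℕ} (a : ℝ) (w : Fin q → ℝ) :
    ‖(Fin.cons a w : Fin (q + 1) → ℝ)‖ = max |a| ‖w‖ := by
  refine le_antisymm ?_ (max_le ?_ ?_)
  · rw [pi_norm_le_iff_of_nonneg (le_max_of_le_left (abs_nonneg a))]
    intro i
    refine Fin.cases ?_ (fun j => ?_) i
    · simp
    · simpa using Or.inr (norm_le_pi_norm w j)
  · simpa using norm_le_pi_norm (Fin.cons a w : Fin (q + 1) → ℝ) 0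
  · rw [pi_norm_le_iff_of_nonneg (norm_nonneg _)]
    intro j
    simpa using norm_le_pi_norm (Fin.cons a w : Fin (q + 1) → ℝ) j.succ

/-- A surjection from a compact space to a Hausdorff space is closed, and so is its product with
`I`; hence the product is a quotient map and homotopies descend. -/
theorem exists_homotopy_lift {T S : Type*} [TopologicalSpace T] [TopologicalSpace S]
    [CompactSpace T] [T2Space S] (k : C(T, S)) (hk : Function.Surjective k) (Γ : C(I × T, Y))
    (hΓ : ∀ t w w', k w = k w' → Γ (t, w) = Γ (t, w')) :
    ∃ H : C(I × S, Y), ∀ t w, H (t, k w) = Γ (t, w) := by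
  let K : C(I × T, I × S) := ⟨fun z => (z.1, k z.2), by fun_prop⟩
  have hK : IsQuotientMap K :=
    K.continuous.isClosedMap.isQuotientMap K.continuous fun z => by
      obtain ⟨w, hw⟩ := hk z.2
      exact ⟨(z.1, w), Prod.ext rfl hw⟩
  have hf : Function.FactorsThrough Γ K := by
    rintro ⟨t, w⟩ ⟨t', w'⟩ h
    have h1 : t = t' := congrArg Prod.fst h
    have h2 : k w = k w' := congrArg Prod.snd h
    subst h1
    exact hΓ _ _ _ h2
  exact ⟨IsQuotientMap.lift hK Γ hf, fun t w =>
    congrArg (fun F : C(I × T, Y) => F (t, w)) (IsQuotientMap.lift_comp hK Γ hf)⟩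

/-- The height of the map that wraps a ball around the boundary of a ball. -/
def wrapHeight (s : ℝ) : ℝ := max (-1) (min 1 (6 * s - 3))

/-- The radial scale of the map that wraps a ball around the boundary of a ball. -/
def wrapScale (s : ℝ) : ℝ := min 1 (3 - 3 * s) / max s (1 / 3)

/-- The three zones of the radius: the inner third covers the bottom face, the middle third runs up
the sides, and the outer third covers the top face from its rim to its centre, where the whole
boundary is collapsed. -/
theorem wrap_cases (s : ℝ) :
    (s ≤ 1 / 3 ∧ wrapHeight s = -1 ∧ wrapScale s = 3) ∨
    (1 / 3 ≤ s ∧ s ≤ 2 / 3 ∧ wrapHeight s = 6 * s - 3 ∧ wrapScale s * s = 1) ∨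
    (2 / 3 ≤ s ∧ wrapHeight s = 1 ∧ wrapScale s * s = 3 - 3 * s) := by
  unfold wrapHeight wrapScale
  rcases le_total s (1 / 3) with h | h
  · left
    refine ⟨h, ?_, ?_⟩
    · rw [min_eq_right (by linarith), max_eq_left (by linarith)]
    · rw [min_eq_left (by linarith), max_eq_right h]
      norm_num
  · rcases le_total s (2 / 3) with h' | h'
    · right; left
      refine ⟨h, h', ?_, ?_⟩
      · rw [min_eq_right (by linarith), max_eq_right (by linarith)]
      · rw [min_eq_left (by linarith), max_eq_left h]
        field_simp
    · right; right
      refine ⟨h', ?_, ?_⟩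
      · rw [min_eq_left (by linarith), max_eq_right (by linarith)]
      · rw [min_eq_right (by linarith), max_eq_left h]
        field_simp

theorem wrapScale_nonneg {s : ℝ} (h1 : s ≤ 1) : 0 ≤ wrapScale s :=
  div_nonneg (le_min zero_le_one (by linarith)) (le_max_of_le_right (by norm_num))

/-- The `q`-ball is wrapped around the boundary of the `(q + 1)`-ball, the boundary being
collapsed to a point. -/
def wrap (q : ℕ) (w : Ball q) : Fin (q + 1) → ℝ :=
  Fin.cons (wrapHeight ‖w.1‖) (wrapScale ‖w.1‖ • w.1)

theorem continuous_wrap (q : ℕ) : Continuous (wrap q) := by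
  have h1 : Continuous fun w : Ball q => wrapHeight ‖w.1‖ := by
    unfold wrapHeight; fun_prop
  have h2 : Continuous fun w : Ball q => wrapScale ‖w.1‖ := by
    unfold wrapScale
    exact Continuous.div (by fun_prop) (by fun_prop)
      fun w => (lt_max_of_lt_right (by norm_num : (0 : ℝ) < 1 / 3)).ne'
  refine continuous_pi fun i => ?_
  refine Fin.cases ?_ (fun j => ?_) i
  · simpa [wrap] using h1
  · simp only [wrap, Fin.cons_succ, Pi.smul_apply, smul_eq_mul]
    exact h2.mul ((continuous_apply j).comp continuous_subtype_val)

theorem norm_wrap {q : ℕ} (w : Ball q) : ‖wrap q w‖ = 1 := by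
  have h0 := norm_nonneg w.1
  have h1 := w.norm_le
  rw [wrap, norm_finCons, norm_smul, Real.norm_eq_abs, abs_of_nonneg (wrapScale_nonneg h1)]
  rcases wrap_cases ‖w.1‖ with ⟨h, ha, hb⟩ | ⟨h, h', ha, hb⟩ | ⟨h, ha, hb⟩ <;> rw [ha, hb]
  · rw [abs_neg, abs_one]
    exact max_eq_left (by linarith)
  · refine max_eq_right ?_
    rw [abs_le]
    constructor <;> linarith
  · rw [abs_one]
    exact max_eq_left (by linarith)

/-- Height and norm of the horizontal part together determine the radius in each zone. At equal
radii below `1` the common scale factor is nonzero and can be cancelled. -/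
theorem wrap_eq {q : ℕ} {w w' : Ball q} (h : wrap q w = wrap q w') :
    w = w' ∨ (w ∈ Ball.bd q ∧ w' ∈ Ball.bd q) := by
  have e1 : wrapHeight ‖w.1‖ = wrapHeight ‖w'.1‖ := by simpa [wrap] using congrFun h 0
  have e2 : wrapScale ‖w.1‖ • w.1 = wrapScale ‖w'.1‖ • w'.1 := by
    ext j
    simpa [wrap] using congrFun h j.succ
  have e3 : wrapScale ‖w.1‖ * ‖w.1‖ = wrapScale ‖w'.1‖ * ‖w'.1‖ := by
    have := congrArg norm e2
    rwa [norm_smul, norm_smul, Real.norm_eq_abs, Real.norm_eq_abs,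
      abs_of_nonneg (wrapScale_nonneg w.norm_le), abs_of_nonneg (wrapScale_nonneg w'.norm_le)]
      at this
  have hs : ‖w.1‖ = ‖w'.1‖ := by
    rcases wrap_cases ‖w.1‖ with ⟨h, ha, hb⟩ | ⟨h, h', ha, hb⟩ | ⟨h, ha, hb⟩ <;>
    rcases wrap_cases ‖w'.1‖ with
      ⟨k, ka, kb⟩ | ⟨k, k', ka, kb⟩ | ⟨k, ka, kb⟩ <;>
    rw [ha, ka] at e1 <;> rw [hb, kb] at e3 <;> linarith
  by_cases h1 : ‖w.1‖ = 1
  · exact Or.inr ⟨h1, hs.symm.trans h1⟩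
  · left
    have hlt : ‖w.1‖ < 1 := lt_of_le_of_ne w.norm_le h1
    have hne : wrapScale ‖w.1‖ ≠ 0 := by
      refine (div_pos (lt_min zero_lt_one (by linarith)) (lt_max_of_lt_right (by norm_num))).ne'
    rw [← hs] at e2
    exact Subtype.ext (smul_right_injective _ hne e2)

theorem exists_wrap_eq {q : ℕ} {v : Fin (q + 1 + 1) → ℝ} (hv : ‖v‖ = 1) :
    ∃ w, wrap (q + 1) w = v := by
  obtain ⟨a, u, rfl⟩ : ∃ (a : ℝ) (u : Fin (q + 1) → ℝ), v = Fin.cons a u :=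
    ⟨v 0, Fin.tail v, (Fin.cons_self_tail v).symm⟩
  rw [norm_finCons] at hv
  have ha : |a| ≤ 1 := hv ▸ le_max_left _ _
  have hu : ‖u‖ ≤ 1 := hv ▸ le_max_right _ _
  have ha' := abs_le.1 ha
  have key : ∀ (s : ℝ) (u' : Fin (q + 1) → ℝ), 0 ≤ s → s ≤ 1 → ‖u'‖ = s → wrapHeight s = a →
      wrapScale s • u' = u → ∃ w, wrap (q + 1) w = Fin.cons a u := by
    intro s u' h0 h1 hu' hh hs
    refine ⟨⟨u', by rw [mem_closedBall_zero_iff, hu']; exact h1⟩, ?_⟩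
    simp only [wrap, hu', hh, hs]
  have hcase : ‖u‖ = 1 ∨ |a| = 1 := by
    rcases max_choice |a| ‖u‖ with h | h
    · exact Or.inr (h ▸ hv)
    · exact Or.inl (h ▸ hv)
  by_cases h1 : ‖u‖ = 1
  -- On the sides the height is `6 s - 3`, so height `a` forces the radius `(a + 3) / 6`.
  · have s1 : (1 : ℝ) / 3 ≤ (a + 3) / 6 := by linarith
    have s2 : (a + 3) / 6 ≤ 2 / 3 := by linarith
    refine key ((a + 3) / 6) (((a + 3) / 6) • u) (by linarith) (by linarith) ?_ ?_ ?_
    · rw [norm_smul, h1, mul_one, Real.norm_eq_abs, abs_of_nonneg (by linarith)]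
    · unfold wrapHeight
      rw [min_eq_right (by linarith), max_eq_right (by linarith)]
      ring
    · rw [smul_smul]
      unfold wrapScale
      rw [min_eq_left (by linarith), max_eq_left (by linarith)]
      rw [div_mul_cancel₀ _ (by linarith : (a + 3) / 6 ≠ 0), one_smul]
  · have hlt : ‖u‖ < 1 := lt_of_le_of_ne hu h1
    rcases (abs_eq zero_le_one).1 (hcase.resolve_left h1) with h | h
    · by_cases hu0 : u = 0
      -- The centre of the top face is the image of the boundary sphere. A boundary point exists
      -- because the ball has positive dimension, which is why the statement starts from `q + 1`.
      · refine key 1 (fun _ => 1) zero_le_one le_rfl ?_ ?_ ?_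
        · simp
        · unfold wrapHeight; rw [h]; norm_num
        · unfold wrapScale; rw [hu0]; norm_num
      · have hpos : 0 < ‖u‖ := norm_pos_iff.2 hu0
        -- On the top face the horizontal norm is `3 - 3 s`, which gives the radius `1 - ‖u‖ / 3`.
        refine key (1 - ‖u‖ / 3) (((1 - ‖u‖ / 3) / ‖u‖) • u) (by linarith) (by linarith) ?_ ?_ ?_
        · rw [norm_smul, Real.norm_eq_abs, abs_of_nonneg (div_nonneg (by linarith) hpos.le),
            div_mul_cancel₀ _ hpos.ne']
        · unfold wrapHeight
          rw [min_eq_left (by linarith), max_eq_right (by linarith), h]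
        · rw [smul_smul]
          unfold wrapScale
          rw [min_eq_right (by linarith), max_eq_left (by linarith)]
          have h3 : (1 - ‖u‖ / 3) ≠ 0 := by linarith
          have : (3 - 3 * (1 - ‖u‖ / 3)) / (1 - ‖u‖ / 3) * ((1 - ‖u‖ / 3) / ‖u‖) = 1 := by
            rw [div_mul_div_cancel₀ h3]
            field_simp
            ring
          rw [this, one_smul]
    · have := norm_nonneg u
      -- On the bottom face the scale is `3`, so the preimage of `u` is `u / 3`.
      refine key (‖u‖ / 3) ((1 / 3 : ℝ) • u) (by linarith) (by linarith) ?_ ?_ ?_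
      · rw [norm_smul]; norm_num; ring
      · unfold wrapHeight
        rw [min_eq_right (by linarith), max_eq_left (by linarith), h]
      · rw [smul_smul]
        unfold wrapScale
        rw [min_eq_left (by linarith), max_eq_right (by linarith)]
        norm_num

/-- A map on the boundary of a cube that is null-homotopic extends to the cube. -/
theorem exists_extension_of_nullhomotopy {n : ℕ} {f : (Fin n → I) → Y} {z : Y}
    (H : C(I × Cube.boundary (Fin n), Y)) (h0 : ∀ c, H (0, c) = f c.1) (h1 : ∀ c, H (1, c) = z) :
    ∃ F : (Fin n → I) → Y, Continuous F ∧ EqOn F f (Cube.boundary (Fin n)) := by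
  classical
  obtain ⟨q, s, -, hq, hqs, -⟩ := exists_cube_retraction n
  let D : (Fin n → I) × I → Y := fun p =>
    if hp : p.1 ∈ Cube.boundary (Fin n) then H (p.2, ⟨p.1, hp⟩) else z
  have hD : ContinuousOn D (Cube.boundary (Fin n) ×ˢ univ) := by
    rw [continuousOn_iff_continuous_domRestrict]
    have : (Cube.boundary (Fin n) ×ˢ univ).domRestrict D = fun p => H (p.1.2, ⟨p.1.1, p.2.1⟩) := by
      ext p
      exact dif_pos p.2.1
    rw [this]
    fun_prop
  refine ⟨_, continuous_hep (isClosed_cubeBoundary n) q s hqs (continuous_const (y := z)) hD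
    fun p hp => ?_, fun p hp => ?_⟩
  · exact (dif_pos hp).trans (h1 _)
  · obtain ⟨e1, e2⟩ := hq p hp
    simp only [e1, e2]
    rw [if_neg zero_ne_one]
    exact (dif_pos hp).trans (h0 _)

/-- For `q = 0` two points have to be joined by a path. For `q > 0` the map on the boundary sphere
is pulled back along `wrap` to a loop based at the image of the collapsed boundary; a null-homotopy
of the loop descends to the sphere and yields the extension. -/
theorem CubeExt.of_subsingleton {q : ℕ} (h : ∀ y : Y, Subsingleton (HomotopyGroup.Pi q Y y)) :
    CubeExt (q + 1) Y := by
  intro f hf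
  cases q with
  | zero =>
    let c0 : Fin 1 → I := fun _ => 0
    let c1 : Fin 1 → I := fun _ => 1
    have hbd : ∀ c, c ∉ Cube.boundary (Fin 0) := fun c ⟨i, _⟩ => i.elim0
    let g0 : GenLoop (Fin 0) Y (f c0) := ⟨ContinuousMap.const _ (f c0), fun c hc => (hbd c hc).elim⟩
    let g1 : GenLoop (Fin 0) Y (f c0) := ⟨ContinuousMap.const _ (f c1), fun c hc => (hbd c hc).elim⟩
    obtain ⟨H⟩ : GenLoop.Homotopic g0 g1 :=
      Quotient.exact ((h (f c0)).elim (Quotient.mk _ g0) (Quotient.mk _ g1))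
    refine ⟨fun c => H (c 0, Fin.elim0), by fun_prop, ?_⟩
    rintro c ⟨i, hi⟩
    obtain rfl : i = 0 := Subsingleton.elim (α := Fin 1) _ _
    rcases hi with hi | hi
    · have : c = c0 := by ext j; rw [Subsingleton.elim (α := Fin 1) j 0, hi]
      subst this
      exact H.map_zero_left _
    · have : c = c1 := by ext j; rw [Subsingleton.elim (α := Fin 1) j 0, hi]
      subst this
      exact H.map_one_left _
  | succ q =>
    let e := ballCube (q + 1)
    let e' := ballCube (q + 1 + 1)
    let k : C(Fin (q + 1) → I, Cube.boundary (Fin (q + 1 + 1))) :=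
      ⟨fun c => ⟨e' ⟨wrap (q + 1) (e.symm c), by rw [mem_closedBall_zero_iff, norm_wrap]⟩,
        (ballCube_mem_boundary _).2 (norm_wrap _)⟩, by
        refine Continuous.subtype_mk (e'.continuous.comp (Continuous.subtype_mk ?_ _)) _
        exact (continuous_wrap _).comp e.symm.continuous⟩
    have hk : Function.Surjective k := by
      rintro ⟨c, hc⟩
      have hc' : e'.symm c ∈ Ball.bd (q + 1 + 1) := by
        rw [← ballCube_mem_boundary]; simpa [e'] using hc
      obtain ⟨w, hw⟩ := exists_wrap_eq hc'
      refine ⟨e w, Subtype.ext ?_⟩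
      change e' _ = c
      rw [← e'.eq_symm_apply]
      ext1
      simpa using hw
    have hk' : ∀ c c', k c = k c' →
        c = c' ∨ c ∈ Cube.boundary (Fin (q + 1)) ∧ c' ∈ Cube.boundary (Fin (q + 1)) := by
      intro c c' hcc
      have h1 := congrArg Subtype.val (e'.injective (congrArg Subtype.val hcc))
      have h2 : ∀ c, e.symm c ∈ Ball.bd (q + 1) → c ∈ Cube.boundary (Fin (q + 1)) := fun c hc => by
        have := (ballCube_mem_boundary (e.symm c)).2 hc
        simpa [e] using this
      exact (wrap_eq h1).imp (fun h => e.symm.injective h) fun h => ⟨h2 _ h.1, h2 _ h.2⟩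
    let z0 : Y := f (k (fun _ => 0)).1
    have hb0 : (fun _ => 0 : Fin (q + 1) → I) ∈ Cube.boundary (Fin (q + 1)) := ⟨0, Or.inl rfl⟩
    have hkb : ∀ c ∈ Cube.boundary (Fin (q + 1)), ∀ c' ∈ Cube.boundary (Fin (q + 1)),
        k c = k c' := by
      intro c hc c' hc'
      have h2 : ∀ c ∈ Cube.boundary (Fin (q + 1)), ‖(e.symm c).1‖ = 1 := fun c hc => by
        have : e.symm c ∈ Ball.bd (q + 1) := by
          rw [← ballCube_mem_boundary]; simpa [e] using hc
        exact this
      have h3 : wrap (q + 1) (e.symm c) = wrap (q + 1) (e.symm c') := by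
        unfold wrap
        rw [h2 c hc, h2 c' hc']
        have : wrapScale 1 = 0 := by unfold wrapScale; norm_num
        rw [this, zero_smul, zero_smul]
      refine Subtype.ext ?_
      change e' _ = e' _
      congr 2
    let g : GenLoop (Fin (q + 1)) Y z0 :=
      ⟨⟨fun c => f (k c).1, hf.comp_continuous (by fun_prop) fun c => (k c).2⟩, fun c hc => by
        change f (k c).1 = f _
        rw [hkb c hc _ hb0]⟩
    obtain ⟨Γ⟩ : GenLoop.Homotopic g GenLoop.const :=
      Quotient.exact ((h z0).elim (Quotient.mk _ g) (Quotient.mk _ GenLoop.const))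
    have hΓb : ∀ t, ∀ c ∈ Cube.boundary (Fin (q + 1)), Γ (t, c) = z0 := fun t c hc =>
      (Γ.eq_fst t hc).trans (g.2 c hc)
    -- `k` identifies only boundary points with each other, and there a homotopy of loops is
    -- constantly `z0`.
    obtain ⟨H, hH⟩ := exists_homotopy_lift k hk Γ.toContinuousMap (by
      intro t w w' hw
      rcases hk' w w' hw with rfl | ⟨h1, h2⟩
      · rfl
      · exact (hΓb t w h1).trans (hΓb t w' h2).symm)
    refine exists_extension_of_nullhomotopy H (z := z0) (fun c => ?_) fun c => ?_
    · obtain ⟨w, rfl⟩ := hk c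
      exact (hH 0 w).trans (Γ.map_zero_left w)
    · obtain ⟨w, rfl⟩ := hk c
      exact (hH 1 w).trans (Γ.map_one_left w)

end Pi

/-! ## A criterion for weak equivalences -/

/-- `p` has a section `s`, and `D` deforms the identity to `s ∘ p` along the fibres of `p`.
Continuity is demanded only on cubes and compact Hausdorff test spaces, since it will be applied to
fixed point subspaces of compactly generated refinements. -/
theorem isWeakEquiv_of_contraction {Y Z : Type u} [TopologicalSpace Y] [TopologicalSpace Z]
    (p : C(Y, Z)) (s : Z → Y) (D : I → Y → Y)
    (hs : ∀ (n : ℕ) (b : (Fin n → I) → Z), Continuous b → Continuous fun c => s (b c))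
    (hD : ∀ (T : Type) [TopologicalSpace T] [CompactSpace T] [T2Space T] (b : T → Y),
      Continuous b → Continuous fun z : T × I => D z.2 (b z.1))
    (h0 : ∀ y, D 0 y = y) (h1 : ∀ y, D 1 y = s (p y)) (hp : ∀ t y, p (D t y) = p y)
    (hps : ∀ z, p (s z) = z) : IsWeakEquiv p := by
  classical
  refine ⟨fun hY => ⟨fun z => hY.false (s z)⟩, fun n y => ⟨?_, ?_⟩⟩
  · intro a b hab
    induction a using Quotient.inductionOn with | _ f =>
    induction b using Quotient.inductionOn with | _ g =>
    obtain ⟨h⟩ := Quotient.exact hab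
    -- Injectivity: a homotopy `h` from `p f` to `p g` is lifted to `s ∘ h`, and `D` fills the
    -- collar between `b` on the boundary and `s (p b)`.
    let b := bottomTop f g y
    have hb : ContinuousOn b _ := continuousOn_bottomTop f.1.continuous g.1.continuous f.2 g.2
    let B : (Fin (n + 1) → I) → Y := fun x => s (h (x 0, Fin.tail x))
    have hB : Continuous B := hs _ _ (h.continuous.comp
      ((continuous_apply 0).prodMk continuous_finTail))
    obtain ⟨q, r, -, hq, hqr, -⟩ := exists_cube_retraction (n + 1)
    have hDc : ContinuousOn (fun z : (Fin (n + 1) → I) × I => D z.2 (b z.1))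
        (Cube.boundary (Fin (n + 1)) ×ˢ univ) := by
      rw [continuousOn_iff_continuous_domRestrict] at hb ⊢
      have : CompactSpace (Cube.boundary (Fin (n + 1))) :=
        isCompact_iff_compactSpace.1 (isClosed_cubeBoundary _).isCompact
      have := hD _ _ hb
      exact this.comp (f := fun z : ↥(Cube.boundary (Fin (n + 1)) ×ˢ (univ : Set I)) =>
        ((⟨z.1.1, z.2.1⟩ : Cube.boundary (Fin (n + 1))), z.1.2)) (by fun_prop)
    refine Quotient.sound (GenLoop.homotopic_of_extension
      (continuous_hep (isClosed_cubeBoundary _) q r hqr hB hDc fun x hx => ?_) fun x hx => ?_)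
    · change D 1 (b x) = s (h (x 0, Fin.tail x))
      rw [h1]
      congr 1
      change p (bottomTop f g y x) = _
      rw [← Fin.cons_self_tail x, cons_mem_boundary] at hx
      by_cases hx0 : x 0 = 0
      · simp only [bottomTop, if_pos hx0]
        rw [hx0]
        exact (h.map_zero_left _).symm
      by_cases hx1 : x 0 = 1
      · simp only [bottomTop, hx1]
        rw [if_neg one_ne_zero]
        exact (h.map_one_left _).symm
      have hx' : (Fin.tail x : Fin n → I) ∈ Cube.boundary (Fin n) := by
        simpa [hx0, hx1] using hx
      simp only [bottomTop, if_neg hx1, if_neg hx0]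
      refine Eq.trans ?_ (h.eq_fst _ hx').symm
      exact (congrArg p (f.2 _ hx')).symm
    · obtain ⟨e1, e2⟩ := hq x hx
      simp only [e1, e2]
      rw [if_neg zero_ne_one]
      exact h0 _
  · intro a
    induction a using Quotient.inductionOn with | _ g =>
    -- Surjectivity: `s ∘ g` need not send the boundary to `y`, so a collar running along `D` from
    -- `y` to `s (p y)` is attached. The result lies over `g ∘ q`, which `h` deforms to `g` relative
    -- to the boundary.
    obtain ⟨q, r, h, hq, hqr, hh0, hh1, hhb⟩ := exists_cube_retraction n
    have hDc : Continuous (fun z : (Fin n → I) × I => D z.2 y) :=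
      hD _ (fun _ => y) continuous_const
    have hc := continuous_hep (isClosed_cubeBoundary _) q r hqr (hs _ _ g.1.continuous)
      hDc.continuousOn fun x hx => by
        change D 1 y = s (g.1 x)
        rw [h1]
        congr 1
        exact (g.2 x hx).symm
    let f : GenLoop (Fin n) Y y := ⟨⟨_, hc⟩, fun x hx => by
      obtain ⟨e1, e2⟩ := hq x hx
      simp only [ContinuousMap.coe_mk, e2]
      rw [if_neg zero_ne_one]
      exact h0 _⟩
    have hf : ∀ x, p (f x) = g (q x) := by
      intro x
      change p (if r x = 1 then s (g.1 (q x)) else D (r x) y) = _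
      split_ifs with hx
      · exact hps _
      · rw [hp]
        exact (g.2 _ ((hqr x).resolve_left hx)).symm
    refine ⟨Quotient.mk _ f, Quotient.sound ?_⟩
    refine ⟨⟨⟨g.1.comp h, fun x => ?_, fun x => ?_⟩, fun t x hx => ?_⟩⟩
    · change g (h (0, x)) = p (f x)
      rw [hh0, hf]
    · change g (h (1, x)) = g x
      rw [hh1]
    · change g (h (t, x)) = p (f x)
      rw [hhb t x hx, hf, (hq x hx).1]

/-! ## Relative extension over cubes -/

section Slab

variable {Y : Type*} [TopologicalSpace Y]

theorem isClosed_zero_one : IsClosed ({t | t = 0 ∨ t = 1} : Set I) :=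
  (isClosed_eq continuous_id continuous_const).union (isClosed_eq continuous_id continuous_const)

/-- One cube coordinate is moved to the parameter space; the boundary of the product is unchanged.
This lets the induction on `m` treat a slab as a family over `P × I`. -/
theorem PairExt.prod_interval {P : Type*} [TopologicalSpace P] {bP : Set P} {j : ℕ}
    (h : PairExt (P × (Fin (j + 1) → I)) (bdProd bP (Cube.boundary (Fin (j + 1)))) Y) :
    PairExt ((P × I) × (Fin j → I))
      (bdProd (bdProd bP {t : I | t = 0 ∨ t = 1}) (Cube.boundary (Fin j))) Y := by
  let e : (P × I) × (Fin j → I) ≃ₜ P × (Fin (j + 1) → I) :=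
    { toFun := fun z => (z.1.1, Fin.cons z.1.2 z.2)
      invFun := fun z => ((z.1, z.2 0), Fin.tail z.2)
      left_inv := fun z => by simp
      right_inv := fun z => by simp
      continuous_toFun := (continuous_fst.comp continuous_fst).prodMk
        (continuous_finCons.comp ((continuous_snd.comp continuous_fst).prodMk continuous_snd))
      continuous_invFun := (continuous_fst.prodMk
        ((continuous_apply 0).comp continuous_snd)).prodMk
        (continuous_finTail.comp continuous_snd) }
  refine h.of_homeomorph e fun z => ?_
  change (z.1.1 ∈ bP ∨ (Fin.cons z.1.2 z.2 : Fin (j + 1) → I) ∈ _) ↔ ((z.1.1 ∈ bP ∨ (z.1.2 = 0 ∨ z.1.2 = 1)) ∨ _)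
  rw [cons_mem_boundary]
  tauto

/-- The point `(i + τ) / M` of the unit interval. -/
def slabPt (M i : ℕ) (τ : I) : I := projIcc 0 1 zero_le_one ((i + τ) / M)

theorem continuous_slabPt (M i : ℕ) : Continuous (slabPt M i) :=
  continuous_projIcc.comp (by fun_prop)

theorem slabPt_one (M i : ℕ) : slabPt M i 1 = slabPt M (i + 1) 0 := by
  simp [slabPt]

theorem dist_slabPt_le (M i : ℕ) (τ τ' : I) : dist (slabPt M i τ) (slabPt M i τ') ≤ 1 / M := by
  have h : |((i : ℝ) + τ) / M - (i + τ') / M| ≤ 1 / M := by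
    rw [← sub_div, abs_div, Nat.abs_cast]
    gcongr
    rw [add_sub_add_left_eq_sub, abs_le]
    constructor <;> linarith [τ.2.1, τ.2.2, τ'.2.1, τ'.2.2]
  refine le_trans ?_ h
  rw [Subtype.dist_eq, Real.dist_eq]
  exact Set.abs_projIcc_sub_projIcc zero_le_one

theorem slabPt_projIcc {M i : ℕ} (hM : 0 < M) {t : I} (h0 : (i : ℝ) / M ≤ t)
    (h1 : (t : ℝ) ≤ (i + 1) / M) :
    slabPt M i (projIcc 0 1 zero_le_one (t * M - i)) = t := by
  have hM' : (0 : ℝ) < M := by exact_mod_cast hM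
  rw [div_le_iff₀ hM'] at h0
  rw [le_div_iff₀ hM'] at h1
  rw [slabPt, projIcc_of_mem zero_le_one (⟨by linarith, by linarith⟩ : (t : ℝ) * M - i ∈ Icc 0 1)]
  have : ((i : ℝ) + (t * M - i)) / M = t := by
    rw [add_sub_cancel]
    exact mul_div_cancel_right₀ _ hM'.ne'
  change projIcc 0 1 zero_le_one (((i : ℝ) + (t * M - i)) / M) = t
  rw [this, projIcc_val]

/-- A map that is defined on the boundary of `P × I ^ m` and on `P × W`, `W` open, extends to
`P × I ^ m` after shrinking `W`, if maps from the boundaries of `P × I ^ j` extend for `j ≤ m`. -/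
theorem exists_relative_extension (m : ℕ) : ∀ {P : Type} [TopologicalSpace P] {bP : Set P},
    IsClosed bP →
    (∀ j ≤ m, PairExt (P × (Fin j → I)) (bdProd bP (Cube.boundary (Fin j))) Y) →
    ∀ {W N : Set (Fin m → I)}, IsOpen W → IsClosed N → N ⊆ W →
    ∀ f : P × (Fin m → I) → Y, ContinuousOn f (bdProd bP (Cube.boundary (Fin m))) →
    ContinuousOn f (univ ×ˢ W) →
    ∃ F : P × (Fin m → I) → Y, Continuous F ∧ EqOn F f (bdProd bP (Cube.boundary (Fin m))) ∧
      EqOn F f (univ ×ˢ N) := by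
  classical
  induction m with
  | zero =>
    intro P _ bP hbP hext W N hW hN hNW f hf hfW
    -- `I ^ 0` is a point, so if `N` is nonempty then `W` is everything and `f` is already
    -- continuous.
    by_cases hne : N.Nonempty
    · have hWu : W = univ := by
        obtain ⟨x, hx⟩ := hne
        ext y
        simpa [Subsingleton.elim y x] using hNW hx
      rw [hWu, univ_prod_univ, continuousOn_univ] at hfW
      exact ⟨f, hfW, fun _ _ => rfl, fun _ _ => rfl⟩
    · obtain ⟨F, hF, hFf⟩ := hext 0 le_rfl f hf
      rw [not_nonempty_iff_eq_empty] at hne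
      exact ⟨F, hF, hFf, by simp [hne]⟩
  | succ m ih =>
    intro P _ bP hbP hext W N hW hN hNW f hf hfW
    -- The walls will agree with `f` on all of `closure O`, so that a slab segment meeting `N`,
    -- which lies in `O` when the slabs are thin, sees prescribed values at both of its ends.
    obtain ⟨O, hO, hNO, hOW⟩ := normal_exists_closure_subset hN hW hNW
    have consc : ∀ t : I, Continuous fun c : Fin m → I => (Fin.cons t c : Fin (m + 1) → I) :=
      fun t => continuous_finCons.comp (continuous_const.prodMk continuous_id)
    have consP : ∀ t : I, Continuous
        fun z : P × (Fin m → I) => (z.1, (Fin.cons t z.2 : Fin (m + 1) → I)) :=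
      fun t => continuous_fst.prodMk ((consc t).comp continuous_snd)
    have hext1 : ∀ j ≤ m, PairExt (P × (Fin j → I)) (bdProd bP (Cube.boundary (Fin j))) Y :=
      fun j hj => hext j (by omega)
    -- the walls
    have walls : ∀ t : I, ∃ G : P × (Fin m → I) → Y, Continuous G ∧
        ∀ p c, p ∈ bP ∨ c ∈ Cube.boundary (Fin m) ∨ (t = 0 ∨ t = 1) ∨
          (Fin.cons t c : Fin (m + 1) → I) ∈ closure O → G (p, c) = f (p, Fin.cons t c) := by
      intro t
      by_cases ht : t = 0 ∨ t = 1
      · refine ⟨fun z => f (z.1, Fin.cons t z.2), ?_, fun _ _ _ => rfl⟩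
        exact hf.comp_continuous (consP t) fun z => Or.inr ((cons_mem_boundary _ _).2 (Or.inl ht))
      · obtain ⟨G, hG, h1, h2⟩ := ih hbP hext1
          (W := {c | (Fin.cons t c : Fin (m + 1) → I) ∈ W})
          (N := {c | (Fin.cons t c : Fin (m + 1) → I) ∈ closure O})
          (hW.preimage (consc t)) (isClosed_closure.preimage (consc t)) (fun c hc => hOW hc)
          (fun z => f (z.1, Fin.cons t z.2))
          (hf.comp (consP t).continuousOn fun z hz => hz.imp id fun h =>
            (cons_mem_boundary _ _).2 (Or.inr h))
          (hfW.comp (consP t).continuousOn fun z hz => ⟨mem_univ _, hz.2⟩)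
        refine ⟨G, hG, fun p c hpc => ?_⟩
        rcases hpc with h | h | h | h
        · exact h1 (Or.inl h)
        · exact h1 (Or.inr h)
        · exact (ht h).elim
        · exact h2 ⟨mem_univ _, h⟩
    choose G hG hGf using walls
    -- the number of slabs
    obtain ⟨δ, hδ, hδO⟩ := hN.isCompact.exists_thickening_subset_open hO hNO
    obtain ⟨M', hM'⟩ := exists_nat_one_div_lt hδ
    obtain ⟨M, hM0, hMδ⟩ : ∃ M : ℕ, 0 < M ∧ (1 : ℝ) / M < δ :=
      ⟨M' + 1, by omega, by exact_mod_cast hM'⟩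
    have hMpos : (0 : ℝ) < M := by exact_mod_cast hM0
    have hNt : ∀ (i : ℕ) (τ τ' : I) (c : Fin m → I),
        (Fin.cons (slabPt M i τ) c : Fin (m + 1) → I) ∈ N →
        (Fin.cons (slabPt M i τ') c : Fin (m + 1) → I) ∈ O := by
      intro i τ τ' c hc
      refine hδO (Metric.mem_thickening_iff.2 ⟨_, hc, lt_of_le_of_lt ?_ hMδ⟩)
      rw [dist_pi_le_iff (by positivity)]
      intro k
      refine Fin.cases ?_ (fun k => ?_) k
      · simpa using dist_slabPt_le M i τ' τ
      · simp
    -- the maps on the boundaries of the slabs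
    let s : ℕ → I → I := slabPt M
    let g : ℕ → (P × I) × (Fin m → I) → Y := fun i z =>
      if z.1.2 = 0 then G (s i 0) (z.1.1, z.2) else if z.1.2 = 1 then G (s i 1) (z.1.1, z.2)
      else f (z.1.1, Fin.cons (s i z.1.2) z.2)
    have hgf : ∀ i p τ c, p ∈ bP ∨ c ∈ Cube.boundary (Fin m) ∨
        (s i τ = 0 ∨ s i τ = 1) ∧ (τ = 0 ∨ τ = 1) ∨
        (Fin.cons (s i τ) c : Fin (m + 1) → I) ∈ closure O →
        g i ((p, τ), c) = f (p, Fin.cons (s i τ) c) := by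
      intro i p τ c h
      have h' : p ∈ bP ∨ c ∈ Cube.boundary (Fin m) ∨ (s i τ = 0 ∨ s i τ = 1) ∨
        (Fin.cons (s i τ) c : Fin (m + 1) → I) ∈ closure O := by tauto
      simp only [g]
      split_ifs with h0 h1
      · subst h0; exact hGf _ _ _ h'
      · subst h1; exact hGf _ _ _ h'
      · rfl
    have consS : ∀ i : ℕ, Continuous fun z : (P × I) × (Fin m → I) =>
        (z.1.1, (Fin.cons (s i z.1.2) z.2 : Fin (m + 1) → I)) := fun i =>
      (continuous_fst.comp continuous_fst).prodMk (continuous_finCons.comp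
        (((continuous_slabPt M i).comp (continuous_snd.comp continuous_fst)).prodMk
          continuous_snd))
    have slabs : ∀ i : ℕ, ∃ F : (P × I) × (Fin m → I) → Y, Continuous F ∧
        EqOn F (g i) (bdProd (bdProd bP {t : I | t = 0 ∨ t = 1}) (Cube.boundary (Fin m))) ∧
        EqOn F (g i) (univ ×ˢ {c | ∃ τ, (Fin.cons (s i τ) c : Fin (m + 1) → I) ∈ N}) := by
      intro i
      have cτ : Continuous fun x : I × (Fin m → I) => (Fin.cons (s i x.1) x.2 : Fin (m + 1) → I) :=
        continuous_finCons.comp (((continuous_slabPt M i).comp continuous_fst).prodMk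
          continuous_snd)
      -- The coordinate across the slab becomes a parameter, so both walls belong to the boundary of
      -- `P × I`. The new open set consists of those `c` whose entire segment across the slab lies
      -- in `O`.
      refine ih (isClosed_bdProd hbP isClosed_zero_one)
        (fun j hj => PairExt.prod_interval (hext (j + 1) (by omega)))
        (W := {c | ∀ τ, (Fin.cons (s i τ) c : Fin (m + 1) → I) ∈ O}) ?_ ?_ ?_ _ ?_ ?_
      · have : {c | ∀ τ, (Fin.cons (s i τ) c : Fin (m + 1) → I) ∈ O} =
            (Prod.snd '' {x : I × (Fin m → I) | (Fin.cons (s i x.1) x.2 : Fin (m + 1) → I) ∉ O})ᶜ := by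
          ext c; simp
        rw [this, isOpen_compl_iff]
        exact isClosedMap_snd_of_compactSpace _ (hO.isClosed_compl.preimage cτ)
      · have : {c | ∃ τ, (Fin.cons (s i τ) c : Fin (m + 1) → I) ∈ N} =
            Prod.snd '' {x : I × (Fin m → I) | (Fin.cons (s i x.1) x.2 : Fin (m + 1) → I) ∈ N} := by
          ext c; simp
        rw [this]
        exact isClosedMap_snd_of_compactSpace _ (hN.preimage cτ)
      · rintro c ⟨τ, hτ⟩ τ'
        exact hNt i τ τ' c hτ
      · have hu : bdProd (bdProd bP {t : I | t = 0 ∨ t = 1}) (Cube.boundary (Fin m)) =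
            (({z | z.1.2 = 0} ∪ {z | z.1.2 = 1}) ∪ {z | z.1.1 ∈ bP}) ∪
              {z | z.2 ∈ Cube.boundary (Fin m)} := by
          ext z
          simp only [bdProd, mem_ofPred_eq, mem_union]
          tauto
        have c0 : IsClosed {z : (P × I) × (Fin m → I) | z.1.2 = 0} :=
          isClosed_eq (by fun_prop) continuous_const
        have c1 : IsClosed {z : (P × I) × (Fin m → I) | z.1.2 = 1} :=
          isClosed_eq (by fun_prop) continuous_const
        have c2 : IsClosed {z : (P × I) × (Fin m → I) | z.1.1 ∈ bP} :=
          hbP.preimage (by fun_prop)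
        have c3 : IsClosed {z : (P × I) × (Fin m → I) | z.2 ∈ Cube.boundary (Fin m)} :=
          (isClosed_cubeBoundary m).preimage (by fun_prop)
        rw [hu]
        refine ContinuousOn.union_of_isClosed (ContinuousOn.union_of_isClosed
          (ContinuousOn.union_of_isClosed ?_ ?_ c0 c1) ?_ (c0.union c1) c2) ?_
          ((c0.union c1).union c2) c3
        · have : Continuous fun z : (P × I) × (Fin m → I) => G (s i 0) (z.1.1, z.2) :=
            (hG _).comp (by fun_prop)
          refine this.continuousOn.congr fun z hz => ?_
          exact if_pos hz
        · have : Continuous fun z : (P × I) × (Fin m → I) => G (s i 1) (z.1.1, z.2) :=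
            (hG _).comp (by fun_prop)
          refine this.continuousOn.congr fun z hz => ?_
          have hz : z.1.2 = 1 := hz
          simp only [g, hz]
          rw [if_neg one_ne_zero, if_pos trivial]
        · refine (hf.comp (consS i).continuousOn fun z hz => Or.inl hz).congr fun z hz => ?_
          exact hgf i z.1.1 z.1.2 z.2 (Or.inl hz)
        · refine (hf.comp (consS i).continuousOn fun z hz => Or.inr
            ((cons_mem_boundary _ _).2 (Or.inr hz))).congr fun z hz => ?_
          exact hgf i z.1.1 z.1.2 z.2 (Or.inr (Or.inl hz))
      · refine (hfW.comp (consS i).continuousOn fun z hz => ⟨mem_univ _,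
          hOW (subset_closure (hz.2 z.1.2))⟩).congr fun z hz => ?_
        exact hgf i z.1.1 z.1.2 z.2 (Or.inr (Or.inr (Or.inr (subset_closure (hz.2 z.1.2)))))
    choose F hF hFb hFN using slabs
    -- gluing
    let τ : ℕ → I → I := fun i t => projIcc 0 1 zero_le_one ((t : ℝ) * M - i)
    have hτc : ∀ i, Continuous (τ i) := fun i => continuous_projIcc.comp (by fun_prop)
    let H : ℕ → P × (Fin (m + 1) → I) → Y := fun i z => F i ((z.1, τ i (z.2 0)), Fin.tail z.2)
    have hH : ∀ i, Continuous (H i) := fun i => (hF i).comp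
      ((continuous_fst.prodMk ((hτc i).comp ((continuous_apply 0).comp continuous_snd))).prodMk
        (continuous_finTail.comp continuous_snd))
    let A : ℕ → Set (P × (Fin (m + 1) → I)) := fun i =>
      {z | (i : ℝ) / M ≤ z.2 0 ∧ (z.2 0 : ℝ) ≤ (i + 1) / M}
    have hA : ∀ i, IsClosed (A i) := fun i => by
      have : Continuous fun z : P × (Fin (m + 1) → I) => (z.2 0 : ℝ) := by fun_prop
      exact (isClosed_le continuous_const this).inter (isClosed_le this continuous_const)
    have hs : ∀ i z, z ∈ A i → s i (τ i (z.2 0)) = z.2 0 := fun i z hz =>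
      slabPt_projIcc hM0 hz.1 hz.2
    have hfl : ∀ z : P × (Fin (m + 1) → I), ∃ i, i < M ∧ z ∈ A i := by
      intro z
      have h0 := (z.2 0).2.1
      have h1 := (z.2 0).2.2
      by_cases hz : (z.2 0 : ℝ) = 1
      -- The end point `1` belongs to the last slab; the floor used otherwise would give the index
      -- `M`.
      · refine ⟨M - 1, by omega, ?_⟩
        have : ((M - 1 : ℕ) : ℝ) = M - 1 := by
          rw [Nat.cast_sub hM0]; simp
        constructor
        · rw [hz, this, div_le_one hMpos]; linarith
        · rw [hz, this, one_le_div hMpos]; linarith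
      · have hlt : (z.2 0 : ℝ) < 1 := lt_of_le_of_ne h1 hz
        refine ⟨⌊(z.2 0 : ℝ) * M⌋₊, ?_, ?_, ?_⟩
        · rw [Nat.floor_lt (by positivity)]
          nlinarith
        · rw [div_le_iff₀ hMpos]
          exact Nat.floor_le (by positivity)
        · rw [le_div_iff₀ hMpos]
          exact (Nat.lt_floor_add_one _).le
    have hov : ∀ i z, z ∈ A i → z ∈ A (i + 1) → H i z = H (i + 1) z := by
      intro i z h1 h2
      have e : (z.2 0 : ℝ) * M = i + 1 := by
        have a1 := h1.2
        have a2 := h2.1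
        rw [le_div_iff₀ hMpos] at a1
        rw [div_le_iff₀ hMpos] at a2
        push_cast at a2
        linarith
      have t1 : τ i (z.2 0) = 1 := by
        simp only [τ, e]
        rw [add_sub_cancel_left]
        exact projIcc_right _
      have t2 : τ (i + 1) (z.2 0) = 0 := by
        simp only [τ, e]
        push_cast
        rw [sub_self]
        exact projIcc_left _
      simp only [H, t1, t2]
      rw [hFb i (Or.inl (Or.inr (Or.inr rfl))), hFb (i + 1) (Or.inl (Or.inr (Or.inl rfl)))]
      simp only [g]
      rw [if_neg one_ne_zero, if_pos trivial, if_pos trivial]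
      simp only [s, slabPt_one]
    have hov' : ∀ i j z, i ≤ j → z ∈ A i → z ∈ A j → H i z = H j z := by
      intro i j z hij h1 h2
      obtain rfl | hlt := hij.eq_or_lt
      · rfl
      have a1 := h1.2
      have a2 := h2.1
      rw [le_div_iff₀ hMpos] at a1
      rw [div_le_iff₀ hMpos] at a2
      have : j ≤ i + 1 := by
        have : (j : ℝ) ≤ i + 1 := by linarith
        exact_mod_cast this
      obtain rfl : j = i + 1 := by omega
      exact hov i z h1 h2
    have hov2 : ∀ i j z, z ∈ A i → z ∈ A j → H i z = H j z := fun i j z h1 h2 =>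
      (le_total i j).elim (fun h => hov' i j z h h1 h2) fun h => (hov' j i z h h2 h1).symm
    choose fl hflM hflA using hfl
    let R : P × (Fin (m + 1) → I) → Y := fun z => H (fl z) z
    have hR : ∀ i z, z ∈ A i → R z = H i z := fun i z hz => hov2 _ _ z (hflA z) hz
    have hRf : ∀ z, (z ∈ bdProd bP (Cube.boundary (Fin (m + 1))) ∨ z.2 ∈ N) → R z = f z := by
      intro z hz
      have key : g (fl z) ((z.1, τ (fl z) (z.2 0)), Fin.tail z.2) = f z := by
        have e := hs _ _ (hflA z)
        have e' : (z.1, (Fin.cons (s (fl z) (τ (fl z) (z.2 0))) (Fin.tail z.2) :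
            Fin (m + 1) → I)) = z := by
          rw [e, Fin.cons_self_tail]
        refine (hgf _ _ _ _ ?_).trans (congrArg f e')
        rw [e, Fin.cons_self_tail]
        rcases hz with (hz | hz) | hz
        · exact Or.inl hz
        · rw [← Fin.cons_self_tail z.2, cons_mem_boundary] at hz
          rcases hz with h | h
          · refine Or.inr (Or.inr (Or.inl ⟨h, ?_⟩))
            have hA' := hflA z
            have a1 := hA'.1
            have a2 := hA'.2
            rw [div_le_iff₀ hMpos] at a1
            rw [le_div_iff₀ hMpos] at a2
            rcases h with h | h
            · left
              simp only [τ, h]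
              refine projIcc_of_le_left _ ?_
              simp
            · right
              simp only [τ, h]
              refine projIcc_of_right_le _ ?_
              have : fl z + 1 ≤ M := hflM z
              have : (fl z : ℝ) + 1 ≤ M := by exact_mod_cast this
              simp only [Set.Icc.coe_one]
              linarith
          · exact Or.inr (Or.inl h)
        · exact Or.inr (Or.inr (Or.inr (subset_closure (hNO hz))))
      refine Eq.trans ?_ key
      rcases hz with (hz | hz) | hz
      · exact hFb _ (Or.inl (Or.inl hz))
      · rw [← Fin.cons_self_tail z.2, cons_mem_boundary] at hz
        rcases hz with h | h
        · have hA' := hflA z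
          refine hFb _ (Or.inl (Or.inr ?_))
          rcases h with h | h
          · left
            simp only [τ, h]
            refine projIcc_of_le_left _ ?_
            simp
          · right
            simp only [τ, h]
            refine projIcc_of_right_le _ ?_
            have : fl z + 1 ≤ M := hflM z
            have : (fl z : ℝ) + 1 ≤ M := by exact_mod_cast this
            simp only [Set.Icc.coe_one]
            linarith
        · exact hFb _ (Or.inr h)
      · refine hFN _ ⟨mem_univ _, ⟨τ (fl z) (z.2 0), ?_⟩⟩
        rw [hs _ _ (hflA z)]
        simpa using hz
    refine ⟨R, ?_, fun z hz => hRf z (Or.inl hz), fun z hz => hRf z (Or.inr hz.2)⟩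
    have hcov : (⋃ i : Fin M, A i) = univ := by
      ext z
      simp only [mem_iUnion, mem_univ, iff_true]
      exact ⟨⟨fl z, hflM z⟩, hflA z⟩
    refine (locallyFinite_of_finite fun i : Fin M => A i).continuous hcov (fun i => hA i) fun i => ?_
    exact (hH i).continuousOn.congr fun z hz => hR i z hz

end Slab

/-! ## Connectivity -/

section Connectivity

theorem IsNConnected.mono {Y : Type u} [TopologicalSpace Y] {n m : ℤ} (h : IsNConnected n Y)
    (hm : m ≤ n) : IsNConnected m Y :=
  ⟨fun h' => h.1 (h'.trans hm), fun k hk => h.2 k (hk.trans hm)⟩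

/-- `conn Y` is a supremum; being strictly above `n - 1` it is exceeded there by some integer `m ≥
n` for which `Y` is `m`-connected. -/
theorem isNConnected_of_le_conn {Y : Type u} [TopologicalSpace Y] {n : ℤ}
    (h : intToEReal n ≤ conn Y) : IsNConnected n Y := by
  have : intToEReal (n - 1) < conn Y := by
    refine lt_of_lt_of_le ?_ h
    unfold intToEReal
    exact_mod_cast (by linarith : (n : ℝ) - 1 < n)
  obtain ⟨m, hm⟩ := lt_iSup_iff.1 this
  obtain ⟨hmc, hlt⟩ := lt_iSup_iff.1 hm
  refine hmc.mono ?_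
  unfold intToEReal at hlt
  have : ((n - 1 : ℤ) : ℝ) < (m : ℝ) := by exact_mod_cast hlt
  have : n - 1 < m := by exact_mod_cast this
  omega

/-- The form in which the bound is used: a cell of dimension `m ≤ d` sees a `(k + m)`-connected
target. If `conn Y = ∞`, the convention for `connSub` loses nothing, since `Y` is then `n`-connected
for all `n`. -/
theorem isNConnected_of_le_connSub {Y : Type u} [TopologicalSpace Y] {k : ℤ} {m : ℕ} {d : EReal}
    (h : intToEReal k ≤ connSub (conn Y) d) (hm : (m : EReal) ≤ d) : IsNConnected (k + m) Y := by
  refine isNConnected_of_le_conn ?_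
  unfold connSub at h
  split_ifs at h with hc
  · rw [hc]; exact le_top
  · have h1 : intToEReal k ≤ conn Y - m := h.trans (EReal.sub_le_sub le_rfl hm)
    have h2 := EReal.add_le_of_le_sub h1
    refine le_trans (le_of_eq ?_) h2
    unfold intToEReal
    push_cast
    rfl

theorem IsNConnected.cubeExt {Y : Type u} [TopologicalSpace Y] {n : ℤ} (h : IsNConnected n Y)
    {q : ℕ} (hq : (q : ℤ) ≤ n) : CubeExt (q + 1) Y :=
  CubeExt.of_subsingleton fun y => h.2 q hq y

theorem CubeExt.prod {Y : Type*} [TopologicalSpace Y] {a b n : ℕ} (h : CubeExt n Y)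
    (hn : n = a + b) :
    PairExt ((Fin a → I) × (Fin b → I))
      (bdProd (Cube.boundary (Fin a)) (Cube.boundary (Fin b))) Y := by
  subst hn
  let e : (Fin a → I) × (Fin b → I) ≃ₜ (Fin (a + b) → I) :=
    Homeomorph.sumArrowHomeomorphProdArrow.symm.trans
      (Homeomorph.piCongrLeft (Y := fun _ => I) finSumFinEquiv)
  have he : ∀ z i, e z (finSumFinEquiv i) = Sum.elim z.1 z.2 i := by
    intro z i
    exact Equiv.piCongrLeft_apply_apply (fun _ => I) finSumFinEquiv _ i
  refine h.of_homeomorph e fun z => ?_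
  constructor
  · rintro ⟨i, hi⟩
    obtain ⟨j, rfl⟩ := finSumFinEquiv.surjective i
    rw [he] at hi
    rcases j with j | j
    · exact Or.inl ⟨j, hi⟩
    · exact Or.inr ⟨j, hi⟩
  · rintro (⟨j, hj⟩ | ⟨j, hj⟩)
    · exact ⟨finSumFinEquiv (Sum.inl j), by rw [he]; exact hj⟩
    · exact ⟨finSumFinEquiv (Sum.inr j), by rw [he]; exact hj⟩

/-- Maps from the boundary of `D ^ (k + 1) × I ^ j` to a `(k + j)`-connected space extend. -/
theorem IsNConnected.pairExt {Y : Type u} [TopologicalSpace Y] {n : ℤ} (h : IsNConnected n Y)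
    {k j : ℕ} (hq : ((k + j : ℕ) : ℤ) ≤ n) :
    PairExt (Ball (k + 1) × (Fin j → I)) (bdProd (Ball.bd (k + 1)) (Cube.boundary (Fin j))) Y := by
  have := (h.cubeExt hq).prod (a := k + 1) (b := j) (by omega)
  refine this.of_homeomorph ((ballCube (k + 1)).prodCongr (Homeomorph.refl _)) fun z => ?_
  exact or_congr (ballCube_mem_boundary _) Iff.rfl

end Connectivity

/-! ## Compactly generated refinements -/

section KSpace

/-- The refined topology is coinduced from all maps of compact Hausdorff spaces, so each of these
stays continuous. -/
theorem continuous_compactlyGenerated_map {X : Type u} [tX : TopologicalSpace X]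
    (S : CompHaus.{u}) (h : C(S, X)) :
    Continuous[inferInstance, TopologicalSpace.compactlyGenerated.{u} X] h := by
  let F : (Σ (i : (S : CompHaus.{u}) × C(S, X)), i.fst) → X := fun ⟨⟨_, i⟩, s⟩ ↦ i s
  suffices ∀ i : (S : CompHaus.{u}) × C(S, X),
      Continuous[inferInstance, TopologicalSpace.compactlyGenerated.{u} X]
        (fun (a : i.fst) ↦ F ⟨i, a⟩) from this ⟨S, h⟩
  rw [← @continuous_sigma_iff]
  apply continuous_coinduced_rng

theorem continuous_compactlyGenerated_rng {X : Type u} [tX : TopologicalSpace X] {T : Type u}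
    [TopologicalSpace T] [CompactlyGeneratedSpace T] {f : T → X} (hf : Continuous f) :
    Continuous[_, TopologicalSpace.compactlyGenerated.{u} X] f :=
  @continuous_from_uCompactlyGeneratedSpace T X _ (TopologicalSpace.compactlyGenerated.{u} X) _ f
    fun S g => continuous_compactlyGenerated_map S ⟨f ∘ g, hf.comp g.continuous⟩

/-- Cubes and balls live in the lowest universe, whereas the refinement is tested in universe `u`;
the passage is through `ULift`. -/
theorem continuous_compactlyGenerated_rng_of_compact {X : Type u} [tX : TopologicalSpace X]
    {T : Type} [TopologicalSpace T] [CompactSpace T] [T2Space T] {f : T → X} (hf : Continuous f) :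
    Continuous[_, TopologicalSpace.compactlyGenerated.{u} X] f := by
  have h := continuous_compactlyGenerated_rng (T := ULift.{u} T) (f := f ∘ ULift.down)
    (hf.comp continuous_uliftDown)
  let _ : TopologicalSpace X := TopologicalSpace.compactlyGenerated.{u} X
  exact h.comp continuous_uliftUp

/-- The compactly generated refinement of a space. -/
def KSpace (X : Type u) : Type u := X

namespace KSpace

variable {X : Type u} [TopologicalSpace X]

instance : TopologicalSpace (KSpace X) := TopologicalSpace.compactlyGenerated.{u} X

/-- The identity from the compactly generated refinement. -/
def out (x : KSpace X) : X := x

/-- The identity to the compactly generated refinement. -/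
def mk (x : X) : KSpace X := x

theorem continuous_out : Continuous (out : KSpace X → X) :=
  @continuous_from_compactlyGenerated X X _ _ id fun _ g => g.continuous

instance : CompactlyGeneratedSpace (KSpace X) := by
  let F : (Σ (i : (S : CompHaus.{u}) × C(S, X)), i.fst) → KSpace X := fun ⟨⟨_, i⟩, s⟩ ↦ mk (i s)
  have hF : Continuous F := continuous_coinduced_rng
  exact uCompactlyGeneratedSpace_of_coinduced (f := F) hF rfl

instance [T2Space X] : T2Space (KSpace X) :=
  T2Space.of_injective_continuous (f := out) (fun _ _ h => h) continuous_out

theorem continuous_mk {T : Type u} [TopologicalSpace T] [CompactlyGeneratedSpace T] {f : T → X}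
    (hf : Continuous f) : Continuous fun t => mk (f t) :=
  @continuous_compactlyGenerated_rng X _ T _ _ f hf

theorem continuous_mk_of_compact {T : Type} [TopologicalSpace T] [CompactSpace T] [T2Space T]
    {f : T → X} (hf : Continuous f) : Continuous fun t => mk (f t) :=
  @continuous_compactlyGenerated_rng_of_compact X _ T _ _ _ f hf

theorem continuous_map {Z : Type u} [TopologicalSpace Z] {f : X → Z} (hf : Continuous f) :
    Continuous fun x : KSpace X => mk (f x.out) :=
  continuous_mk (hf.comp continuous_out)

end KSpace

end KSpace

/-! ## Cones with the coarse topology -/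

/-- The points of `Y` together with a point whose only neighbourhood is the whole space. -/
def WithCenter (Y : Type u) : Type u := Option Y

/-- The inclusion of `Y`. -/
def WithCenter.some {Y : Type u} (y : Y) : WithCenter Y := Option.some y

/-- The additional point. -/
def WithCenter.none {Y : Type u} : WithCenter Y := Option.none

instance (Y : Type u) [TopologicalSpace Y] : TopologicalSpace (WithCenter Y) where
  IsOpen U := (WithCenter.none ∈ U → U = univ) ∧ IsOpen (WithCenter.some ⁻¹' U)
  isOpen_univ := ⟨fun _ => rfl, isOpen_univ⟩
  isOpen_inter U V hU hV := ⟨fun h => by rw [hU.1 h.1, hV.1 h.2, univ_inter], hU.2.inter hV.2⟩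
  isOpen_sUnion S hS := ⟨fun ⟨U, hU, h⟩ => by
      rw [(hS U hU).1 h] at hU
      exact eq_univ_of_univ_subset (subset_sUnion_of_mem hU), by
    rw [preimage_sUnion]
    exact isOpen_biUnion fun U hU => (hS U hU).2⟩

/-- The cone on `Y`, with the coarsest topology for which the height is continuous, and the
projection to `Y` is continuous on the open set of points of positive height. -/
def Cone (Y : Type u) : Type u := {z : I × WithCenter Y // z.2 = (none : Option Y) ↔ z.1 = 0}

namespace Cone

variable {Y : Type u}

instance [TopologicalSpace Y] : TopologicalSpace (Cone Y) := inferInstanceAs (TopologicalSpace (Subtype _))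

/-- The height. -/
def ht (c : Cone Y) : I := c.1.1

/-- The projection to `Y`, defined on the points of positive height. -/
def pr (c : Cone Y) : Option Y := c.1.2

/-- The point of height `t` over `y`. -/
def mk (t : I) (y : Y) : Cone Y :=
  open Classical in
  ⟨(t, if t = 0 then (none : Option Y) else some y), by
    change (if t = 0 then (none : Option Y) else some y) = none ↔ t = 0
    split_ifs with h <;> simp [h]⟩

/-- The cone point. -/
def base : Cone Y := ⟨(0, WithCenter.none), iff_of_true rfl rfl⟩

theorem ext {c d : Cone Y} (h1 : c.ht = d.ht) (h2 : c.pr = d.pr) : c = d :=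
  Subtype.ext (Prod.ext h1 h2)

@[simp] theorem ht_mk (t : I) (y : Y) : (mk t y).ht = t := rfl

@[simp] theorem ht_base : (base : Cone Y).ht = 0 := rfl

@[simp] theorem pr_base : (base : Cone Y).pr = none := rfl

theorem pr_mk {t : I} (ht : t ≠ 0) (y : Y) : (mk t y).pr = some y := if_neg ht

theorem mk_zero (y : Y) : mk 0 y = base := ext rfl (if_pos rfl)

theorem eq_base_or (c : Cone Y) : c = base ∨ ∃ t y, t ≠ 0 ∧ c = mk t y := by
  by_cases h : c.ht = 0
  · exact Or.inl (ext h (c.2.2 h))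
  · right
    have : c.pr ≠ none := fun h' => h (c.2.1 h')
    obtain ⟨y, hy⟩ := Option.ne_none_iff_exists'.1 this
    exact ⟨c.ht, y, h, ext rfl (by rw [pr_mk h, hy])⟩

theorem mk_ne_base {t : I} (ht : t ≠ 0) (y : Y) : mk t y ≠ base := fun h => ht (congrArg Cone.ht h)

theorem mk_inj {t t' : I} {y y' : Y} (ht : t ≠ 0) (h : mk t y = mk t' y') : t = t' ∧ y = y' := by
  have h1 : t = t' := congrArg Cone.ht h
  subst h1
  have h2 := congrArg pr h
  rw [pr_mk ht, pr_mk ht] at h2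
  exact ⟨rfl, Option.some_injective _ h2⟩

theorem continuous_ht [TopologicalSpace Y] : Continuous (ht : Cone Y → I) := continuous_fst.comp continuous_subtype_val

theorem isOpen_pr [TopologicalSpace Y] {V : Set Y} (hV : IsOpen V) : IsOpen {c : Cone Y | ∃ y ∈ V, c.pr = some y} := by
  let U : Set (WithCenter Y) := {o | ∃ y ∈ V, o = (some y : Option Y)}
  have hU : IsOpen U := by
    refine ⟨?_, ?_⟩
    · rintro ⟨y, -, h⟩
      exact (Option.some_ne_none y h.symm).elim
    · have : WithCenter.some ⁻¹' U = V := by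
        ext y
        constructor
        · rintro ⟨z, hz, h⟩
          rwa [Option.some_injective _ h]
        · exact fun h => ⟨y, h, rfl⟩
      rw [this]
      exact hV
  exact hU.preimage (continuous_snd.comp continuous_subtype_val)

/-- The reason for the coarse topology: a map into the cone is tested by its height and by its
projection on the open set of positive height, with no condition at the cone point beyond the
height. -/
theorem continuous_of [TopologicalSpace Y] {T : Type*} [TopologicalSpace T] {f : T → Cone Y}
    (h1 : Continuous fun x => (f x).ht)
    (h2 : ∀ V : Set Y, IsOpen V → IsOpen {x | ∃ y ∈ V, (f x).pr = some y}) : Continuous f := by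
  refine Continuous.subtype_mk (f := fun x => (f x).1) (h1.prodMk ?_) _
  refine ⟨fun U hU => ?_⟩
  by_cases h : WithCenter.none ∈ U
  · rw [hU.1 h]
    exact isOpen_univ
  · have : (fun x => (f x).1.2) ⁻¹' U = {x | ∃ y ∈ WithCenter.some ⁻¹' U, (f x).pr = some y} := by
      ext x
      constructor
      · intro hx
        cases e : (f x).pr with
        | none =>
          have hx : WithCenter.none ∈ U := by
            have e : (f x).1.2 = WithCenter.none := e
            rw [← e]
            exact hx
          exact (h hx).elim
        | some y =>
          refine ⟨y, ?_, e⟩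
          have e' : (f x).1.2 = WithCenter.some y := e
          rw [mem_preimage, ← e']
          exact hx
      · rintro ⟨y, hy, e⟩
        have e' : (f x).1.2 = WithCenter.some y := e
        rw [mem_preimage, e']
        exact hy
    rw [this]
    exact h2 _ hU.2

theorem continuous_mk [TopologicalSpace Y] {T : Type*} [TopologicalSpace T] {t : T → I} {y : T → Y} (ht : Continuous t)
    (hy : Continuous y) : Continuous fun x => mk (t x) (y x) := by
  refine continuous_of ht fun V hV => ?_
  have : {x | ∃ z ∈ V, (mk (t x) (y x)).pr = some z} = {x | t x ≠ 0} ∩ {x | y x ∈ V} := by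
    ext x
    by_cases h : t x = 0
    · simp [h, mk_zero]
    · simp [h, pr_mk h]
  rw [this]
  exact (isOpen_ne.preimage ht).inter (hV.preimage hy)

/-- Functoriality of the cone. -/
def map {Z : Type u} (f : Y → Z) (c : Cone Y) : Cone Z :=
  ⟨(c.ht, c.pr.map f), Option.map_eq_none_iff.trans c.2⟩

variable {Z : Type u}

@[simp] theorem map_base (f : Y → Z) : map f base = base := rfl

theorem map_mk (f : Y → Z) (t : I) (y : Y) : map f (mk t y) = mk t (f y) := by
  by_cases h : t = 0
  · subst h; rw [mk_zero, mk_zero, map_base]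
  · refine ext rfl ?_
    change (mk t y).pr.map f = _
    rw [pr_mk h, pr_mk h, Option.map_some]

theorem pr_map (f : Y → Z) (c : Cone Y) : (map f c).pr = c.pr.map f := rfl

theorem map_id (c : Cone Y) : map (fun y => y) c = c := ext rfl Option.map_id'

theorem map_map {W : Type u} (f : Y → Z) (g : Z → W) (c : Cone Y) :
    map g (map f c) = map (fun y => g (f y)) c := ext rfl (by simp [pr_map, Function.comp_def])

theorem continuous_map [TopologicalSpace Y] [TopologicalSpace Z] {f : Y → Z} (hf : Continuous f) : Continuous (map f) := by
  refine continuous_of continuous_ht fun V hV => ?_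
  have : {c : Cone Y | ∃ z ∈ V, (map f c).pr = some z} = {c | ∃ y ∈ f ⁻¹' V, c.pr = some y} := by
    ext c
    simp only [pr_map, Option.map_eq_some_iff, mem_ofPred_eq, mem_preimage]
    constructor
    · rintro ⟨z, hz, y, hy, rfl⟩
      exact ⟨y, hz, hy⟩
    · rintro ⟨y, hy, h⟩
      exact ⟨_, hy, y, h, rfl⟩
  rw [this]
  exact isOpen_pr (hV.preimage hf)

/-- Multiplication of the height by a factor. -/
def scale (s : I) (c : Cone Y) : Cone Y :=
  match c.pr with
  | none => base
  | some y => mk (s * c.ht) y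

@[simp] theorem scale_base (s : I) : scale s (base : Cone Y) = base := rfl

theorem scale_mk (s t : I) (y : Y) : scale s (mk t y) = mk (s * t) y := by
  by_cases h : t = 0
  · subst h; rw [mk_zero, scale_base, mul_zero, mk_zero]
  · unfold scale
    rw [pr_mk h]
    rfl

theorem ht_scale (s : I) (c : Cone Y) : (scale s c).ht = s * c.ht := by
  rcases c.eq_base_or with rfl | ⟨t, y, -, rfl⟩
  · simp
  · rw [scale_mk]; rfl

theorem scale_one (c : Cone Y) : scale 1 c = c := by
  rcases c.eq_base_or with rfl | ⟨t, y, -, rfl⟩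
  · rfl
  · rw [scale_mk, one_mul]

theorem scale_zero (c : Cone Y) : scale 0 c = base := by
  rcases c.eq_base_or with rfl | ⟨t, y, -, rfl⟩
  · rfl
  · rw [scale_mk, zero_mul, mk_zero]

theorem map_scale (f : Y → Z) (s : I) (c : Cone Y) : map f (scale s c) = scale s (map f c) := by
  rcases c.eq_base_or with rfl | ⟨t, y, -, rfl⟩
  · rfl
  · rw [scale_mk, map_mk, map_mk, scale_mk]

theorem pr_scale {s : I} (hs : s ≠ 0) (c : Cone Y) : (scale s c).pr = c.pr := by
  rcases c.eq_base_or with rfl | ⟨t, y, ht, rfl⟩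
  · rfl
  · rw [scale_mk, pr_mk (mul_ne_zero hs ht), pr_mk ht]

theorem continuous_scale [TopologicalSpace Y] {T : Type*} [TopologicalSpace T] {s : T → I} {c : T → Cone Y}
    (hs : Continuous s) (hc : Continuous c) : Continuous fun x => scale (s x) (c x) := by
  refine continuous_of ?_ fun V hV => ?_
  · simp only [ht_scale]
    exact hs.mul (continuous_ht.comp hc)
  · have : {x | ∃ z ∈ V, (scale (s x) (c x)).pr = some z} =
        {x | s x ≠ 0} ∩ {x | ∃ z ∈ V, (c x).pr = some z} := by
      ext x
      by_cases h : s x = 0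
      · rw [mem_ofPred_eq, h, scale_zero]; simp [h]
      · rw [mem_ofPred_eq, pr_scale h]; simp [h]
    rw [this]
    exact (isOpen_ne.preimage hs).inter ((isOpen_pr hV).preimage hc)

/-- Points of different heights are separated by the height, points of the same positive height by
the projection, and only the cone point has height `0`. -/
instance [TopologicalSpace Y] [T2Space Y] : T2Space (Cone Y) := by
  refine ⟨fun c d hcd => ?_⟩
  by_cases h : c.ht = d.ht
  · rcases c.eq_base_or with rfl | ⟨t, y, ht, rfl⟩
    · rcases d.eq_base_or with rfl | ⟨t', y', ht', rfl⟩
      · exact (hcd rfl).elim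
      · exact (ht' h.symm).elim
    · rcases d.eq_base_or with rfl | ⟨t', y', ht', rfl⟩
      · exact (ht h).elim
      · obtain rfl : t = t' := h
        have hy : y ≠ y' := fun e => hcd (by rw [e])
        obtain ⟨U, V, hU, hV, hyU, hyV, hUV⟩ := t2_separation hy
        refine ⟨_, _, isOpen_pr hU, isOpen_pr hV, ⟨y, hyU, pr_mk ht y⟩, ⟨y', hyV, pr_mk ht y'⟩, ?_⟩
        rw [Set.disjoint_left]
        rintro e ⟨z, hz, hze⟩ ⟨z', hz', hze'⟩
        obtain rfl : z = z' := Option.some_injective _ (hze.symm.trans hze')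
        exact (Set.disjoint_left.1 hUV) hz hz'
  · obtain ⟨U, V, hU, hV, hyU, hyV, hUV⟩ := t2_separation h
    exact ⟨_, _, hU.preimage continuous_ht, hV.preimage continuous_ht, hyU, hyV,
      hUV.preimage _⟩

end Cone

/-! ## `G`-diagrams as diagrams on the Grothendieck construction -/

section Total

variable {G : Type u} [Group G] {a : SingleObj G ⥤ Cat.{u, u}}

/-- The action of `g` on morphisms. -/
def gmap (g : G) {i j : Idx a} (α : i ⟶ j) : g • i ⟶ g • j := (act a g).map α

@[simp] theorem gmap_id (g : G) (i : Idx a) : gmap g (𝟙 i) = 𝟙 (g • i) := (act a g).map_id i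

@[simp] theorem gmap_comp (g : G) {i j k : Idx a} (α : i ⟶ j) (β : j ⟶ k) :
    gmap g (α ≫ β) = gmap g α ≫ gmap g β := (act a g).map_comp α β

@[simp] theorem gmap_eqToHom (g : G) {i j : Idx a} (h : i = j) :
    gmap g (eqToHom h) = eqToHom (by rw [h]) := by
  subst h
  simp

theorem gmap_one {i j : Idx a} (α : i ⟶ j) : gmap (1 : G) α =
    eqToHom (one_smul G i) ≫ α ≫ eqToHom (one_smul G j).symm :=
  Functor.congr_hom (act_one a) α

theorem gmap_mul (h g : G) {i j : Idx a} (α : i ⟶ j) : gmap (h * g) α =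
    eqToHom (mul_smul h g i) ≫ gmap h (gmap g α) ≫ eqToHom (mul_smul h g j).symm :=
  Functor.congr_hom (act_mul a h g) α

variable (a) in
/-- The objects of the Grothendieck construction. -/
structure Tot where
  /-- the underlying object -/
  idx : Idx a

/-- The morphisms of the Grothendieck construction. -/
structure Tot.Hom (i j : Tot a) where
  /-- the group element -/
  elt : G
  /-- the morphism -/
  hom : elt • i.idx ⟶ j.idx

theorem Tot.Hom.ext' {i j : Tot a} {m n : Tot.Hom i j} (e : m.elt = n.elt)
    (e' : m.hom = eqToHom (by rw [e]) ≫ n.hom) : m = n := by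
  obtain ⟨g, α⟩ := m
  obtain ⟨h, β⟩ := n
  dsimp only at e e'
  subst e
  simp [e']

instance : Category (Tot a) where
  Hom := Tot.Hom
  id i := ⟨1, eqToHom (one_smul G i.idx)⟩
  comp {i j k} m n := ⟨n.elt * m.elt, eqToHom (mul_smul _ _ _) ≫ gmap n.elt m.hom ≫ n.hom⟩
  id_comp {i j} m := Tot.Hom.ext' (mul_one _) (by simp)
  comp_id {i j} m := Tot.Hom.ext' (one_mul _) (by simp [gmap_one])
  assoc {i j k l} m n p := Tot.Hom.ext' (mul_assoc _ _ _).symm (by simp [gmap_mul])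

/-- The object of the Grothendieck construction given by an object of the category. -/
abbrev tot (i : Idx a) : Tot a := ⟨i⟩

/-- The morphism of the Grothendieck construction given by `g` and `α : g i ⟶ j`. -/
def totHom (g : G) {i j : Idx a} (α : g • i ⟶ j) : tot i ⟶ tot j := ⟨g, α⟩

/-- The isomorphism of the Grothendieck construction given by `g`. -/
abbrev totTr (g : G) {i j : Idx a} (h : g • i = j) : tot i ⟶ tot j := totHom g (eqToHom h)

/-- The morphism of the Grothendieck construction given by `α`. -/
abbrev totMap {i j : Idx a} (α : i ⟶ j) : tot i ⟶ tot j := totHom (1 : G) (eqToHom (one_smul G i) ≫ α)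

theorem totHom_comp (g h : G) {i j k : Idx a} (α : g • i ⟶ j) (β : h • j ⟶ k) :
    totHom g α ≫ totHom h β =
      totHom (h * g) (eqToHom (mul_smul h g i) ≫ gmap h α ≫ β) := rfl

theorem totHom_ext {g h : G} {i j : Idx a} {α : g • i ⟶ j} {β : h • i ⟶ j} (e : g = h)
    (e' : α = eqToHom (by rw [e]) ≫ β) : totHom g α = totHom h β := Tot.Hom.ext' e e'

theorem id_tot (i : Idx a) : 𝟙 (tot i) = totHom (1 : G) (eqToHom (one_smul G i)) := rfl

theorem totTr_comp {g h : G} {i j k : Idx a} (e : g • i = j) (e' : h • j = k) :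
    totTr g e ≫ totTr h e' = totTr (h * g) (by rw [mul_smul, e, e']) := by
  rw [totHom_comp]
  exact totHom_ext rfl (by simp)

theorem totTr_one {i : Idx a} (e : (1 : G) • i = i) : totTr 1 e = 𝟙 (tot i) := rfl

theorem totMap_comp {i j k : Idx a} (α : i ⟶ j) (β : j ⟶ k) :
    totMap α ≫ totMap β = totMap (α ≫ β) := by
  rw [totHom_comp]
  exact totHom_ext (one_mul 1) (by simp [gmap_one])

theorem totMap_id (i : Idx a) : totMap (𝟙 i) = 𝟙 (tot i) := by
  rw [id_tot]
  exact totHom_ext rfl (by simp)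

theorem totTr_totMap (g : G) {i j k : Idx a} (e : g • i = j) (α : j ⟶ k) :
    totTr g e ≫ totMap α = totHom g (eqToHom e ≫ α) := by
  rw [totHom_comp]
  exact totHom_ext (one_mul g) (by simp)

theorem totMap_totTr (g : G) {i j k : Idx a} (α : i ⟶ j) (e : g • j = k) :
    totMap α ≫ totTr g e = totHom g (gmap g α ≫ eqToHom e) := by
  rw [totHom_comp]
  exact totHom_ext (mul_one g) (by simp)

theorem totHom_eq (g : G) {i j : Idx a} (α : g • i ⟶ j) :
    totHom g α = totTr g rfl ≫ totMap α := by
  rw [totTr_totMap]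
  simp

variable {C : Type*} [Category C]

theorem GDiagram.map_tr' (K : GDiagram a C) (g : G) {i i' j j' : Idx a} (α : i ⟶ i')
    (h : g • i = j) (h' : g • i' = j') :
    K.functor.map α ≫ K.tr g h' =
      K.tr g h ≫ K.functor.map (eqToHom h.symm ≫ gmap g α ≫ eqToHom h') := K.map_tr g α h h'

theorem GDiagram.tr_map_eqToHom (K : GDiagram a C) (g : G) {i j k : Idx a} (h : g • i = j)
    (h' : j = k) : K.tr g h ≫ K.functor.map (eqToHom h') = K.tr g (h.trans h') := by
  subst h'
  simp

theorem GDiagram.tr_congr (K : GDiagram a C) {g g' : G} (e : g = g') {i j : Idx a}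
    (h : g • i = j) (h' : g' • i = j) : K.tr g h = K.tr g' h' := by
  subst e
  rfl

/-- A `G`-diagram as a functor on the Grothendieck construction. -/
def GDiagram.toTot (K : GDiagram a C) : Tot a ⥤ C where
  obj i := K.functor.obj i.idx
  map {i j} m := K.tr m.elt rfl ≫ K.functor.map m.hom
  map_id i := (K.tr_map_eqToHom (1 : G) rfl (one_smul G i.idx)).trans (K.tr_one _)
  map_comp {i j k} m n := by
    have h1 := K.map_tr' n.elt m.hom rfl rfl
    rw [Category.assoc, reassoc_of% h1, ← Category.assoc, K.tr_comp]
    change K.tr (n.elt * m.elt) rfl ≫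
      K.functor.map (eqToHom (mul_smul _ _ _) ≫ gmap n.elt m.hom ≫ n.hom) = _
    rw [K.functor.map_comp, ← Category.assoc, K.tr_map_eqToHom, ← K.functor.map_comp]
    simp

@[simp] theorem GDiagram.toTot_map_totTr (K : GDiagram a C) (g : G) {i j : Idx a} (e : g • i = j) :
    K.toTot.map (totTr g e) = K.tr g e := K.tr_map_eqToHom g rfl e

@[simp] theorem GDiagram.toTot_map_totMap (K : GDiagram a C) {i j : Idx a} (α : i ⟶ j) :
    K.toTot.map (totMap α) = K.functor.map α := by
  change K.tr (1 : G) rfl ≫ K.functor.map (eqToHom _ ≫ α) = _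
  rw [K.functor.map_comp, ← Category.assoc, K.tr_map_eqToHom, K.tr_one, Category.id_comp]

/-- The `G`-diagram of a functor on the Grothendieck construction. -/
def GDiagram.ofTot (F : Tot a ⥤ C) : GDiagram a C where
  functor :=
    { obj := fun i => F.obj (tot i)
      map := fun α => F.map (totMap α)
      map_id := fun i => by rw [totMap_id, F.map_id]
      map_comp := fun α β => by rw [← totMap_comp, F.map_comp] }
  φ g :=
    { app := fun i => F.map (totTr g rfl)
      naturality := fun i j α => by
        change F.map (totMap α) ≫ F.map _ = F.map _ ≫ F.map (totMap (gmap g α))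
        rw [← F.map_comp, ← F.map_comp, totMap_totTr, totTr_totMap]
        congr 2
        exact (Category.comp_id _).trans (Category.id_comp _).symm }
  φ_one i := by
    change F.map _ = F.map _
    congr 1
    exact totHom_ext rfl (by simp)
  φ_mul h g i := by
    change F.map _ = F.map _ ≫ F.map _ ≫ F.map _
    rw [← F.map_comp, ← F.map_comp, totTr_totMap, totHom_comp]
    congr 1
    refine totHom_ext rfl ?_
    simp only [eqToHom_refl]
    erw [gmap_id]
    simp

theorem GDiagram.ofTot_tr (F : Tot a ⥤ C) (g : G) {i j : Idx a} (e : g • i = j) :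
    (GDiagram.ofTot F).tr g e = F.map (totTr g e) := by
  change F.map _ ≫ F.map _ = _
  rw [← F.map_comp, totTr_totMap]
  congr 1
  exact totHom_ext rfl (by simp)

end Total
/-! ## Degrees of objects of a category without long chains -/

section Degree

/-- A morphism is an identity, up to an equality of its source and target. -/
def IsIdentity {C : Type*} [Category C] {j i : C} (α : j ⟶ i) : Prop :=
  ∃ h : j = i, α = eqToHom h

/-- There is a chain of `n` morphisms which are not identities ending in `i`. -/
inductive HasChain {C : Type*} [Category C] : ℕ → C → Prop
  | zero (i : C) : HasChain 0 i
  | succ {n : ℕ} {j i : C} (α : j ⟶ i) (hα : ¬ IsIdentity α) (h : HasChain n j) : HasChain (n + 1) i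

/-- There is a chain of `n` morphisms which are not identities starting at `i`. -/
inductive HasForwardChain {C : Type*} [Category C] : ℕ → C → Prop
  | zero (i : C) : HasForwardChain 0 i
  | succ {n : ℕ} {j i : C} (α : i ⟶ j) (hα : ¬ IsIdentity α) (h : HasForwardChain n j) :
      HasForwardChain (n + 1) i

theorem IsIdentity.left {C : Type*} [Category C] {i : C} {x y : Over i} {f : x ⟶ y}
    (h : IsIdentity f) : IsIdentity f.left := by
  obtain ⟨rfl, rfl⟩ := h
  exact ⟨rfl, rfl⟩

/-- Composition with the morphisms to `i` turns a chain ending in `i` into a chain of `I/i`. The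
chain is read from its last morphism backwards, so the part already treated is carried along as a
forward chain. -/
theorem HasChain.hasForwardChain {C : Type*} [Category C] {i : C} {n : ℕ} {j : C}
    (h : HasChain n j) {m : ℕ} (α : j ⟶ i) (hm : HasForwardChain m (Over.mk α)) :
    ∃ y : Over i, HasForwardChain (n + m) y := by
  induction h generalizing m with
  | zero j => exact ⟨_, by simpa using hm⟩
  | @succ n j' j β hβ h ih =>
    obtain ⟨y, hy⟩ := ih (m := m + 1) (β ≫ α)
      (HasForwardChain.succ (Over.homMk β : Over.mk (β ≫ α) ⟶ Over.mk α)
        (fun e => hβ (by simpa using e.left)) hm)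
    exact ⟨y, by convert hy using 1; omega⟩

theorem HasForwardChain.exists_composableArrows {C : Type*} [Category C] {m : ℕ} {x : C}
    (h : HasForwardChain m x) : ∃ F : ComposableArrows C m, F.left = x ∧
      ∀ k : Fin m, ¬ IsIdentity (F.map (homOfLE (Fin.castSucc_le_succ k))) := by
  induction h with
  | zero i => exact ⟨ComposableArrows.mk₀ i, rfl, fun k => k.elim0⟩
  | @succ n j i α hα h ih =>
    obtain ⟨F, rfl, hF⟩ := ih
    refine ⟨F.precomp α, rfl, fun k => ?_⟩
    refine Fin.cases ?_ (fun k => ?_) k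
    · exact hα
    · exact hF k

/-- A simplex in the image of the `k`-th degeneracy has an identity as its `k`-th arrow. -/
theorem not_isIdentity_nonDegenerate {C : Type u} [Category.{u} C] {m : ℕ}
    (F : ComposableArrows C m)
    (hF : ∀ k : Fin m, ¬ IsIdentity (F.map (homOfLE (Fin.castSucc_le_succ k)))) :
    (F : (nerve C).obj (Opposite.op (SimplexCategory.mk m))) ∈ (nerve C).nonDegenerate m := by
  obtain _ | m := m
  · rw [SSet.nondegenerate_zero]
    trivial
  · refine (SSet.mem_nonDegenerate_iff_notMem_degenerate _ _).2 ?_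
    rw [SSet.degenerate_eq_iUnion_range_σ]
    intro hF'
    obtain ⟨k, F', hF'⟩ := mem_iUnion.1 hF'
    refine hF k ?_
    subst hF'
    have e : k.predAbove k.castSucc = k.predAbove k.succ := by simp
    refine ⟨congrArg F'.obj e, ?_⟩
    exact (congrArg F'.map (Subsingleton.elim _ (eqToHom e))).trans (eqToHom_map F' e)

/-- A chain of length `n` ending in `i` becomes a nondegenerate `n`-simplex of `N(I/i)` whose last
vertex is the identity of `i`. -/
theorem HasChain.lt {C : Type u} [SmallCategory C] {i : C} {d n : ℕ}
    (hd : (nerve (Over i)).HasDimensionLT d) (h : HasChain n i) : n < d := by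
  obtain ⟨y, hy⟩ := h.hasForwardChain (𝟙 i) (HasForwardChain.zero _)
  obtain ⟨F, -, hF⟩ := hy.exists_composableArrows
  exact (nerve (Over i)).dim_lt_of_nonDegenerate ⟨F, not_isIdentity_nonDegenerate F hF⟩ d

variable {G : Type u} [Group G] {a : SingleObj G ⥤ Cat.{u, u}}

open Classical in
/-- The degree of an object: the maximal length of a chain of non-identities ending there. -/
def deg (hfin : ∀ i : Idx a, ∃ d : ℕ, (nerve (Over i)).HasDimensionLT d) (i : Idx a) : ℕ :=
  Nat.findGreatest (fun n => HasChain n i) (Classical.choose (hfin i))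

variable (hfin : ∀ i : Idx a, ∃ d : ℕ, (nerve (Over i)).HasDimensionLT d)

theorem HasChain.le_deg {i : Idx a} {n : ℕ} (h : HasChain n i) : n ≤ deg hfin i := by
  classical
  exact Nat.le_findGreatest (h.lt (Classical.choose_spec (hfin i))).le h

theorem hasChain_deg (i : Idx a) : HasChain (deg hfin i) i := by
  classical
  exact Nat.findGreatest_spec (P := fun n => HasChain n i) (Nat.zero_le _) (HasChain.zero i)

theorem deg_lt {j i : Idx a} (α : j ⟶ i) (hα : ¬ IsIdentity α) : deg hfin j < deg hfin i :=
  (HasChain.succ α hα (hasChain_deg hfin j)).le_deg hfin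

theorem deg_le {j i : Idx a} (α : j ⟶ i) : deg hfin j ≤ deg hfin i := by
  by_cases h : IsIdentity α
  · obtain ⟨rfl, -⟩ := h
    exact le_rfl
  · exact (deg_lt hfin α h).le

theorem isIdentity_of_deg_eq {j i : Idx a} (α : j ⟶ i) (h : deg hfin j = deg hfin i) :
    IsIdentity α := by
  by_contra hα
  exact (deg_lt hfin α hα).ne h

theorem HasChain.smul {n : ℕ} {i : Idx a} (h : HasChain n i) (g : G) : HasChain n (g • i) := by
  induction h with
  | zero i => exact HasChain.zero _
  | @succ n j i α hα h ih =>
    refine HasChain.succ (gmap g α) (fun ⟨e, he⟩ => hα ?_) ih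
    obtain rfl : j = i := smul_left_cancel g e
    -- Translation by `g⁻¹` carries an identity `g α` back to `α`, which is then an identity as
    -- well.
    have h1 := gmap_mul g⁻¹ g α
    rw [he, gmap_eqToHom, eqToHom_trans, eqToHom_trans] at h1
    have h2 : gmap (1 : G) α = eqToHom rfl := by
      rw [← inv_mul_cancel g]
      exact h1
    rw [gmap_one] at h2
    refine ⟨rfl, ?_⟩
    have h3 : α = eqToHom (one_smul G j).symm ≫ (eqToHom (one_smul G j) ≫ α ≫
        eqToHom (one_smul G j).symm) ≫ eqToHom (one_smul G j) := by simp
    rw [h3, h2]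
    simp

theorem deg_smul (g : G) (i : Idx a) : deg hfin (g • i) = deg hfin i := by
  refine le_antisymm ?_ ((hasChain_deg hfin i).smul g |>.le_deg hfin)
  have := ((hasChain_deg hfin (g • i)).smul g⁻¹).le_deg hfin
  rwa [inv_smul_smul] at this

end Degree

/-! ## Lifting along acyclic fibrations of diagrams on the Grothendieck construction -/

section Lifting

variable {G : Type u} [Group G] {a : SingleObj G ⥤ Cat.{u, u}}

theorem map_comp_apply {C : Type*} [Category C] (F : C ⥤ TopCat.{u}) {i j k : C} (m : i ⟶ j)
    (n : j ⟶ k) (x : F.obj i) : F.map (m ≫ n) x = F.map n (F.map m x) := by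
  rw [F.map_comp]
  rfl

theorem map_id_apply {C : Type*} [Category C] (F : C ⥤ TopCat.{u}) {i : C} (x : F.obj i) :
    F.map (𝟙 i) x = x := by
  rw [F.map_id]
  rfl

theorem nat_apply {C : Type*} [Category C] {E B : C ⥤ TopCat.{u}} (p : E ⟶ B) {i j : C}
    (m : i ⟶ j) (x : E.obj i) : p.app j (E.map m x) = B.map m (p.app i x) :=
  ConcreteCategory.congr_hom (p.naturality m) x

/-- A functor to spaces on the Grothendieck construction with base points. -/
structure PtTot (a : SingleObj G ⥤ Cat.{u, u}) where
  /-- the functor -/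
  functor : Tot a ⥤ TopCat.{u}
  /-- the base points -/
  pt (i : Tot a) : functor.obj i
  map_pt {i j : Tot a} (m : i ⟶ j) : functor.map m (pt i) = pt j

/-- The pointed functor on the Grothendieck construction of a pointed `G`-diagram. -/
def PtGDiagram.toPtTot (K : PtGDiagram a) : PtTot a where
  functor := K.toTot
  pt i := K.pt i.idx
  map_pt {i j} m := by
    change K.functor.map m.hom (K.tr m.elt rfl (K.pt i.idx)) = _
    rw [K.tr_pt, K.map_pt]

namespace PtTot

/-- The pointed `G`-diagram of a pointed functor on the Grothendieck construction. -/
def toPtGDiagram (E : PtTot a) : PtGDiagram a where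
  toGDiagram := GDiagram.ofTot E.functor
  pt i := E.pt (tot i)
  map_pt _ := E.map_pt _
  φ_pt _ _ := E.map_pt _

/-- A natural transformation preserving the base points, as a morphism of pointed `G`-diagrams. -/
def hom {E B : PtTot a} (p : E.functor ⟶ B.functor) (hp : ∀ i, p.app i (E.pt i) = B.pt i) :
    PtGDiagram.Hom E.toPtGDiagram B.toPtGDiagram where
  nat :=
    { app := fun i => p.app (tot i)
      naturality := fun _ _ _ => p.naturality _ }
  map_pt i := hp (tot i)
  comm g _ := (p.naturality (totTr g rfl)).symm

theorem mem_fixed {E : PtTot a} {i : Idx a} {H : Subgroup (Stab a i)}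
    {x : E.functor.obj (tot i)} :
    x ∈ E.toPtGDiagram.Fixed i H ↔ ∀ γ ∈ H, E.functor.map (totTr γ.1 γ.2) x = x := by
  have key : ∀ γ : Stab a i, (γ • (show E.toPtGDiagram.functor.obj i from x) : E.functor.obj (tot i))
      = E.functor.map (totTr γ.1 γ.2) x := fun γ => by
    change E.toPtGDiagram.tr γ.1 _ x = _
    exact ConcreteCategory.congr_hom (GDiagram.ofTot_tr E.functor γ.1 γ.2) x
  constructor
  · intro hx γ hγ
    rw [← key γ]
    exact hx ⟨γ, hγ⟩
  · intro hx γ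
    exact (key γ.1).trans (hx γ.1 γ.2)

/-- The section, the deformation and the path lifting are constructed on the whole spaces. Since
section and deformation are equivariant for `G_i`, and the lifting keeps data fixed by an element
fixed, they restrict to `H`-fixed points for all `H` at once. -/
theorem isAcyclicFibration_hom {E B : PtTot a} (p : E.functor ⟶ B.functor)
    (hp : ∀ i, p.app i (E.pt i) = B.pt i) (s : ∀ i : Idx a, B.functor.obj (tot i) → E.functor.obj (tot i))
    (D : ∀ i : Idx a, I → E.functor.obj (tot i) → E.functor.obj (tot i))
    (hs : ∀ (i : Idx a) (n : ℕ) (b : (Fin n → I) → B.functor.obj (tot i)),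
      Continuous b → Continuous fun c => s i (b c))
    (hD : ∀ (i : Idx a) (T : Type) [TopologicalSpace T] [CompactSpace T] [T2Space T]
      (b : T → E.functor.obj (tot i)), Continuous b → Continuous fun z : T × I => D i z.2 (b z.1))
    (h0 : ∀ i y, D i 0 y = y) (h1 : ∀ i y, D i 1 y = s i (p.app (tot i) y))
    (hpD : ∀ i t y, p.app (tot i) (D i t y) = p.app (tot i) y)
    (hps : ∀ i z, p.app (tot i) (s i z) = z)
    (hes : ∀ (i : Idx a) (g : G) (h : g • i = i) (z : B.functor.obj (tot i)),
      E.functor.map (totTr g h) (s i z) = s i (B.functor.map (totTr g h) z))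
    (heD : ∀ (i : Idx a) (g : G) (h : g • i = i) (t : I) (y : E.functor.obj (tot i)),
      E.functor.map (totTr g h) (D i t y) = D i t (E.functor.map (totTr g h) y))
    (hlift : ∀ (i : Idx a) (n : ℕ) (f : (Fin n → I) → E.functor.obj (tot i))
      (h : (Fin n → I) × I → B.functor.obj (tot i)), Continuous f → Continuous h →
      (∀ x, p.app (tot i) (f x) = h (x, 0)) → ∃ F : (Fin n → I) × I → E.functor.obj (tot i),
        Continuous F ∧ (∀ x, F (x, 0) = f x) ∧ (∀ z, p.app (tot i) (F z) = h z) ∧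
        ∀ (g : G) (e : g • i = i), (∀ x, E.functor.map (totTr g e) (f x) = f x) →
          (∀ z, B.functor.map (totTr g e) (h z) = h z) →
          ∀ z, E.functor.map (totTr g e) (F z) = F z) :
    (hom p hp).IsAcyclicFibration := by
  intro i H
  constructor
  · intro n f h hfh
    have hf : Continuous fun x => (f x).1 := continuous_subtype_val.comp f.continuous
    have hh : Continuous fun z => (h z).1 := continuous_subtype_val.comp h.continuous
    obtain ⟨F, hF, hF0, hFh, hFe⟩ := hlift i n (fun x => (f x).1) (fun z => (h z).1) hf hh
      (fun x => congrArg Subtype.val (hfh x))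
    let F' : (Fin n → I) × I → E.toPtGDiagram.Fixed i H := fun z => ⟨F z, mem_fixed.2 fun γ hγ =>
      hFe γ.1 γ.2 (fun x => mem_fixed.1 (f x).2 γ hγ) (fun z => mem_fixed.1 (h z).2 γ hγ) z⟩
    have hF' : Continuous F' := continuous_induced_rng.2 hF
    exact ⟨⟨F', hF'⟩, fun x => Subtype.ext (hF0 x), fun z => Subtype.ext (hFh z)⟩
  · let s' : B.toPtGDiagram.Fixed i H → E.toPtGDiagram.Fixed i H := fun z =>
      ⟨s i z.1, mem_fixed.2 fun γ hγ =>
        (hes i γ.1 γ.2 z.1).trans (congrArg (s i) (mem_fixed.1 z.2 γ hγ))⟩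
    let D' : I → E.toPtGDiagram.Fixed i H → E.toPtGDiagram.Fixed i H := fun t y =>
      ⟨D i t y.1, mem_fixed.2 fun γ hγ =>
        (heD i γ.1 γ.2 t y.1).trans (congrArg (D i t) (mem_fixed.1 y.2 γ hγ))⟩
    refine isWeakEquiv_of_contraction _ s' D'
      (fun n b hb => ?_) (fun T _ _ _ b hb => ?_)
      (fun y => Subtype.ext (h0 i y.1)) (fun y => Subtype.ext (h1 i y.1))
      (fun t y => Subtype.ext (hpD i t y.1)) (fun z => Subtype.ext (hps i z.1))
    · have hb' : Continuous fun x => (b x).1 := continuous_subtype_val.comp hb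
      exact continuous_induced_rng.2 (hs i n _ hb')
    · have hb' : Continuous fun x => (b x).1 := continuous_subtype_val.comp hb
      exact continuous_induced_rng.2 (hD i T _ hb')

end PtTot

/-- The lifting property, transported to functors on the Grothendieck construction. Naturality of
the lift is checked separately on group elements and on morphisms of `I`, which generate all
morphisms. -/
theorem PtGDiagram.IsCofibrant.exists_lift {K : PtGDiagram a} (hK : K.IsCofibrant) {E B : PtTot a}
    (hE : ∀ i, CompactlyGeneratedSpace (E.functor.obj i) ∧ T2Space (E.functor.obj i))
    (hB : ∀ i, CompactlyGeneratedSpace (B.functor.obj i) ∧ T2Space (B.functor.obj i))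
    {p : E.functor ⟶ B.functor} {hp : ∀ i, p.app i (E.pt i) = B.pt i}
    (hacyc : (PtTot.hom p hp).IsAcyclicFibration) (f : K.toTot ⟶ B.functor)
    (hf : ∀ i : Idx a, f.app (tot i) (K.pt i) = B.pt (tot i)) :
    ∃ l : K.toTot ⟶ E.functor, (∀ i : Idx a, l.app (tot i) (K.pt i) = E.pt (tot i)) ∧ l ≫ p = f := by
  let f' : PtGDiagram.Hom K B.toPtGDiagram :=
    { nat :=
        { app := fun i => f.app (tot i)
          naturality := fun i j α => by
            have := f.naturality (totMap α)
            rwa [GDiagram.toTot_map_totMap] at this }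
      map_pt := hf
      comm := fun g i => by
        have := f.naturality (totTr g (i := i) rfl)
        rw [GDiagram.toTot_map_totTr] at this
        have h0 : K.tr g (i := i) rfl = (K.φ g).app i := by simp [GDiagram.tr]
        rw [h0] at this
        exact this.symm }
  obtain ⟨l, hl⟩ := hK _ _ (fun i => hE (tot i)) (fun i => hB (tot i)) _ hacyc f'
  refine ⟨{ app := fun i => l.nat.app i.idx, naturality := ?_ }, l.map_pt, ?_⟩
  · rintro ⟨i⟩ ⟨j⟩ m
    obtain ⟨g, α, rfl⟩ : ∃ (g : G) (α : g • i ⟶ j), m = totHom g α := ⟨m.elt, m.hom, rfl⟩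
    rw [totHom_eq, Functor.map_comp, Functor.map_comp, GDiagram.toTot_map_totTr,
      GDiagram.toTot_map_totMap]
    have h1 := l.tr_comm g (i := i) rfl
    have h2 := l.nat.naturality α
    have h3 : E.toPtGDiagram.tr g (i := i) rfl = E.functor.map (totTr g rfl) :=
      GDiagram.ofTot_tr E.functor g rfl
    rw [h3] at h1
    have e1 : (K.tr g (i := i) rfl ≫ K.functor.map α) ≫ l.nat.app j =
        K.tr g rfl ≫ l.nat.app (g • i) ≫ E.toPtGDiagram.functor.map α := by
      rw [Category.assoc, h2]
    have e2 : l.nat.app i ≫ E.functor.map (totTr g rfl) ≫ E.functor.map (totMap α) =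
        K.tr g rfl ≫ l.nat.app (g • i) ≫ E.toPtGDiagram.functor.map α := by
      refine (Category.assoc _ _ _).symm.trans ?_
      refine (congrArg (· ≫ E.functor.map (totMap α)) h1).trans ?_
      exact Category.assoc _ _ _
    exact e1.trans e2.symm
  · ext i : 2
    exact NatTrans.congr_app hl i.idx

end Lifting

/-! ## Paths to the latching subspace -/

section Latch

open scoped NNReal

variable {G : Type u} [Group G] {a : SingleObj G ⥤ Cat.{u, u}}
  (hfin : ∀ i : Idx a, ∃ d : ℕ, (nerve (Over i)).HasDimensionLT d) (K : PtTot a)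

theorem deg_le_of_tot {i j : Tot a} (m : i ⟶ j) : deg hfin i.idx ≤ deg hfin j.idx :=
  (deg_smul hfin m.elt i.idx).symm.trans_le (deg_le hfin m.hom)

theorem exists_totTr {i j : Tot a} (m : i ⟶ j) (h : deg hfin i.idx = deg hfin j.idx) :
    ∃ (g : G) (e : g • i.idx = j.idx), m = totTr g e := by
  obtain ⟨e, he⟩ := isIdentity_of_deg_eq hfin m.hom ((deg_smul hfin m.elt i.idx).trans h)
  exact ⟨m.elt, e, Tot.Hom.ext' rfl (he.trans (Category.id_comp _).symm)⟩

/-- The points in the image of objects of smaller degree, and the base point. -/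
def IsLatched {i : Tot a} (x : K.functor.obj i) : Prop :=
  x = K.pt i ∨ ∃ (j : Tot a) (m : j ⟶ i) (y : K.functor.obj j),
    deg hfin j.idx < deg hfin i.idx ∧ K.functor.map m y = x

/-- The latching subspace, with the final topology. -/
@[ext] structure Latch (i : Tot a) : Type u where
  /-- the point -/
  val : K.functor.obj i
  prop : IsLatched hfin K val

variable {hfin K}

/-- The maps to the latching subspace. -/
def Latch.of {j i : Tot a} (m : j ⟶ i) (h : deg hfin j.idx < deg hfin i.idx)
    (y : K.functor.obj j) : Latch hfin K i := ⟨K.functor.map m y, Or.inr ⟨j, m, y, h, rfl⟩⟩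

/-- The final topology is chosen instead of the subspace topology: a map defined degree by degree is
then automatically continuous on the latching subspace. The stronger requirement on maps into it is
absorbed by the lifting property of `K`. -/
instance (i : Tot a) : TopologicalSpace (Latch hfin K i) :=
  ⨆ (j : Tot a) (m : j ⟶ i) (h : deg hfin j.idx < deg hfin i.idx),
    TopologicalSpace.coinduced (Latch.of m h) inferInstance

theorem Latch.continuous_of {j i : Tot a} (m : j ⟶ i) (h : deg hfin j.idx < deg hfin i.idx) :
    Continuous (Latch.of (K := K) m h) :=
  continuous_iSup_rng (i := j) (continuous_iSup_rng (i := m)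
    (continuous_iSup_rng (i := h) continuous_coinduced_rng))

theorem Latch.continuous_dom {i : Tot a} {Y : Type*} [TopologicalSpace Y]
    {f : Latch hfin K i → Y} (hf : ∀ (j : Tot a) (m : j ⟶ i) (h : deg hfin j.idx < deg hfin i.idx),
      Continuous fun y => f (Latch.of m h y)) : Continuous f :=
  continuous_iSup_dom.2 fun j => continuous_iSup_dom.2 fun m => continuous_iSup_dom.2 fun h =>
    continuous_coinduced_dom.2 (hf j m h)

theorem Latch.continuous_val (i : Tot a) :
    Continuous (Latch.val : Latch hfin K i → K.functor.obj i) :=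
  Latch.continuous_dom fun _ m _ => (K.functor.map m).hom.continuous

/-- The action of the morphisms between objects of equal degree. -/
def Latch.map {i j : Tot a} (m : i ⟶ j) (h : deg hfin i.idx = deg hfin j.idx)
    (x : Latch hfin K i) : Latch hfin K j :=
  ⟨K.functor.map m x.val, by
    rcases x.prop with hx | ⟨k, n, y, hk, hx⟩
    · exact Or.inl (by rw [hx, K.map_pt])
    · exact Or.inr ⟨k, n ≫ m, y, h ▸ hk, by rw [map_comp_apply, hx]⟩⟩

theorem Latch.continuous_map {i j : Tot a} (m : i ⟶ j) (h : deg hfin i.idx = deg hfin j.idx) :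
    Continuous (Latch.map (K := K) m h) := by
  refine Latch.continuous_dom fun k n hk => ?_
  convert Latch.continuous_of (K := K) (n ≫ m) (h ▸ hk) using 2
  exact Latch.ext (map_comp_apply _ _ _ _).symm

variable (hfin K)

/-- Paths to the latching subspace: a point `c = (t, y)` of the cone on the latching subspace,
together with a path that is constant with value `y` from time `t⁻¹ - 1` on. -/
structure PathCone (i : Tot a) : Type u where
  /-- the path -/
  path : C(ℝ≥0, K.functor.obj i)
  /-- the point of the cone -/
  cone : Cone (Latch hfin K i)
  path_eq' : ∀ y, cone.pr = some y → ∀ r : ℝ≥0, 1 ≤ (cone.ht : ℝ) * (1 + r) → path r = y.val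

instance (i : Tot a) : TopologicalSpace (PathCone hfin K i) :=
  TopologicalSpace.induced (fun x => (x.path, x.cone)) inferInstance

namespace PathCone

variable {hfin K}

theorem path_eq {i : Tot a} (x : PathCone hfin K i) {y : Latch hfin K i} (h : x.cone.pr = some y)
    {r : ℝ≥0} (hr : 1 ≤ (x.cone.ht : ℝ) * (1 + r)) : x.path r = y.val := x.path_eq' y h r hr

theorem ext {i : Tot a} {x y : PathCone hfin K i} (h : ∀ r, x.path r = y.path r)
    (h' : x.cone = y.cone) : x = y := by
  obtain ⟨p, c, hx⟩ := x
  obtain ⟨q, d, hy⟩ := y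
  obtain rfl : p = q := ContinuousMap.ext h
  obtain rfl : c = d := h'
  rfl

theorem continuous_path {i : Tot a} : Continuous (path : PathCone hfin K i → _) :=
  have h : Continuous fun x : PathCone hfin K i => (x.path, x.cone) := continuous_induced_dom
  h.fst

theorem continuous_cone {i : Tot a} : Continuous (cone : PathCone hfin K i → _) :=
  have h : Continuous fun x : PathCone hfin K i => (x.path, x.cone) := continuous_induced_dom
  h.snd

theorem continuous_of {i : Tot a} {T : Type*} [TopologicalSpace T] {f : T → PathCone hfin K i}
    (h : Continuous fun x => (f x).path) (h' : Continuous fun x => (f x).cone) : Continuous f :=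
  continuous_induced_rng.2 (h.prodMk h')

instance (i : Tot a) [T2Space (K.functor.obj i)] : T2Space (PathCone hfin K i) :=
  have : T2Space (Latch hfin K i) :=
    T2Space.of_injective_continuous (fun _ _ => Latch.ext) (Latch.continuous_val i)
  T2Space.of_injective_continuous (f := fun x : PathCone hfin K i => (x.path, x.cone))
    (fun _ _ h => ext (DFunLike.congr_fun (congrArg Prod.fst h)) (congrArg Prod.snd h))
    continuous_induced_dom

/-- The constant path at a point of the latching subspace. -/
def const {i : Tot a} (x : Latch hfin K i) : PathCone hfin K i :=
  ⟨ContinuousMap.const _ x.val, Cone.mk 1 x, fun y hy r _ => by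
    rw [Cone.pr_mk one_ne_zero] at hy
    rw [Option.some_injective _ hy]
    rfl⟩

theorem continuous_const {i : Tot a} : Continuous (const : Latch hfin K i → _) :=
  continuous_of (ContinuousMap.continuous_const'.comp (Latch.continuous_val i))
    (Cone.continuous_mk _root_.continuous_const continuous_id)

open Classical in
/-- The functoriality of `PathCone`. -/
def map {i j : Tot a} (m : i ⟶ j) (x : PathCone hfin K i) : PathCone hfin K j :=
  if h : deg hfin i.idx < deg hfin j.idx then const (Latch.of m h (x.path 0))
  else ⟨(K.functor.map m).hom.comp x.path,
      x.cone.map (Latch.map m (le_antisymm (deg_le_of_tot hfin m) (not_lt.1 h))), fun y hy r hr => by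
    rw [Cone.pr_map] at hy
    obtain ⟨y', hy', rfl⟩ := Option.map_eq_some_iff.1 hy
    exact congrArg (K.functor.map m) (x.path_eq hy' hr)⟩

theorem map_of_lt {i j : Tot a} (m : i ⟶ j) (h : deg hfin i.idx < deg hfin j.idx)
    (x : PathCone hfin K i) : map m x = const (Latch.of m h (x.path 0)) := dif_pos h

theorem path_map {i j : Tot a} (m : i ⟶ j) (h : deg hfin i.idx = deg hfin j.idx)
    (x : PathCone hfin K i) (r : ℝ≥0) : (map m x).path r = K.functor.map m (x.path r) := by
  rw [map, dif_neg h.not_lt]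
  rfl

theorem cone_map {i j : Tot a} (m : i ⟶ j) (h : deg hfin i.idx = deg hfin j.idx)
    (x : PathCone hfin K i) : (map m x).cone = x.cone.map (Latch.map m h) := by
  rw [map, dif_neg h.not_lt]

theorem path_map_zero {i j : Tot a} (m : i ⟶ j) (x : PathCone hfin K i) :
    (map m x).path 0 = K.functor.map m (x.path 0) := by
  rcases (deg_le_of_tot hfin m).lt_or_eq with h | h
  · rw [map_of_lt m h]
    rfl
  · exact path_map m h x 0

theorem map_const {i j : Tot a} (m : i ⟶ j) (h : deg hfin i.idx = deg hfin j.idx)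
    (x : Latch hfin K i) : map m (const x) = const (Latch.map m h x) :=
  ext (fun r => path_map m h _ r) ((cone_map m h _).trans (Cone.map_mk _ _ _))

theorem continuous_map {i j : Tot a} (m : i ⟶ j) : Continuous (map (hfin := hfin) (K := K) m) := by
  rcases (deg_le_of_tot hfin m).lt_or_eq with h | h
  · rw [funext (map_of_lt m h)]
    exact continuous_const.comp ((Latch.continuous_of m h).comp
      ((continuous_eval_const (0 : ℝ≥0)).comp continuous_path))
  · refine continuous_of ?_ ?_
    · have : (fun x : PathCone hfin K i => (map m x).path) =
          fun x => (K.functor.map m).hom.comp x.path := funext fun x =>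
        ContinuousMap.ext fun r => path_map m h x r
      rw [this]
      exact (ContinuousMap.continuous_postcomp _).comp continuous_path
    · rw [funext (cone_map m h)]
      exact (Cone.continuous_map (Latch.continuous_map m h)).comp continuous_cone

theorem map_id {i : Tot a} (x : PathCone hfin K i) : map (𝟙 i) x = x := by
  refine ext (fun r => ?_) ?_
  · rw [path_map _ rfl, map_id_apply]
  · rw [cone_map _ rfl]
    convert Cone.map_id x.cone using 2
    exact funext fun y => Latch.ext (map_id_apply _ _)

/-- A morphism that raises the degree forgets everything except the starting point, and starting
points are natural for all morphisms; a degree-preserving morphism acts pointwise. -/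
theorem map_comp {i j k : Tot a} (m : i ⟶ j) (n : j ⟶ k) (x : PathCone hfin K i) :
    map (m ≫ n) x = map n (map m x) := by
  rcases (deg_le_of_tot hfin n).lt_or_eq with hn | hn
  · rw [map_of_lt n hn, map_of_lt _ ((deg_le_of_tot hfin m).trans_lt hn), path_map_zero]
    congr 1
    exact Latch.ext (map_comp_apply _ _ _ _)
  · rcases (deg_le_of_tot hfin m).lt_or_eq with hm | hm
    · rw [map_of_lt m hm, map_of_lt _ (hm.trans_eq hn), map_const n hn]
      congr 1
      exact Latch.ext (map_comp_apply _ _ _ _)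
    · refine ext (fun r => ?_) ?_
      · rw [path_map _ (hm.trans hn), path_map _ hn, path_map _ hm, map_comp_apply]
      · rw [cone_map _ (hm.trans hn), cone_map _ hn, cone_map _ hm, Cone.map_map]
        congr 1
        exact funext fun y => Latch.ext (map_comp_apply _ _ _ _)

end PathCone

/-- The functor of paths to the latching subspace. -/
def pathCone : PtTot a where
  functor :=
    { obj := fun i => TopCat.of (KSpace (PathCone hfin K i))
      map := fun m => TopCat.ofHom ⟨fun x => KSpace.mk (PathCone.map m x.out),
        KSpace.continuous_map (PathCone.continuous_map m)⟩
      map_id := fun i => by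
        ext x
        exact PathCone.map_id x
      map_comp := fun m n => by
        ext x
        exact PathCone.map_comp m n x }
  pt i := KSpace.mk (PathCone.const ⟨K.pt i, Or.inl rfl⟩)
  map_pt {i j} m := by
    change PathCone.map m (PathCone.const ⟨K.pt i, Or.inl rfl⟩) = PathCone.const _
    rcases (deg_le_of_tot hfin m).lt_or_eq with h | h
    · rw [PathCone.map_of_lt m h]
      exact congrArg _ (Latch.ext (K.map_pt m))
    · rw [PathCone.map_const m h]
      exact congrArg _ (Latch.ext (K.map_pt m))

/-- The starting point of a path. -/
def pathConeStart : (pathCone hfin K).functor ⟶ K.functor where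
  app i := TopCat.ofHom ⟨fun x => (KSpace.out (X := PathCone hfin K i) x).path 0,
    ((continuous_eval_const (0 : ℝ≥0)).comp PathCone.continuous_path).comp
      KSpace.continuous_out⟩
  naturality i j m := by
    ext x
    exact PathCone.path_map_zero m (KSpace.out x)

theorem pathConeStart_pt (i : Tot a) :
    (pathConeStart hfin K).app i ((pathCone hfin K).pt i) = K.pt i := rfl

/-- The time change of the contraction of the space of paths. -/
def shrinkTime (t : I) : ℝ≥0 := min 1 (Real.toNNReal (2 - 2 * t))

/-- The height change of the contraction of the space of paths. -/
def shrinkHeight (t : I) : I := projIcc 0 1 zero_le_one (1 - 2 * (t : ℝ))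

/-- The contraction has two phases: the height drops to `0` while the path is unchanged, and only
afterwards, when no end condition is left, is the path contracted to its starting point. -/
theorem shrinkTime_eq_one {t : I} (h : shrinkHeight t ≠ 0) : shrinkTime t = 1 := by
  rw [shrinkTime, min_eq_left]
  rw [Real.one_le_toNNReal]
  by_contra h'
  exact h (projIcc_of_le_left _ (by linarith))

namespace PathCone

variable {hfin K}

/-- The contraction of the space of paths to the space of starting points. -/
def shrink {i : Tot a} (t : I) (x : PathCone hfin K i) : PathCone hfin K i :=
  ⟨x.path.comp ⟨fun r => r * shrinkTime t, by fun_prop⟩, x.cone.scale (shrinkHeight t),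
    fun y hy r hr => by
      have h0 : shrinkHeight t ≠ 0 := fun h0 => by
        change (Cone.scale _ _).pr = _ at hy
        rw [h0, Cone.scale_zero] at hy
        exact Option.some_ne_none _ hy.symm
      change (Cone.scale _ _).pr = _ at hy
      rw [Cone.pr_scale h0] at hy
      change 1 ≤ ((Cone.scale _ _).ht : ℝ) * _ at hr
      rw [Cone.ht_scale, Set.Icc.coe_mul] at hr
      change x.path (r * shrinkTime t) = _
      rw [shrinkTime_eq_one h0, mul_one]
      refine x.path_eq hy (hr.trans ?_)
      have := (shrinkHeight t).2.2
      have := x.cone.ht.2.1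
      have := r.2
      gcongr
      exact mul_le_of_le_one_left ‹_› ‹_›⟩

theorem path_shrink {i : Tot a} (t : I) (x : PathCone hfin K i) (r : ℝ≥0) :
    (shrink t x).path r = x.path (r * shrinkTime t) := rfl

theorem cone_shrink {i : Tot a} (t : I) (x : PathCone hfin K i) :
    (shrink t x).cone = x.cone.scale (shrinkHeight t) := rfl

theorem continuous_shrink {i : Tot a} {T : Type*} [TopologicalSpace T] {b : T → PathCone hfin K i}
    (hb : Continuous b) : Continuous fun z : T × I => shrink z.2 (b z.1) := by
  have h1 : Continuous shrinkTime := by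
    unfold shrinkTime
    fun_prop
  have h2 : Continuous shrinkHeight := continuous_projIcc.comp (by fun_prop)
  refine continuous_of ?_ ?_
  · refine ContinuousMap.continuous_of_continuous_uncurry _ ?_
    exact (continuous_path.comp (hb.comp (continuous_fst.comp continuous_fst))).eval
      (continuous_snd.mul (h1.comp (continuous_snd.comp continuous_fst)))
  · exact Cone.continuous_scale (h2.comp continuous_snd)
      (continuous_cone.comp (hb.comp continuous_fst))

theorem shrink_zero {i : Tot a} (x : PathCone hfin K i) : shrink 0 x = x := by
  have h1 : shrinkTime 0 = 1 := by simp [shrinkTime]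
  have h2 : shrinkHeight 0 = 1 := projIcc_of_right_le _ (by simp)
  refine ext (fun r => ?_) ?_
  · rw [path_shrink, h1, mul_one]
  · rw [cone_shrink, h2, Cone.scale_one]

/-- The constant path, at height `0`. -/
def zero {i : Tot a} (z : K.functor.obj i) : PathCone hfin K i :=
  ⟨ContinuousMap.const _ z, Cone.base, fun y hy => (Option.some_ne_none y hy.symm).elim⟩

theorem continuous_zero {i : Tot a} : Continuous (zero (hfin := hfin) (K := K) (i := i)) :=
  continuous_of ContinuousMap.continuous_const' _root_.continuous_const

theorem shrink_one {i : Tot a} (x : PathCone hfin K i) : shrink 1 x = zero (x.path 0) := by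
  have h1 : shrinkTime 1 = 0 := by simp [shrinkTime]
  have h2 : shrinkHeight 1 = 0 := projIcc_of_le_left _ (by simp)
  refine ext (fun r => ?_) ?_
  · rw [path_shrink, h1, mul_zero]
    rfl
  · rw [cone_shrink, h2, Cone.scale_zero]
    rfl

theorem map_zero {i j : Tot a} (m : i ⟶ j) (h : deg hfin i.idx = deg hfin j.idx)
    (z : K.functor.obj i) : map m (zero (hfin := hfin) z) = zero (K.functor.map m z) :=
  ext (fun r => path_map m h _ r) (cone_map m h _)

theorem map_shrink {i j : Tot a} (m : i ⟶ j) (h : deg hfin i.idx = deg hfin j.idx) (t : I)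
    (x : PathCone hfin K i) : map m (shrink t x) = shrink t (map m x) :=
  ext (fun r => by rw [path_map m h, path_shrink, path_shrink, path_map m h])
    (by rw [cone_map m h, cone_shrink, cone_shrink, cone_map m h, Cone.map_scale])

end PathCone

/-- The height change of the path lifting. -/
def liftHeight (t : I) : I := ⟨1 / (1 + t), by
  have := t.2.1
  constructor
  · positivity
  · rw [div_le_one (by positivity)]
    linarith⟩

-- The lifted path at time `t` runs back along `h` from `h (x, t)` to `h (x, 0)` and then follows
-- the path of `f x`. The delay `t` before the end condition takes effect is paid for by dividing
-- the height by `1 + t`.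
open Classical in
theorem PathCone.exists_lift {i : Tot a} {T : Type} [TopologicalSpace T]
    {f : T → PathCone hfin K i} {h : T × I → K.functor.obj i} (hf : Continuous f)
    (hh : Continuous h) (hfh : ∀ x, (f x).path 0 = h (x, 0)) :
    ∃ F : T × I → PathCone hfin K i, Continuous F ∧ (∀ x, F (x, 0) = f x) ∧
      (∀ z, (F z).path 0 = h z) ∧
      ∀ (m : i ⟶ i), (∀ x, map m (f x) = f x) → (∀ z, K.functor.map m (h z) = h z) →
        ∀ z, map m (F z) = F z := by
  let P : (T × I) × ℝ≥0 → K.functor.obj i := fun w =>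
    if (w.2 : ℝ) ≤ w.1.2 then h (w.1.1, projIcc 0 1 zero_le_one (w.1.2 - w.2 : ℝ))
    else (f w.1.1).path (Real.toNNReal (w.2 - w.1.2 : ℝ))
  have hP : Continuous P := by
    refine Continuous.if_le ?_ ?_ (by fun_prop) (by fun_prop) ?_
    · exact hh.comp ((continuous_fst.comp continuous_fst).prodMk
        (continuous_projIcc.comp (by fun_prop)))
    · exact (continuous_path.comp (hf.comp (continuous_fst.comp continuous_fst))).eval
        (by fun_prop)
    · intro w hw
      rw [hw, sub_self, Real.toNNReal_zero, hfh, projIcc_of_le_left _ le_rfl]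
      rfl
  let F : T × I → PathCone hfin K i := fun z =>
    ⟨⟨fun r => P (z, r), by fun_prop⟩, (f z.1).cone.scale (liftHeight z.2), fun y hy r hr => by
      have h0 : liftHeight z.2 ≠ 0 := fun h0 => by
        have h1 : (1 : ℝ) / (1 + z.2) = 0 := congrArg Subtype.val h0
        have := z.2.2.1
        rw [div_eq_zero_iff] at h1
        rcases h1 with h1 | h1 <;> linarith
      change (Cone.scale _ _).pr = _ at hy
      rw [Cone.pr_scale h0] at hy
      change 1 ≤ ((Cone.scale _ _).ht : ℝ) * _ at hr
      rw [Cone.ht_scale, Set.Icc.coe_mul] at hr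
      have h1 : (liftHeight z.2 : ℝ) = 1 / (1 + z.2) := rfl
      have ht0 := z.2.2.1
      have hr0 := r.2
      have hc0 := (f z.1).cone.ht.2.1
      have hc1 := (f z.1).cone.ht.2.2
      rw [h1, one_div, mul_assoc, ← div_eq_inv_mul, le_div_iff₀ (by positivity), one_mul] at hr
      have hr1 : (z.2 : ℝ) ≤ r := by
        have := mul_le_of_le_one_left (by positivity : (0 : ℝ) ≤ 1 + r) hc1
        linarith
      -- With original height `c ≤ 1`, the hypothesis reads `1 + t ≤ c (1 + r)`; subtracting `c t ≤
      -- t` gives `1 ≤ c (1 + (r - t))`.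
      have hr2 : 1 ≤ ((f z.1).cone.ht : ℝ) * (1 + (r - z.2)) := by
        have := mul_le_of_le_one_left ht0 hc1
        nlinarith
      have hr3 : (f z.1).path (Real.toNNReal (r - z.2 : ℝ)) = y.val :=
        (f z.1).path_eq hy (by rwa [Real.coe_toNNReal _ (by linarith)])
      change P (z, r) = _
      by_cases hrz : (r : ℝ) ≤ z.2
      · have e : (r : ℝ) = z.2 := le_antisymm hrz hr1
        rw [e, sub_self, Real.toNNReal_zero, hfh] at hr3
        change (if _ then _ else _) = _
        rw [if_pos hrz]
        change h (z.1, projIcc 0 1 zero_le_one (z.2 - r : ℝ)) = _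
        rw [e, sub_self, projIcc_of_le_left _ le_rfl]
        exact hr3
      · change (if _ then _ else _) = _
        rw [if_neg hrz]
        exact hr3⟩
  have hFp : ∀ z r, (F z).path r = P (z, r) := fun _ _ => rfl
  have hFc : ∀ z, (F z).cone = (f z.1).cone.scale (liftHeight z.2) := fun _ => rfl
  refine ⟨F, ?_, fun x => ?_, fun z => ?_, fun m hm hm' z => ?_⟩
  · refine continuous_of ?_ ?_
    · exact ContinuousMap.continuous_of_continuous_uncurry _ hP
    · refine Cone.continuous_scale ?_ (continuous_cone.comp (hf.comp continuous_fst))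
      refine Continuous.subtype_mk ?_ _
      refine Continuous.div _root_.continuous_const (by fun_prop) fun z => ?_
      have := z.2.2.1
      positivity
  · refine ext (fun r => ?_) ?_
    · rw [hFp]
      change (if _ then _ else _) = _
      split_ifs with hr
      · have : r = 0 := le_antisymm (NNReal.coe_le_coe.1 (by simpa using hr)) bot_le
        subst this
        rw [hfh]
        simp
      · simp
    · rw [hFc]
      have : liftHeight 0 = 1 := Subtype.ext (by simp [liftHeight])
      rw [this, Cone.scale_one]
  · rw [hFp]
    change (if _ then _ else _) = _
    rw [if_pos (show (((0 : ℝ≥0) : ℝ)) ≤ z.2 from z.2.2.1)]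
    have : (z.2 - ((0 : ℝ≥0) : ℝ) : ℝ) = z.2 := by simp
    change h (z.1, projIcc 0 1 zero_le_one (z.2 - ((0 : ℝ≥0) : ℝ) : ℝ)) = _
    rw [this, projIcc_val]
  · refine ext (fun r => ?_) ?_
    · rw [path_map m rfl, hFp]
      change K.functor.map m (if _ then _ else _) = if _ then _ else _
      split_ifs with hr
      · exact hm' _
      · have := path_map m rfl (f z.1) (Real.toNNReal (r - z.2 : ℝ))
        rw [hm] at this
        exact this.symm
    · rw [cone_map m rfl, hFc, Cone.map_scale, ← cone_map m rfl, hm]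

/-- Constant paths of height `0` form a section, `shrink` deforms every path to such a path without
moving its starting point, and homotopies of starting points lift by prefixing their reversal. -/
theorem pathConeStart_isAcyclicFibration :
    (PtTot.hom (pathConeStart hfin K) (pathConeStart_pt hfin K)).IsAcyclicFibration := by
  refine PtTot.isAcyclicFibration_hom _ _ (fun i z => KSpace.mk (PathCone.zero z))
    (fun i t x => KSpace.mk (PathCone.shrink t (KSpace.out (X := PathCone hfin K (tot i)) x)))
    (fun i n b hb => KSpace.continuous_mk_of_compact (X := PathCone hfin K (tot i)) (PathCone.continuous_zero.comp hb))
    (fun i T _ _ _ b hb => KSpace.continuous_mk_of_compact (X := PathCone hfin K (tot i))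
      (PathCone.continuous_shrink (KSpace.continuous_out.comp hb)))
    (fun i x => PathCone.shrink_zero (KSpace.out x)) (fun i x => PathCone.shrink_one (KSpace.out x))
    (fun i t x => ?_) (fun i z => rfl) (fun i g h z => PathCone.map_zero _ rfl z)
    (fun i g h t x => PathCone.map_shrink _ rfl t (KSpace.out x))
    (fun i n f h hf hh hfh => ?_)
  · change (PathCone.shrink t (KSpace.out (X := PathCone hfin K (tot i)) x)).path 0 = _
    rw [PathCone.path_shrink, zero_mul]
    rfl
  · obtain ⟨F, h1, h2, h3, h4⟩ := PathCone.exists_lift hfin K (f := fun x => KSpace.out (f x))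
      (KSpace.continuous_out.comp hf) hh hfh
    exact ⟨fun z => KSpace.mk (F z), KSpace.continuous_mk_of_compact (X := PathCone hfin K (tot i)) h1, h2, h3,
      fun g e => h4 (totTr g e)⟩

end Latch

/-! ## Normal forms of points of a cofibrant diagram -/

section Sep

variable {G : Type u} [Group G] {a : SingleObj G ⥤ Cat.{u, u}}
  (hfin : ∀ i : Idx a, ∃ d : ℕ, (nerve (Over i)).HasDimensionLT d) (K : PtTot a)

theorem totTr_totMap_eqToHom (g : G) {i j k : Idx a} (e : g • i = j) (e' : j = k) :
    totTr g e ≫ totMap (eqToHom e') = totTr g (e.trans e') := by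
  rw [totTr_totMap]
  exact totHom_ext rfl (by simp)

theorem eq_totTr_totMap {i j : Tot a} (m : i ⟶ j) :
    m = totTr m.elt (i := i.idx) rfl ≫ totMap m.hom := totHom_eq m.elt m.hom

/-- Points of `K` at objects of degree `n`, pushed forward formally. -/
def FreePush (n : ℕ) (i : Tot a) : Type u :=
  Σ (j : {j : Idx a // deg hfin j = n}) (_ : j.1 ⟶ i.idx), K.functor.obj (tot j.1)

instance (n : ℕ) (i : Tot a) : TopologicalSpace (FreePush hfin K n i) :=
  inferInstanceAs (TopologicalSpace (Σ (j : {j : Idx a // deg hfin j = n}) (_ : j.1 ⟶ i.idx),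
    K.functor.obj (tot j.1)))

namespace FreePush

variable {hfin K} {n : ℕ}

/-- The formal image of `y` under `α`. -/
def mk {i : Tot a} {j : Idx a} (h : deg hfin j = n) (α : j ⟶ i.idx) (y : K.functor.obj (tot j)) :
    FreePush hfin K n i := ⟨⟨j, h⟩, α, y⟩

theorem continuous_mk {i : Tot a} {j : Idx a} (h : deg hfin j = n) (α : j ⟶ i.idx) :
    Continuous (mk (K := K) (i := i) h α) :=
  Continuous.comp (Y := Σ _ : j ⟶ i.idx, K.functor.obj (tot j)) (Z := FreePush hfin K n i)
    continuous_sigmaMk continuous_sigmaMk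

theorem mk_eq {i : Tot a} {j j' : Idx a} {h : deg hfin j = n} {h' : deg hfin j' = n}
    {α : j ⟶ i.idx} {α' : j' ⟶ i.idx} {y : K.functor.obj (tot j)} {y' : K.functor.obj (tot j')}
    (e : j = j') (hα : α = eqToHom e ≫ α') (hy : K.functor.map (totMap (eqToHom e)) y = y') :
    (mk h α y : FreePush hfin K n i) = mk h' α' y' := by
  subst e
  rw [eqToHom_refl, totMap_id, map_id_apply] at hy
  rw [eqToHom_refl, Category.id_comp] at hα
  rw [hα, hy]

theorem of_mk_eq {i : Tot a} {j j' : Idx a} {h : deg hfin j = n} {h' : deg hfin j' = n}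
    {α : j ⟶ i.idx} {α' : j' ⟶ i.idx} {y : K.functor.obj (tot j)} {y' : K.functor.obj (tot j')}
    (heq : (mk h α y : FreePush hfin K n i) = mk h' α' y') :
    ∃ e : j = j', α = eqToHom e ≫ α' ∧ K.functor.map (totMap (eqToHom e)) y = y' := by
  have e : j = j' := congrArg (fun z : FreePush hfin K n i => z.1.1) heq
  subst e
  have h1 := eq_of_heq (Sigma.mk.inj heq).2
  have h2 : α = α' := congrArg Sigma.fst h1
  subst h2
  refine ⟨rfl, by simp, ?_⟩
  rw [eqToHom_refl, totMap_id, map_id_apply]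
  exact eq_of_heq (Sigma.mk.inj h1).2

theorem exists_mk {i : Tot a} (s : FreePush hfin K n i) :
    ∃ (j : Idx a) (h : deg hfin j = n) (α : j ⟶ i.idx) (y : K.functor.obj (tot j)),
      s = mk h α y := ⟨s.1.1, s.1.2, s.2.1, s.2.2, rfl⟩

instance [∀ i, T2Space (K.functor.obj i)] (i : Tot a) : T2Space (FreePush hfin K n i) :=
  inferInstanceAs (T2Space (Σ (j : {j : Idx a // deg hfin j = n}) (_ : j.1 ⟶ i.idx),
    K.functor.obj (tot j.1)))

/-- The functoriality of `FreePush`. -/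
def map {i j : Tot a} (m : i ⟶ j) (s : FreePush hfin K n i) : FreePush hfin K n j :=
  mk ((deg_smul hfin m.elt s.1.1).trans s.1.2) (gmap m.elt s.2.1 ≫ m.hom)
    (K.functor.map (totTr m.elt rfl) s.2.2)

theorem map_mk {i j : Tot a} (m : i ⟶ j) {k : Idx a} (h : deg hfin k = n) (α : k ⟶ i.idx)
    (y : K.functor.obj (tot k)) : map m (mk h α y) =
      mk ((deg_smul hfin m.elt k).trans h) (gmap m.elt α ≫ m.hom)
        (K.functor.map (totTr m.elt rfl) y) := rfl

theorem continuous_map {i j : Tot a} (m : i ⟶ j) :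
    Continuous (map (hfin := hfin) (K := K) (n := n) m) := by
  refine continuous_sigma fun k => continuous_sigma fun α => ?_
  exact (continuous_mk (i := j) ((deg_smul hfin m.elt k.1).trans k.2)
    (gmap m.elt α ≫ m.hom)).comp (K.functor.map (totTr m.elt rfl)).hom.continuous

theorem map_id {i : Tot a} (s : FreePush hfin K n i) : map (𝟙 i) s = s := by
  obtain ⟨j, h, α, y, rfl⟩ := s.exists_mk
  rw [map_mk]
  refine mk_eq (one_smul G j) ?_ ?_
  · change gmap (1 : G) α ≫ eqToHom (one_smul G i.idx) = _
    rw [gmap_one]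
    simp
  · rw [← map_comp_apply]
    change K.functor.map (totTr 1 rfl ≫ _) y = _
    rw [totTr_totMap_eqToHom, totTr_one, map_id_apply]

theorem map_comp {i j k : Tot a} (m : i ⟶ j) (m' : j ⟶ k) (s : FreePush hfin K n i) :
    map (m ≫ m') s = map m' (map m s) := by
  obtain ⟨l, h, α, y, rfl⟩ := s.exists_mk
  rw [map_mk, map_mk, map_mk]
  refine mk_eq (mul_smul m'.elt m.elt l) ?_ ?_
  · change gmap (m'.elt * m.elt) α ≫ (eqToHom (mul_smul _ _ _) ≫ gmap m'.elt m.hom ≫ m'.hom) = _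
    rw [gmap_mul]
    simp
  · rw [← map_comp_apply, ← map_comp_apply]
    change K.functor.map (totTr (m'.elt * m.elt) rfl ≫ _) y = _
    rw [totTr_totMap_eqToHom, totTr_comp]

theorem isEmpty {i : Tot a} (h : deg hfin i.idx < n) (s : FreePush hfin K n i) : False := by
  have := deg_le hfin s.2.1
  rw [s.1.2] at this
  omega

/-- Evaluation of formal images. -/
def eval {i : Tot a} (s : FreePush hfin K n i) : K.functor.obj i := K.functor.map (totMap s.2.1) s.2.2

theorem eval_mk {i : Tot a} {j : Idx a} (h : deg hfin j = n) (α : j ⟶ i.idx)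
    (y : K.functor.obj (tot j)) :
    eval (mk h α y : FreePush hfin K n i) = K.functor.map (totMap α : tot j ⟶ i) y := rfl

theorem continuous_eval {i : Tot a} : Continuous (eval (hfin := hfin) (K := K) (n := n) (i := i)) :=
  continuous_sigma fun _ => continuous_sigma fun α => (K.functor.map (totMap α)).hom.continuous

theorem eval_map {i j : Tot a} (m : i ⟶ j) (s : FreePush hfin K n i) :
    eval (map m s) = K.functor.map m (eval s) := by
  obtain ⟨k, h, α, y, rfl⟩ := s.exists_mk
  rw [map_mk, eval_mk, eval_mk, ← map_comp_apply, ← map_comp_apply, totTr_totMap]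
  congr 3
  have e : totMap α ≫ m = totMap α ≫ totTr m.elt rfl ≫ totMap m.hom :=
    congrArg (totMap α ≫ ·) (eq_totTr_totMap m)
  rw [e]
  refine Eq.trans ?_ (Category.assoc _ _ _)
  rw [totMap_totTr, totHom_comp]
  exact totHom_ext (one_mul _).symm (by simp [gmap_one])

/-- At an object of degree `n` the only morphisms from objects of degree `n` are identities, so
formal images are just points of `K_i`. -/
theorem mk_eval {i : Tot a} (hi : deg hfin i.idx = n) (s : FreePush hfin K n i) :
    mk hi (𝟙 i.idx) (eval s) = s := by
  obtain ⟨j, h, α, y, rfl⟩ := s.exists_mk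
  obtain ⟨e, rfl⟩ := isIdentity_of_deg_eq hfin α (h.trans hi.symm)
  exact (mk_eq e (by simp) rfl).symm

end FreePush

theorem FreePush.coneMap_id {n : ℕ} {i : Tot a} (c : Cone (FreePush hfin K n i)) :
    Cone.map (FreePush.map (𝟙 i)) c = c := by
  rw [show (FreePush.map (hfin := hfin) (K := K) (n := n) (𝟙 i)) = fun y => y from
    funext FreePush.map_id]
  exact Cone.map_id c

theorem FreePush.coneMap_comp {n : ℕ} {i j k : Tot a} (m : i ⟶ j) (m' : j ⟶ k)
    (c : Cone (FreePush hfin K n i)) : Cone.map (FreePush.map (m ≫ m')) c =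
      Cone.map (FreePush.map m') (Cone.map (FreePush.map m) c) := by
  rw [Cone.map_map]
  congr 1
  exact funext (FreePush.map_comp m m')

/-- The cones on formal images. -/
def freeCone (n : ℕ) : PtTot a where
  functor :=
    { obj := fun i => TopCat.of (KSpace (Cone (FreePush hfin K n i)))
      map := fun m => TopCat.ofHom ⟨fun c => KSpace.mk (Cone.map (FreePush.map m) c.out),
        KSpace.continuous_map (Cone.continuous_map (FreePush.continuous_map m))⟩
      map_id := fun i => by
        ext c
        exact FreePush.coneMap_id hfin K _
      map_comp := fun m m' => by
        ext c
        exact FreePush.coneMap_comp hfin K m m' _ }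
  pt _ := KSpace.mk Cone.base
  map_pt _ := rfl

/-- The space at `i`, if `i` has degree `n`. -/
abbrev DegPart (n : ℕ) (i : Tot a) : Type u := {_x : K.functor.obj i // deg hfin i.idx = n}

variable {hfin K} in
/-- The functoriality of `DegPart`. -/
def DegPart.map {n : ℕ} {i j : Tot a} (m : i ⟶ j) (h : deg hfin i.idx = deg hfin j.idx)
    (x : DegPart hfin K n i) : DegPart hfin K n j := ⟨K.functor.map m x.1, h.symm.trans x.2⟩

variable {hfin K} in
theorem DegPart.continuous_map {n : ℕ} {i j : Tot a} (m : i ⟶ j)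
    (h : deg hfin i.idx = deg hfin j.idx) : Continuous (DegPart.map (K := K) (n := n) m h) :=
  ((K.functor.map m).hom.continuous.comp continuous_subtype_val).subtype_mk _

open Classical in
variable {hfin K} in
/-- The functoriality of the cone on `DegPart`. -/
def DegPart.coneMap {n : ℕ} {i j : Tot a} (m : i ⟶ j) (c : Cone (DegPart hfin K n i)) :
    Cone (DegPart hfin K n j) :=
  if h : deg hfin i.idx = deg hfin j.idx then c.map (DegPart.map m h) else Cone.base

variable {hfin K} in
theorem DegPart.coneMap_of_eq {n : ℕ} {i j : Tot a} (m : i ⟶ j)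
    (h : deg hfin i.idx = deg hfin j.idx) (c : Cone (DegPart hfin K n i)) :
    DegPart.coneMap m c = c.map (DegPart.map m h) := dif_pos h

variable {hfin K} in
theorem DegPart.coneMap_of_ne {n : ℕ} {i j : Tot a} (m : i ⟶ j)
    (h : deg hfin i.idx ≠ deg hfin j.idx) (c : Cone (DegPart hfin K n i)) :
    DegPart.coneMap m c = Cone.base := dif_neg h

variable {hfin K} in
theorem DegPart.coneMap_base {n : ℕ} {i j : Tot a} (m : i ⟶ j) :
    DegPart.coneMap m (Cone.base : Cone (DegPart hfin K n i)) = Cone.base := by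
  by_cases h : deg hfin i.idx = deg hfin j.idx
  · rw [DegPart.coneMap_of_eq _ h, Cone.map_base]
  · rw [DegPart.coneMap_of_ne _ h]

variable {hfin K} in
theorem DegPart.coneMap_id {n : ℕ} {i : Tot a} (c : Cone (DegPart hfin K n i)) :
    DegPart.coneMap (𝟙 i) c = c := by
  rw [DegPart.coneMap_of_eq _ rfl]
  convert Cone.map_id c using 2
  exact funext fun y => Subtype.ext (map_id_apply _ _)

variable {hfin K} in
theorem DegPart.coneMap_comp {n : ℕ} {i j k : Tot a} (m : i ⟶ j) (m' : j ⟶ k)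
    (c : Cone (DegPart hfin K n i)) :
    DegPart.coneMap (m ≫ m') c = DegPart.coneMap m' (DegPart.coneMap m c) := by
  have h1 := deg_le_of_tot hfin m
  have h2 := deg_le_of_tot hfin m'
  by_cases h : deg hfin i.idx = deg hfin j.idx
  · by_cases h' : deg hfin j.idx = deg hfin k.idx
    · rw [DegPart.coneMap_of_eq _ (h.trans h'), DegPart.coneMap_of_eq _ h',
        DegPart.coneMap_of_eq _ h, Cone.map_map]
      congr 1
      exact funext fun y => Subtype.ext (map_comp_apply _ _ _ _)
    · rw [DegPart.coneMap_of_ne _ (h ▸ h'), DegPart.coneMap_of_ne _ h']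
  · rw [DegPart.coneMap_of_ne _ (fun e => h (by omega)), DegPart.coneMap_of_ne _ h,
      DegPart.coneMap_base]

/-- The cones on the parts of degree `n`. -/
def degCone (n : ℕ) : PtTot a where
  functor :=
    { obj := fun i => TopCat.of (KSpace (Cone (DegPart hfin K n i)))
      map := fun {i j} m => TopCat.ofHom ⟨fun c => KSpace.mk (DegPart.coneMap m c.out), by
        refine KSpace.continuous_map ?_
        by_cases h : deg hfin i.idx = deg hfin j.idx
        · rw [funext (DegPart.coneMap_of_eq m h)]
          exact Cone.continuous_map (DegPart.continuous_map m h)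
        · rw [funext (DegPart.coneMap_of_ne m h)]
          exact continuous_const⟩
      map_id := fun i => by
        ext c
        exact DegPart.coneMap_id _
      map_comp := fun {i j k} m m' => by
        ext c
        exact DegPart.coneMap_comp m m' _ }
  pt _ := KSpace.mk Cone.base
  map_pt {i j} m := by
    exact DegPart.coneMap_base m

/-! ### The evaluation of cones on formal images -/

variable {hfin K} {n : ℕ}

theorem degCone_eq_base {i : Tot a} (h : deg hfin i.idx ≠ n) (c : Cone (DegPart hfin K n i)) :
    c = Cone.base := by
  rcases c.eq_base_or with rfl | ⟨_, y, -, -⟩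
  · rfl
  · exact (h y.2).elim

theorem freeCone_eq_base {i : Tot a} (h : deg hfin i.idx < n) (c : Cone (FreePush hfin K n i)) :
    c = Cone.base := by
  rcases c.eq_base_or with rfl | ⟨_, y, -, -⟩
  · rfl
  · exact (y.isEmpty h).elim

open Classical in
/-- Evaluation on cones. -/
def FreePush.coneEval {i : Tot a} (c : Cone (FreePush hfin K n i)) : Cone (DegPart hfin K n i) :=
  if h : deg hfin i.idx = n then c.map fun s => ⟨s.eval, h⟩ else Cone.base

theorem FreePush.coneEval_of_eq {i : Tot a} (h : deg hfin i.idx = n)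
    (c : Cone (FreePush hfin K n i)) : coneEval c = c.map fun s => ⟨s.eval, h⟩ := dif_pos h

theorem FreePush.coneEval_map {i j : Tot a} (m : i ⟶ j) (c : Cone (FreePush hfin K n i)) :
    coneEval (c.map (map m)) = DegPart.coneMap m (coneEval c) := by
  have h1 := deg_le_of_tot hfin m
  by_cases hj : deg hfin j.idx = n
  · by_cases hi : deg hfin i.idx = n
    · rw [coneEval_of_eq hi, coneEval_of_eq hj, DegPart.coneMap_of_eq _ (hi.trans hj.symm),
        Cone.map_map, Cone.map_map]
      congr 1
      exact funext fun s => Subtype.ext (eval_map m s)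
    · rw [freeCone_eq_base (lt_of_le_of_ne (hj ▸ h1) hi) c, Cone.map_base,
        DegPart.coneMap_of_ne _ (fun e => hi (e.trans hj)), coneEval_of_eq hj, Cone.map_base]
  · rw [degCone_eq_base hj (coneEval _), degCone_eq_base hj (DegPart.coneMap _ _)]

theorem FreePush.continuous_coneEval {i : Tot a} :
    Continuous (coneEval (hfin := hfin) (K := K) (n := n) (i := i)) := by
  by_cases h : deg hfin i.idx = n
  · rw [funext (coneEval_of_eq h)]
    exact Cone.continuous_map (continuous_eval.subtype_mk _)
  · rw [funext fun c => degCone_eq_base h (coneEval c)]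
    exact continuous_const

/-- The section of the evaluation on cones. -/
def FreePush.coneSection {i : Tot a} (c : Cone (DegPart hfin K n i)) : Cone (FreePush hfin K n i) :=
  c.map fun x => mk x.2 (𝟙 i.idx) x.1

theorem FreePush.continuous_coneSection {i : Tot a} :
    Continuous (coneSection (hfin := hfin) (K := K) (n := n) (i := i)) := by
  by_cases h : deg hfin i.idx = n
  · exact Cone.continuous_map ((continuous_mk h (𝟙 i.idx)).comp continuous_subtype_val)
  · have : coneSection (hfin := hfin) (K := K) (n := n) (i := i) = fun _ => Cone.base :=
      funext fun c => congrArg coneSection (degCone_eq_base h c)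
    rw [this]
    exact continuous_const

theorem FreePush.coneEval_coneSection {i : Tot a} (c : Cone (DegPart hfin K n i)) :
    coneEval (coneSection c) = c := by
  by_cases h : deg hfin i.idx = n
  · rw [coneEval_of_eq h, coneSection, Cone.map_map]
    convert Cone.map_id c using 2
    refine funext fun x => Subtype.ext ?_
    dsimp only
    rw [eval_mk]
    exact (congrArg (fun m => K.functor.map m x.1) (totMap_id i.idx)).trans (map_id_apply _ _)
  · rw [degCone_eq_base h c, degCone_eq_base h (coneEval _)]

theorem FreePush.coneSection_coneEval {i : Tot a} (h : deg hfin i.idx = n)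
    (c : Cone (FreePush hfin K n i)) : coneSection (coneEval c) = c := by
  rw [coneEval_of_eq h, coneSection, Cone.map_map]
  convert Cone.map_id c using 2
  exact funext fun s => mk_eval h s

theorem FreePush.map_coneSection {i j : Tot a} (m : i ⟶ j) (h : deg hfin i.idx = deg hfin j.idx)
    (c : Cone (DegPart hfin K n i)) :
    (coneSection c).map (map m) = coneSection (DegPart.coneMap m c) := by
  rcases c.eq_base_or with rfl | ⟨t, y, -, rfl⟩
  · rw [DegPart.coneMap_of_eq _ h]
    rfl
  · have hi := y.2
    conv_lhs => rw [← coneSection_coneEval (h.symm.trans hi) ((coneSection _).map (map m))]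
    rw [coneEval_map, coneEval_coneSection]

variable (hfin K n)

/-- The evaluation. -/
def freeConeEval : (freeCone hfin K n).functor ⟶ (degCone hfin K n).functor where
  app i := TopCat.ofHom ⟨fun c => KSpace.mk (FreePush.coneEval (KSpace.out
      (X := Cone (FreePush hfin K n i)) c)),
    KSpace.continuous_map FreePush.continuous_coneEval⟩
  naturality i j m := by
    ext c
    exact FreePush.coneEval_map m _

theorem freeConeEval_pt (i : Tot a) :
    (freeConeEval hfin K n).app i ((freeCone hfin K n).pt i) = (degCone hfin K n).pt i := by
  change FreePush.coneEval Cone.base = Cone.base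
  by_cases h : deg hfin i.idx = n
  · rw [FreePush.coneEval_of_eq h, Cone.map_base]
  · exact degCone_eq_base h _

open Classical in
/-- The height change of the contraction of the cones on formal images. -/
def freeShrink (i : Idx a) (t : I) : I := if deg hfin i = n then 1 else σ t

theorem freeShrink_zero (i : Idx a) : freeShrink hfin n i 0 = 1 := by
  unfold freeShrink
  split_ifs <;> simp

theorem freeShrink_of_eq {i : Idx a} (h : deg hfin i = n) (t : I) : freeShrink hfin n i t = 1 :=
  if_pos h

theorem freeShrink_one {i : Idx a} (h : deg hfin i ≠ n) : freeShrink hfin n i 1 = 0 := by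
  rw [freeShrink, if_neg h, symm_one]

theorem continuous_freeShrink (i : Idx a) : Continuous (freeShrink hfin n i) := by
  unfold freeShrink
  split_ifs
  · exact continuous_const
  · exact continuous_symm

theorem FreePush.scale_freeShrink_one {i : Idx a} (c : Cone (FreePush hfin K n (tot i))) :
    Cone.scale (freeShrink hfin n i 1) c = coneSection (coneEval c) := by
  by_cases h : deg hfin i = n
  · rw [freeShrink_of_eq hfin n h, Cone.scale_one, coneSection_coneEval (i := tot i) h]
  · rw [freeShrink_one hfin n h, Cone.scale_zero, degCone_eq_base (i := tot i) h (coneEval c)]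
    rfl

theorem FreePush.coneEval_scale {i : Idx a} (t : I) (c : Cone (FreePush hfin K n (tot i))) :
    coneEval (Cone.scale (freeShrink hfin n i t) c) = coneEval c := by
  by_cases h : deg hfin i = n
  · rw [freeShrink_of_eq hfin n h, Cone.scale_one]
  · rw [degCone_eq_base (i := tot i) h (coneEval c), degCone_eq_base (i := tot i) h (coneEval _)]

/-- At objects of degree `n` the evaluation is a bijection with inverse `coneSection`. At all other
objects the target is a point and the source is a cone, contracted by scaling the height. -/
theorem freeConeEval_isAcyclicFibration :
    (PtTot.hom (freeConeEval hfin K n) (freeConeEval_pt hfin K n)).IsAcyclicFibration := by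
  refine PtTot.isAcyclicFibration_hom _ _
    (fun i z => KSpace.mk (FreePush.coneSection (KSpace.out (X := Cone (DegPart hfin K n (tot i))) z)))
    (fun i t c => KSpace.mk (Cone.scale (freeShrink hfin n i t)
      (KSpace.out (X := Cone (FreePush hfin K n (tot i))) c)))
    (fun i m b hb => KSpace.continuous_mk_of_compact (X := Cone (FreePush hfin K n (tot i)))
      (FreePush.continuous_coneSection.comp (KSpace.continuous_out.comp hb)))
    (fun i T _ _ _ b hb => KSpace.continuous_mk_of_compact (X := Cone (FreePush hfin K n (tot i)))
        (Cone.continuous_scale ((continuous_freeShrink hfin n i).comp continuous_snd)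
          (KSpace.continuous_out.comp (hb.comp continuous_fst))))
    (fun i c => ?_) (fun i c => FreePush.scale_freeShrink_one hfin K n _)
    (fun i t c => FreePush.coneEval_scale hfin K n t _)
    (fun i z => FreePush.coneEval_coneSection _)
    (fun i g h z => FreePush.map_coneSection (i := tot i) (j := tot i) _ rfl _)
    (fun i g h t c => Cone.map_scale _ _ _) (fun i m f h hf hh hfh => ?_)
  · change Cone.scale _ _ = _
    rw [freeShrink_zero]
    exact Cone.scale_one _
  · by_cases hi : deg hfin i = n
    · refine ⟨fun z => KSpace.mk (FreePush.coneSection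
        (KSpace.out (X := Cone (DegPart hfin K n (tot i))) (h z))),
        KSpace.continuous_mk_of_compact (X := Cone (FreePush hfin K n (tot i)))
          (FreePush.continuous_coneSection.comp (KSpace.continuous_out.comp hh)), fun x => ?_,
        fun z => FreePush.coneEval_coneSection _, fun g e _ hhe z => ?_⟩
      · dsimp only
        rw [← hfh]
        exact FreePush.coneSection_coneEval (i := tot i) hi _
      · refine (FreePush.map_coneSection (i := tot i) (j := tot i) (totTr g e) rfl _).trans ?_
        exact congrArg FreePush.coneSection (hhe z)
    -- The target is a point here, so the constant homotopy is a lift.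
    · exact ⟨fun z => f z.1, hf.comp continuous_fst, fun _ => rfl, fun z =>
        (degCone_eq_base (i := tot i) hi _).trans (degCone_eq_base (i := tot i) hi _).symm,
        fun g e hfe _ z => hfe z.1⟩

end Sep

/-! ## Consequences of cofibrancy -/

section Cofibrant

variable {G : Type u} [Group G] {a : SingleObj G ⥤ Cat.{u, u}}
  (hfin : ∀ i : Idx a, ∃ d : ℕ, (nerve (Over i)).HasDimensionLT d)

/-- A natural choice of paths to the latching subspace. -/
structure LatchSection (K : PtTot a) where
  /-- the paths -/
  toFun (i : Tot a) : K.functor.obj i → PathCone hfin K i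
  continuous_toFun (i : Tot a) : Continuous (toFun i)
  path_zero (i : Tot a) (x : K.functor.obj i) : (toFun i x).path 0 = x
  map_toFun {i j : Tot a} (m : i ⟶ j) (x : K.functor.obj i) :
    PathCone.map m (toFun i x) = toFun j (K.functor.map m x)
  toFun_pt (i : Tot a) : toFun i (K.pt i) = PathCone.const ⟨K.pt i, Or.inl rfl⟩

variable {hfin}

namespace LatchSection

variable {K : PtTot a} (s : LatchSection hfin K)

/-- The height function, which has the value `1` on the latching subspace. -/
def ht {i : Tot a} (x : K.functor.obj i) : I := (s.toFun i x).cone.ht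

theorem continuous_ht {i : Tot a} : Continuous (s.ht (i := i)) :=
  Cone.continuous_ht.comp (PathCone.continuous_cone.comp (s.continuous_toFun i))

theorem ht_map_of_lt {i j : Tot a} (m : i ⟶ j) (h : deg hfin i.idx < deg hfin j.idx)
    (x : K.functor.obj i) : s.ht (K.functor.map m x) = 1 := by
  rw [ht, ← s.map_toFun, PathCone.map_of_lt m h]
  rfl

theorem ht_map_of_eq {i j : Tot a} (m : i ⟶ j) (h : deg hfin i.idx = deg hfin j.idx)
    (x : K.functor.obj i) : s.ht (K.functor.map m x) = s.ht x := by
  rw [ht, ← s.map_toFun, PathCone.cone_map m h]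
  rfl

theorem ht_pt (i : Tot a) : s.ht (K.pt i) = 1 := by
  rw [ht, s.toFun_pt]
  rfl

/-- At height `1` the end condition already holds at time `0`, so the starting point `x` itself lies
in the latching subspace. The converse is naturality, since pushing forward from a smaller degree
yields a constant path of height `1`. -/
theorem isLatched_iff {i : Tot a} (x : K.functor.obj i) : IsLatched hfin K x ↔ s.ht x = 1 := by
  constructor
  · rintro (rfl | ⟨j, m, y, h, rfl⟩)
    · exact s.ht_pt i
    · exact s.ht_map_of_lt m h y
  · intro h
    rcases (s.toFun i x).cone.eq_base_or with h' | ⟨t, y, ht, h'⟩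
    · rw [ht, h'] at h
      exact (zero_ne_one h).elim
    · have := (s.toFun i x).path_eq (y := y) (by rw [h', Cone.pr_mk ht]) (r := 0)
        (by rw [show (s.toFun i x).cone.ht = 1 from h]; simp)
      rw [s.path_zero] at this
      rw [this]
      exact y.prop

end LatchSection

theorem FreePush.map_mk_id {K : PtTot a} {n : ℕ} {i : Tot a} {k : Idx a} (hk : deg hfin k = n)
    (β : k ⟶ i.idx) (y : K.functor.obj (tot k)) :
    FreePush.map (totMap β : tot k ⟶ i) (FreePush.mk hk (𝟙 k) y) =
      (FreePush.mk hk β y : FreePush hfin K n i) := by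
  rw [FreePush.map_mk]
  refine FreePush.mk_eq (one_smul G k) ?_ ?_
  · change gmap (1 : G) (𝟙 k) ≫ eqToHom _ ≫ β = _
    rw [gmap_id, Category.id_comp]
    rfl
  · rw [← map_comp_apply]
    have e : totTr (1 : G) (i := k) rfl ≫ totMap (eqToHom (one_smul G k)) = 𝟙 (tot k) :=
      totTr_totMap_eqToHom 1 rfl (one_smul G k)
    exact (congrArg (fun m => K.functor.map m y) e).trans (map_id_apply _ _)

variable {K : PtGDiagram a}

/-- A lift of the identity of `K` along `pathConeStart`. In classical terms, the latching subspace
is a natural neighbourhood deformation retract. -/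
theorem PtGDiagram.IsCofibrant.exists_latchSection (hK : K.IsCofibrant) (hKC : K.IsCGHaus) :
    Nonempty (LatchSection hfin K.toPtTot) := by
  have : ∀ i, T2Space (K.toPtTot.functor.obj i) := fun i => (hKC i.idx).2
  obtain ⟨l, hl, hlp⟩ := hK.exists_lift (E := pathCone hfin K.toPtTot) (B := K.toPtTot)
    (fun i => ⟨inferInstanceAs (CompactlyGeneratedSpace (KSpace (PathCone hfin K.toPtTot i))),
      inferInstanceAs (T2Space (KSpace (PathCone hfin K.toPtTot i)))⟩) (fun i => hKC i.idx)
    (pathConeStart_isAcyclicFibration hfin K.toPtTot) (𝟙 _) (fun _ => rfl)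
  refine ⟨⟨fun i x => KSpace.out (X := PathCone hfin K.toPtTot i) (l.app i x),
    fun i => KSpace.continuous_out.comp (l.app i).hom.continuous, fun i x => ?_, fun {i j} m x => ?_,
    fun i => hl i.idx⟩⟩
  · exact ConcreteCategory.congr_hom (NatTrans.congr_app hlp i) x
  · exact (nat_apply l m x).symm

-- In degree `n`, the map `x ↦ (1 - height x, x)` to the cone on `K_i` sends latched points to the
-- cone point, and is therefore natural when all other degrees are sent to cone points. Its lift to
-- cones on formal images remembers, for the image of a non-latched point, both the point and the
-- morphism.
open Classical in
theorem PtGDiagram.IsCofibrant.exists_separation (hK : K.IsCofibrant) (hKC : K.IsCGHaus)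
    (s : LatchSection hfin K.toPtTot) (n : ℕ) :
    ∃ l : ∀ i : Tot a, K.toPtTot.functor.obj i → Cone (FreePush hfin K.toPtTot n i),
      (∀ {i j : Tot a} (m : i ⟶ j) x, l j (K.toPtTot.functor.map m x) =
        (l i x).map (FreePush.map m)) ∧
      (∀ (i : Tot a) (h : deg hfin i.idx = n) x, ¬ IsLatched hfin K.toPtTot x →
        ∃ t ≠ 0, l i x = Cone.mk t (FreePush.mk h (𝟙 i.idx) x)) ∧
      ∀ i : Tot a, l i (K.toPtTot.pt i) = Cone.base := by
  have : ∀ i, T2Space (K.toPtTot.functor.obj i) := fun i => (hKC i.idx).2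
  let f : ∀ i : Tot a, K.toPtTot.functor.obj i → Cone (DegPart hfin K.toPtTot n i) := fun i x =>
    if h : deg hfin i.idx = n then Cone.mk (σ (s.ht x)) ⟨x, h⟩ else Cone.base
  have hf1 : ∀ (i : Tot a) (h : deg hfin i.idx = n) x, f i x = Cone.mk (σ (s.ht x)) ⟨x, h⟩ :=
    fun i h x => dif_pos h
  have hfc : ∀ i, Continuous (f i) := fun i => by
    by_cases h : deg hfin i.idx = n
    · rw [funext (hf1 i h)]
      exact Cone.continuous_mk (continuous_symm.comp s.continuous_ht)
        (continuous_id.subtype_mk _)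
    · rw [funext fun x => degCone_eq_base h (f i x)]
      exact continuous_const
  have hfn : ∀ {i j : Tot a} (m : i ⟶ j) x,
      f j (K.toPtTot.functor.map m x) = DegPart.coneMap m (f i x) := fun {i j} m x => by
    by_cases hj : deg hfin j.idx = n
    · by_cases hi : deg hfin i.idx = n
      · rw [hf1 j hj, hf1 i hi, DegPart.coneMap_of_eq m (hi.trans hj.symm), Cone.map_mk,
          s.ht_map_of_eq m (hi.trans hj.symm)]
        rfl
      · rw [hf1 j hj, degCone_eq_base hi (f i x), DegPart.coneMap_base, s.ht_map_of_lt m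
          (lt_of_le_of_ne (deg_le_of_tot hfin m) (fun e => hi (e.trans hj))), symm_one,
          Cone.mk_zero]
    · rw [degCone_eq_base hj (f j _), degCone_eq_base hj (DegPart.coneMap _ _)]
  have hfp : ∀ i, f i (K.toPtTot.pt i) = Cone.base := fun i => by
    by_cases h : deg hfin i.idx = n
    · rw [hf1 i h, s.ht_pt, symm_one, Cone.mk_zero]
    · exact degCone_eq_base h _
  have : ∀ i, CompactlyGeneratedSpace (K.toPtTot.functor.obj i) := fun i => (hKC i.idx).1
  obtain ⟨l, hl, hlp⟩ := hK.exists_lift (E := freeCone hfin K.toPtTot n)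
    (B := degCone hfin K.toPtTot n)
    (fun i => ⟨inferInstanceAs (CompactlyGeneratedSpace (KSpace (Cone (FreePush hfin K.toPtTot n i)))),
      inferInstanceAs (T2Space (KSpace (Cone (FreePush hfin K.toPtTot n i))))⟩)
    (fun i => ⟨inferInstanceAs (CompactlyGeneratedSpace (KSpace (Cone (DegPart hfin K.toPtTot n i)))),
      inferInstanceAs (T2Space (KSpace (Cone (DegPart hfin K.toPtTot n i))))⟩)
    (freeConeEval_isAcyclicFibration hfin K.toPtTot n)
    { app := fun i => TopCat.ofHom ⟨fun x => KSpace.mk (f i x),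
        KSpace.continuous_mk (T := K.toPtTot.functor.obj i) (hfc i)⟩
      naturality := fun i j m => by
        ext x
        exact hfn m x }
    (fun i => hfp (tot i))
  have hlp' : ∀ (i : Tot a) (x : K.toPtTot.functor.obj i), FreePush.coneEval
      (KSpace.out (X := Cone (FreePush hfin K.toPtTot n i)) (l.app i x)) = f i x := fun i x =>
    ConcreteCategory.congr_hom (NatTrans.congr_app hlp i) x
  refine ⟨fun i x => KSpace.out (X := Cone (FreePush hfin K.toPtTot n i)) (l.app i x),
    fun m x => nat_apply l m x, fun i h x hx => ⟨σ (s.ht x), ?_, ?_⟩, fun i => hl i.idx⟩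
  · rw [s.isLatched_iff] at hx
    exact fun e => hx (symm_eq_zero.1 e)
  · dsimp only
    refine (FreePush.coneSection_coneEval h _).symm.trans ?_
    refine (congrArg FreePush.coneSection ((hlp' i x).trans (hf1 i h x))).trans ?_
    exact Cone.map_mk _ _ _

/-- The separating map has positive height on the image of a non-latched point and height `0` at the
base point. -/
theorem PtGDiagram.IsCofibrant.map_ne_pt (hK : K.IsCofibrant) (hKC : K.IsCGHaus)
    (s : LatchSection hfin K.toPtTot)
    {i j : Tot a} (m : j ⟶ i) {x : K.toPtTot.functor.obj j} (hx : ¬ IsLatched hfin K.toPtTot x) :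
    K.toPtTot.functor.map m x ≠ K.toPtTot.pt i := by
  obtain ⟨l, hl, hl', hlp⟩ := hK.exists_separation hKC s (deg hfin j.idx)
  obtain ⟨t, ht, h⟩ := hl' j rfl x hx
  intro e
  have := hlp i
  rw [← e, hl, h, Cone.map_mk] at this
  exact Cone.mk_ne_base ht _ this

/-- First the degrees agree: the separating map for the larger degree vanishes at objects of smaller
degree, hence on their images, but not on the image of a non-latched point of the larger degree.
Then the separating map of the common degree recovers the morphism and the point. -/
theorem PtGDiagram.IsCofibrant.normalForm_unique (hK : K.IsCofibrant) (hKC : K.IsCGHaus)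
    (s : LatchSection hfin K.toPtTot) {i : Tot a} {j j' : Idx a} (α : j ⟶ i.idx) (α' : j' ⟶ i.idx)
    {x : K.toPtTot.functor.obj (tot j)} {x' : K.toPtTot.functor.obj (tot j')}
    (hx : ¬ IsLatched hfin K.toPtTot x) (hx' : ¬ IsLatched hfin K.toPtTot x')
    (h : K.toPtTot.functor.map (totMap α : tot j ⟶ i) x =
      K.toPtTot.functor.map (totMap α' : tot j' ⟶ i) x') :
    ∃ e : j = j', α = eqToHom e ≫ α' ∧ K.toPtTot.functor.map (totMap (eqToHom e)) x = x' := by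
  have key : ∀ {j j' : Idx a} (α : j ⟶ i.idx) (α' : j' ⟶ i.idx)
      {x : K.toPtTot.functor.obj (tot j)} {x' : K.toPtTot.functor.obj (tot j')},
      ¬ IsLatched hfin K.toPtTot x → K.toPtTot.functor.map (totMap α : tot j ⟶ i) x =
      K.toPtTot.functor.map (totMap α' : tot j' ⟶ i) x' → deg hfin j ≤ deg hfin j' := by
    intro j j' α α' x x' hx h
    by_contra hlt
    obtain ⟨l, hl, hl', hlp⟩ := hK.exists_separation hKC s (deg hfin j)
    obtain ⟨t, ht, h1⟩ := hl' (tot j) rfl x hx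
    have h2 := hl (totMap α : tot j ⟶ i) x
    rw [h, hl, freeCone_eq_base (i := tot j') (not_le.1 hlt) (l _ x'), h1, Cone.map_mk,
      Cone.map_base] at h2
    exact Cone.mk_ne_base ht _ h2.symm
  have hd := le_antisymm (key α α' hx h) (key α' α hx' h.symm)
  obtain ⟨l, hl, hl', -⟩ := hK.exists_separation hKC s (deg hfin j)
  obtain ⟨t, ht, h1⟩ := hl' (tot j) rfl x hx
  obtain ⟨t', ht', h1'⟩ := hl' (tot j') hd.symm x' hx'
  have h2 := hl (totMap α : tot j ⟶ i) x
  rw [h, hl, h1, h1', Cone.map_mk, Cone.map_mk] at h2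
  have h3 := (Cone.mk_inj ht' h2).2
  rw [FreePush.map_mk_id, FreePush.map_mk_id] at h3
  exact FreePush.of_mk_eq h3.symm

end Cofibrant

/-! ## Extending equivariant maps over equivariant CW complexes -/

section GCW

theorem continuousOn_biUnion_finset {X Y ι : Type*} [TopologicalSpace X] [TopologicalSpace Y]
    {f : X → Y} (s : Finset ι) (A : ι → Set X) (hA : ∀ i ∈ s, IsClosed (A i))
    (hf : ∀ i ∈ s, ContinuousOn f (A i)) : ContinuousOn f (⋃ i ∈ s, A i) := by
  classical
  induction s using Finset.induction_on with
  | empty => simp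
  | insert i s hi ih =>
    rw [Finset.set_biUnion_insert]
    exact (hf i (Finset.mem_insert_self i s)).union_of_isClosed
      (ih (fun j hj => hA j (Finset.mem_insert_of_mem hj))
        fun j hj => hf j (Finset.mem_insert_of_mem hj))
      (hA i (Finset.mem_insert_self i s))
      (isClosed_biUnion_finset fun j hj => hA j (Finset.mem_insert_of_mem hj))

namespace GCWComplex

variable {Γ : Type u} [Group Γ] {K : Type u} [TopologicalSpace K] [MulAction Γ K]
  (c : GCWComplex Γ K)

/-- The characteristic maps. -/
def chr {n : ℕ} (e : c.cw.cell n) (x : Ball n) : K := c.cw.map n e x.1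

/-- The action on the cells. -/
def smulCell {n : ℕ} (γ : Γ) (e : c.cw.cell n) : c.cw.cell n := (c.cellAction n).smul γ e

theorem continuous_chr {n : ℕ} (e : c.cw.cell n) : Continuous (c.chr e) :=
  continuousOn_iff_continuous_domRestrict.1 (c.cw.continuousOn n e)

theorem chr_smul {n : ℕ} (γ : Γ) (e : c.cw.cell n) (x : Ball n) :
    c.chr (c.smulCell γ e) x = γ • c.chr e x := c.map_smul n γ e x.1 x.2

theorem exists_chr (y : K) : ∃ (n : ℕ) (e : c.cw.cell n) (x : Ball n), ‖x.1‖ < 1 ∧ c.chr e x = y := by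
  let _ := c.cw
  have h := (Topology.CWComplex.iUnion_openCell_eq_complex (C := (univ : Set K))).ge (mem_univ y)
  obtain ⟨n, h⟩ := mem_iUnion.1 h
  obtain ⟨e, x, hx, rfl⟩ := mem_iUnion.1 h
  exact ⟨n, e, ⟨x, Metric.ball_subset_closedBall hx⟩, by simpa using hx, rfl⟩

theorem chr_unique {n : ℕ} {e e' : c.cw.cell n} {x x' : Ball n} (hx : ‖x.1‖ < 1) (hx' : ‖x'.1‖ < 1)
    (h : c.chr e x = c.chr e' x') : e = e' ∧ x = x' := by
  have hb : x.1 ∈ Metric.ball (0 : Fin n → ℝ) 1 := by simpa using hx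
  have hb' : x'.1 ∈ Metric.ball (0 : Fin n → ℝ) 1 := by simpa using hx'
  have he : e = e' := by
    by_contra hne
    have := c.cw.pairwiseDisjoint' (mem_univ ⟨n, e⟩) (mem_univ ⟨n, e'⟩) (fun h => hne (by
      simpa using h))
    exact Set.disjoint_left.1 this ⟨x.1, hb, rfl⟩ ⟨x'.1, hb', h.symm⟩
  subst he
  refine ⟨rfl, Subtype.ext ((c.cw.map n e).injOn ?_ ?_ h)⟩
  · rwa [c.cw.source_eq]
  · rwa [c.cw.source_eq]

theorem chr_ne [T2Space K] {n m : ℕ} (hm : m < n) (e : c.cw.cell n) (j : c.cw.cell m) {x : Ball n}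
    (hx : ‖x.1‖ < 1) (y : Ball m) : c.chr e x ≠ c.chr j y := by
  let _ := c.cw
  intro h
  have h1 : c.chr j y ∈ (Topology.CWComplex.skeletonLT (univ : Set K) (m + 1 : ℕ) : Set K) :=
    Topology.CWComplex.closedCell_subset_skeletonLT (C := (univ : Set K)) m j ⟨y.1, y.2, rfl⟩
  have h2 : c.chr e x ∈ Topology.CWComplex.openCell (C := (univ : Set K)) n e :=
    ⟨x.1, by simpa using hx, rfl⟩
  have hd := Topology.CWComplex.disjoint_skeletonLT_openCell (C := (univ : Set K)) (n := ((m + 1 : ℕ) : ℕ∞))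
    (j := e) (by exact_mod_cast hm)
  exact Set.disjoint_left.1 hd h1 (h ▸ h2)

theorem exists_frontier {n : ℕ} (e : c.cw.cell n) : ∃ s : Finset (Σ m, c.cw.cell m),
    (∀ j ∈ s, j.1 < n) ∧ ∀ x ∈ Ball.bd n, ∃ j ∈ s, ∃ y : Ball j.1, c.chr e x = c.chr j.2 y := by
  obtain ⟨J, hJ⟩ := c.cw.mapsTo' n e
  refine ⟨(Finset.range n).sigma J, fun j hj => by simpa using (Finset.mem_sigma.1 hj).1,
    fun x hx => ?_⟩
  have := hJ (show x.1 ∈ Metric.sphere 0 1 by simpa [Ball.bd] using hx)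
  simp only [mem_iUnion] at this
  obtain ⟨m, hm, j, hj, y, hy, h⟩ := this
  exact ⟨⟨m, j⟩, Finset.mem_sigma.2 ⟨Finset.mem_range.2 hm, hj⟩, ⟨y, hy⟩, h.symm⟩

/-- A set is closed if it meets every closed cell in a closed set, and each closed cell is the
compact image of a ball. -/
theorem continuous_of_chr [T2Space K] {Z : Type*} [TopologicalSpace Z] {g : K → Z}
    (hg : ∀ (n : ℕ) (e : c.cw.cell n), Continuous fun x => g (c.chr e x)) : Continuous g := by
  rw [continuous_iff_isClosed]
  intro A hA
  refine c.cw.closed' _ (subset_univ _) fun n e => ?_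
  have : g ⁻¹' A ∩ c.cw.map n e '' Metric.closedBall 0 1 =
      c.chr e '' ((fun x => g (c.chr e x)) ⁻¹' A) := by
    ext y
    constructor
    · rintro ⟨hy, x, hx, rfl⟩
      exact ⟨⟨x, hx⟩, hy, rfl⟩
    · rintro ⟨x, hx, rfl⟩
      exact ⟨hx, x.1, x.2, rfl⟩
  rw [this]
  exact ((hA.preimage (hg n e)).isCompact.image (c.continuous_chr e)).isClosed

variable {P : Type} [TopologicalSpace P] [CompactSpace P] [T2Space P] {Y : Type u}
  [TopologicalSpace Y]

/-- `P × Ball n → P × (closed cell)` is a closed surjection by compactness, hence a quotient map. -/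
theorem continuousOn_cell [T2Space K] {f : P → K → Y} {n : ℕ} (e : c.cw.cell n)
    (hf : Continuous fun z : P × Ball n => f z.1 (c.chr e z.2)) :
    ContinuousOn (fun z : P × K => f z.1 z.2) (univ ×ˢ range (c.chr e)) := by
  let q : P × Ball n → (univ ×ˢ range (c.chr e) : Set (P × K)) := fun z =>
    ⟨(z.1, c.chr e z.2), trivial, z.2, rfl⟩
  have hq : Continuous q := (continuous_fst.prodMk
    ((c.continuous_chr e).comp continuous_snd)).subtype_mk _
  have hs : Function.Surjective q := by
    rintro ⟨⟨v, y⟩, -, x, hx⟩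
    exact ⟨(v, x), Subtype.ext (Prod.ext rfl hx)⟩
  rw [continuousOn_iff_continuous_domRestrict]
  exact (hq.isClosedMap.isQuotientMap hq hs).continuous_iff.2 hf

/-- The boundary of a cell meets only finitely many closed cells of smaller dimension, so continuity
can be glued over a finite closed cover. -/
theorem continuousOn_frontier [T2Space K] {f : P → K → Y} {n : ℕ} (e : c.cw.cell n)
    (hf : ∀ m < n, ∀ j : c.cw.cell m, Continuous fun z : P × Ball m => f z.1 (c.chr j z.2)) :
    ContinuousOn (fun z : P × Ball n => f z.1 (c.chr e z.2)) (univ ×ˢ Ball.bd n) := by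
  obtain ⟨s, hs, hse⟩ := c.exists_frontier e
  have h := continuousOn_biUnion_finset (f := fun z : P × K => f z.1 z.2) s
    (fun j => univ ×ˢ range (c.chr j.2))
    (fun j _ => isClosed_univ.prod (isCompact_range (c.continuous_chr j.2)).isClosed)
    fun j hj => c.continuousOn_cell j.2 (hf j.1 (hs j hj) j.2)
  refine h.comp (continuous_fst.prodMk
    ((c.continuous_chr e).comp continuous_snd)).continuousOn ?_
  rintro ⟨v, x⟩ ⟨-, hx⟩
  obtain ⟨j, hj, y, hy⟩ := hse x hx
  exact mem_iUnion₂.2 ⟨j, hj, trivial, y, hy.symm⟩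

/-- The thresholds of the induction over the skeleta. -/
def threshold (n : ℕ) : ℝ := n / (n + 1)

theorem threshold_lt_one (n : ℕ) : threshold n < 1 := by
  rw [threshold, div_lt_one (by positivity)]
  linarith

theorem threshold_nonneg (n : ℕ) : 0 ≤ threshold n := by
  unfold threshold
  positivity

theorem threshold_lt_succ (n : ℕ) : threshold n < threshold (n + 1) := by
  rw [threshold, threshold, div_lt_div_iff₀ (by positivity) (by positivity)]
  push_cast
  nlinarith

variable [MulAction Γ Y] (bP : Set P) (τ : K → I) (F : P → K → Y)

/-- A map is given near the points of height `1`, and on a part of the boundary. -/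
structure IsPartialMap : Prop where
  isClosed : IsClosed bP
  continuous_height : Continuous τ
  height_smul (γ : Γ) (x : K) : τ (γ • x) = τ x
  continuousOn_bd : ContinuousOn (fun z : P × K => F z.1 z.2) (bP ×ˢ univ)
  continuousOn_height : ContinuousOn (fun z : P × K => F z.1 z.2) (univ ×ˢ {x | 0 < τ x})
  map_smul (γ : Γ) (v : P) (x : K) (h : v ∈ bP ∨ 0 < τ x) : F v (γ • x) = γ • F v x

/-- An extension over the cells of dimension less than `n`. -/
structure IsSkeletalExtension (n : ℕ) (E : P → K → Y) : Prop where
  continuous (m : ℕ) (hm : m < n) (e : c.cw.cell m) :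
    Continuous fun z : P × Ball m => E z.1 (c.chr e z.2)
  eq_bd (v : P) (hv : v ∈ bP) (x : K) : E v x = F v x
  eq_height (v : P) (x : K) (hx : threshold n < τ x) : E v x = F v x
  map_smul (m : ℕ) (hm : m < n) (e : c.cw.cell m) (x : Ball m) (γ : Γ) (v : P) :
    E v (γ • c.chr e x) = γ • E v (c.chr e x)

/-- An extension over an `n`-cell. -/
structure IsCellExtension {n : ℕ} (E : P → K → Y) (e : c.cw.cell n) (f : P × Ball n → Y) : Prop where
  continuous : Continuous f
  smul_eq (γ : Γ) (hγ : c.smulCell γ e = e) (z : P × Ball n) : γ • f z = f z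
  eq_bd (v : P) (hv : v ∈ bP) (x : Ball n) : f (v, x) = F v (c.chr e x)
  eq_frontier (v : P) (x : Ball n) (hx : x ∈ Ball.bd n) : f (v, x) = E v (c.chr e x)
  eq_height (v : P) (x : Ball n) (hx : threshold (n + 1) < τ (c.chr e x)) :
    f (v, x) = F v (c.chr e x)

variable {bP τ F}

-- The cell is fixed pointwise by its stabilizer, so the problem takes place in the fixed points of
-- the stabilizer. Prescribed are the boundary of `P`, the boundary of the cell, and the open set of
-- height above `threshold n`; `exists_relative_extension` keeps the values where the height exceeds
-- `threshold (n + 1)`.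
open Classical in
theorem exists_isCellExtension [T2Space K] (hF : IsPartialMap (Γ := Γ) bP τ F) {n : ℕ}
    {E : P → K → Y} (hE : c.IsSkeletalExtension bP τ F n E) (e : c.cw.cell n) {y₀ : Y}
    (hy₀ : ∀ γ : Γ, γ • y₀ = y₀)
    (h : (∀ x : Ball n, τ (c.chr e x) = 1) ∨ ∀ j ≤ n, PairExt (P × (Fin j → I))
      (bdProd bP (Cube.boundary (Fin j))) {y : Y | ∀ γ : Γ, c.smulCell γ e = e → γ • y = y}) :
    ∃ f, c.IsCellExtension bP τ F E e f := by
  have hsm : ∀ γ : Γ, c.smulCell γ e = e → ∀ x : Ball n, γ • c.chr e x = c.chr e x := by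
    intro γ hγ x
    rw [← c.chr_smul, hγ]
  have hFfix : ∀ γ : Γ, c.smulCell γ e = e → ∀ v (x : Ball n), (v ∈ bP ∨ 0 < τ (c.chr e x)) →
      γ • F v (c.chr e x) = F v (c.chr e x) := by
    intro γ hγ v x hv
    rw [← hF.map_smul γ v _ hv, hsm γ hγ]
  rcases h with h | h
  -- The whole cell has height `1`, where `F` is already defined and continuous; nothing may or need
  -- be chosen.
  · refine ⟨fun z => F z.1 (c.chr e z.2), ?_, fun γ hγ z => hFfix γ hγ _ _ (Or.inr ?_),
      fun v hv x => rfl, fun v x hx => ?_, fun v x hx => rfl⟩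
    · have := hF.continuousOn_height.comp_continuous (f := fun z : P × Ball n => (z.1, c.chr e z.2))
        (continuous_fst.prodMk ((c.continuous_chr e).comp continuous_snd))
        fun z => ⟨trivial, by simp [h]⟩
      exact this
    · rw [h]
      exact one_pos
    · rw [hE.eq_height]
      rw [h]
      exact threshold_lt_one n
  · let X : Set Y := {y : Y | ∀ γ : Γ, c.smulCell γ e = e → γ • y = y}
    let k : P × (Fin n → I) → P × K := fun z => (z.1, c.chr e ((ballCube n).symm z.2))
    have hk : Continuous k := continuous_fst.prodMk ((c.continuous_chr e).comp
      ((ballCube n).symm.continuous.comp continuous_snd))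
    let W : Set (Fin n → I) := {x | threshold n < τ (c.chr e ((ballCube n).symm x))}
    let N : Set (Fin n → I) := {x | threshold (n + 1) ≤ τ (c.chr e ((ballCube n).symm x))}
    have hτ : Continuous fun x : Fin n → I => (τ (c.chr e ((ballCube n).symm x)) : ℝ) :=
      continuous_subtype_val.comp (hF.continuous_height.comp ((c.continuous_chr e).comp
        (ballCube n).symm.continuous))
    have hW : IsOpen W := isOpen_lt continuous_const hτ
    have hN : IsClosed N := isClosed_le continuous_const hτ
    have hNW : N ⊆ W := fun x hx => (threshold_lt_succ n).trans_le hx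
    have hbdiff : ∀ x : Fin n → I, x ∈ Cube.boundary (Fin n) ↔ (ballCube n).symm x ∈ Ball.bd n := by
      intro x
      rw [← ballCube_mem_boundary, Homeomorph.apply_symm_apply]
    have hE1 : ContinuousOn (fun z => E (k z).1 (k z).2) (bdProd bP (Cube.boundary (Fin n))) := by
      have h1 : ContinuousOn (fun z => E (k z).1 (k z).2) (bP ×ˢ univ) := by
        refine (hF.continuousOn_bd.comp hk.continuousOn fun z hz => ⟨hz.1, trivial⟩).congr
          fun z hz => hE.eq_bd _ hz.1 _
      have h2 : ContinuousOn (fun z => E (k z).1 (k z).2) (univ ×ˢ Cube.boundary (Fin n)) := by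
        refine (c.continuousOn_frontier e hE.continuous).comp (f := fun z : P × (Fin n → I) =>
          (z.1, (ballCube n).symm z.2)) (continuous_fst.prodMk
            ((ballCube n).symm.continuous.comp continuous_snd)).continuousOn fun z hz =>
            ⟨trivial, (hbdiff _).1 hz.2⟩
      have h3 : bdProd bP (Cube.boundary (Fin n)) = bP ×ˢ univ ∪ univ ×ˢ Cube.boundary (Fin n) := by
        ext z
        simp [bdProd]
      rw [h3]
      exact h1.union_of_isClosed h2 (hF.isClosed.prod isClosed_univ)
        (isClosed_univ.prod (isClosed_cubeBoundary n))
    have hE2 : ContinuousOn (fun z => E (k z).1 (k z).2) (univ ×ˢ W) := by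
      refine (hF.continuousOn_height.comp hk.continuousOn fun z hz => ⟨trivial, ?_⟩).congr
        fun z hz => hE.eq_height _ _ hz.2
      exact (threshold_nonneg n).trans_lt hz.2
    have hX1 : ∀ z ∈ bdProd bP (Cube.boundary (Fin n)), E (k z).1 (k z).2 ∈ X := by
      rintro z (hz | hz) γ hγ
      · rw [hE.eq_bd _ hz]
        exact hFfix γ hγ _ _ (Or.inl hz)
      · obtain ⟨s, hs, hse⟩ := c.exists_frontier e
        obtain ⟨j, hj, y, hy⟩ := hse _ ((hbdiff _).1 hz)
        change γ • E z.1 (c.chr e _) = E z.1 (c.chr e _)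
        conv_rhs => rw [← hsm γ hγ]
        rw [hy, hE.map_smul j.1 (hs j hj)]
    have hX2 : ∀ z ∈ (univ ×ˢ W : Set (P × (Fin n → I))), E (k z).1 (k z).2 ∈ X := by
      rintro z ⟨-, hz⟩ γ hγ
      rw [hE.eq_height _ _ hz]
      exact hFfix γ hγ _ _ (Or.inr ((threshold_nonneg n).trans_lt hz))
    -- The value `y₀` only fills in points where nothing is prescribed.
    let f : P × (Fin n → I) → X := fun z =>
      if hz : E (k z).1 (k z).2 ∈ X then ⟨_, hz⟩ else ⟨y₀, fun γ _ => hy₀ γ⟩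
    have hf : ∀ z, E (k z).1 (k z).2 ∈ X → (f z).1 = E (k z).1 (k z).2 := fun z hz => by
      simp only [f, dif_pos hz]
    have hfc : ∀ S : Set (P × (Fin n → I)), ContinuousOn (fun z => E (k z).1 (k z).2) S →
        (∀ z ∈ S, E (k z).1 (k z).2 ∈ X) → ContinuousOn f S := fun S h1 h2 =>
      Topology.IsInducing.subtypeVal.continuousOn_iff.2 (h1.congr fun z hz => hf z (h2 z hz))
    obtain ⟨f', hf', hf1, hf2⟩ := exists_relative_extension (Y := X) n hF.isClosed h hW hN hNW f
      (hfc _ hE1 hX1) (hfc _ hE2 hX2)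
    have hkb : ∀ (v : P) (x : Ball n), k (v, ballCube n x) = (v, c.chr e x) := fun v x => by
      simp only [k, Homeomorph.symm_apply_apply]
    refine ⟨fun z => (f' (z.1, ballCube n z.2)).1, ?_, fun γ hγ z => (f' _).2 γ hγ, ?_, ?_, ?_⟩
    · exact continuous_subtype_val.comp (hf'.comp (continuous_fst.prodMk
        ((ballCube n).continuous.comp continuous_snd)))
    · intro v hv x
      have hz : (v, ballCube n x) ∈ bdProd bP (Cube.boundary (Fin n)) := Or.inl hv
      dsimp only
      rw [hf1 hz, hf _ (hX1 _ hz), hkb, hE.eq_bd v hv]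
    · intro v x hx
      have hz : (v, ballCube n x) ∈ bdProd bP (Cube.boundary (Fin n)) :=
        Or.inr ((ballCube_mem_boundary x).2 hx)
      dsimp only
      rw [hf1 hz, hf _ (hX1 _ hz), hkb]
    · intro v x hx
      have hxN : ballCube n x ∈ N := by
        change threshold (n + 1) ≤ _
        rw [Homeomorph.symm_apply_apply]
        exact hx.le
      have hz : (v, ballCube n x) ∈ (univ ×ˢ N : Set (P × (Fin n → I))) := ⟨trivial, hxN⟩
      dsimp only
      rw [hf2 hz, hf _ (hX2 _ ⟨trivial, hNW hxN⟩), hkb,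
        hE.eq_height v _ ((threshold_lt_succ n).trans hx)]

-- The extension is chosen on one cell of each orbit and translated to the others.
open Classical in
theorem exists_isSkeletalExtension_succ [T2Space K] (hY : ∀ γ : Γ, Continuous fun y : Y => γ • y)
    (hF : IsPartialMap (Γ := Γ) bP τ F) {n : ℕ}
    {E : P → K → Y} (hE : c.IsSkeletalExtension bP τ F n E) {y₀ : Y}
    (hy₀ : ∀ γ : Γ, γ • y₀ = y₀)
    (h : ∀ e : c.cw.cell n, (∀ x : Ball n, τ (c.chr e x) = 1) ∨ ∀ j ≤ n, PairExt (P × (Fin j → I))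
      (bdProd bP (Cube.boundary (Fin j))) {y : Y | ∀ γ : Γ, c.smulCell γ e = e → γ • y = y}) :
    ∃ E', c.IsSkeletalExtension bP τ F (n + 1) E' ∧
      ∀ m < n, ∀ (e : c.cw.cell m) (x : Ball m) (v : P), E' v (c.chr e x) = E v (c.chr e x) := by
  let _ := c.cellAction n
  have hsm : ∀ (γ : Γ) (e : c.cw.cell n), c.smulCell γ e = γ • e := fun _ _ => rfl
  choose f₀ hf₀ using fun e => c.exists_isCellExtension hF hE e hy₀ (h e)
  let rep : c.cw.cell n → c.cw.cell n := fun e =>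
    (Quotient.mk (MulAction.orbitRel Γ (c.cw.cell n)) e).out
  have hrep : ∀ e, ∃ γ : Γ, γ • rep e = e := fun e =>
    (MulAction.orbitRel Γ (c.cw.cell n)).symm (Quotient.mk_out e)
  have hrepγ : ∀ (γ : Γ) e, rep (γ • e) = rep e := fun γ e =>
    congrArg Quotient.out (Quotient.sound (s := MulAction.orbitRel Γ (c.cw.cell n)) ⟨γ, rfl⟩)
  choose g hg using hrep
  let f : c.cw.cell n → P × Ball n → Y := fun e z => g e • f₀ (rep e) z
  have hfγ : ∀ (γ : Γ) e z, f (γ • e) z = γ • f e z := by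
    intro γ e z
    -- The two ways of translating from the representative differ by an element of its stabilizer,
    -- and the chosen extension has values fixed by that stabilizer.
    have h1 : (g (γ • e))⁻¹ • γ • g e • rep e = rep e := by
      rw [hg, inv_smul_eq_iff, ← hrepγ γ e, hg]
    have h2 := (hf₀ (rep e)).smul_eq ((g (γ • e))⁻¹ * γ * g e)
      (by rw [hsm, mul_smul, mul_smul, h1]) z
    change g (γ • e) • f₀ (rep (γ • e)) z = γ • g e • f₀ (rep e) z
    have h3 : γ • g e • f₀ (rep e) z =
        g (γ • e) • ((g (γ • e))⁻¹ * γ * g e) • f₀ (rep e) z := by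
      rw [mul_smul, mul_smul, smul_inv_smul]
    rw [hrepγ, h3, h2]
  have hchr : ∀ e x, c.chr e x = g e • c.chr (rep e) x := fun e x => by
    rw [← c.chr_smul, hsm, hg]
  have hf : ∀ e, c.IsCellExtension bP τ F E e (f e) := by
    intro e
    refine ⟨(hY _).comp (hf₀ _).continuous, fun γ hγ z => ?_, fun v hv x => ?_, fun v x hx => ?_,
      fun v x hx => ?_⟩
    · rw [← hfγ, ← hsm, hγ]
    · rw [hchr, hF.map_smul _ _ _ (Or.inl hv), ← (hf₀ (rep e)).eq_bd v hv]
    · obtain ⟨s, hs, hse⟩ := c.exists_frontier (rep e)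
      obtain ⟨j, hj, y, hy⟩ := hse x hx
      rw [hchr, hy, hE.map_smul j.1 (hs j hj), ← hy, ← (hf₀ (rep e)).eq_frontier v x hx]
    · have hx' : threshold (n + 1) < τ (c.chr (rep e) x) := by
        rwa [hchr, hF.height_smul] at hx
      rw [hchr, hF.map_smul _ _ _ (Or.inr ((threshold_nonneg _).trans_lt hx')),
        ← (hf₀ (rep e)).eq_height v x hx']
  -- Only the open `n`-cells receive new values; these cells are disjoint from each other and from
  -- the closed cells of smaller dimension.
  let E' : P → K → Y := fun v y =>
    if hy : ∃ z : c.cw.cell n × Ball n, ‖z.2.1‖ < 1 ∧ c.chr z.1 z.2 = y then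
      f hy.choose.1 (v, hy.choose.2) else E v y
  have hlow : ∀ m < n, ∀ (e : c.cw.cell m) (x : Ball m) (v : P),
      E' v (c.chr e x) = E v (c.chr e x) := by
    intro m hm e x v
    simp only [E']
    rw [dif_neg]
    rintro ⟨z, hz, hzx⟩
    exact c.chr_ne hm z.1 e hz x hzx
  have htop : ∀ (e : c.cw.cell n) (x : Ball n) (v : P), E' v (c.chr e x) = f e (v, x) := by
    intro e x v
    by_cases hx : ‖x.1‖ < 1
    · have hy : ∃ z : c.cw.cell n × Ball n, ‖z.2.1‖ < 1 ∧ c.chr z.1 z.2 = c.chr e x :=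
        ⟨(e, x), hx, rfl⟩
      simp only [E']
      rw [dif_pos hy]
      obtain ⟨h1, h2⟩ := c.chr_unique hy.choose_spec.1 hx hy.choose_spec.2
      rw [h1, h2]
    · have hx : x ∈ Ball.bd n := le_antisymm x.norm_le (not_lt.1 hx)
      obtain ⟨s, hs, hse⟩ := c.exists_frontier e
      obtain ⟨j, hj, y, hy⟩ := hse x hx
      rw [(hf e).eq_frontier v x hx, hy, hlow j.1 (hs j hj)]
  have heq : ∀ v y, (∃ (e : c.cw.cell n) (x : Ball n), c.chr e x = y) ∨ E' v y = E v y := by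
    intro v y
    by_cases hy : ∃ z : c.cw.cell n × Ball n, ‖z.2.1‖ < 1 ∧ c.chr z.1 z.2 = y
    · obtain ⟨z, -, hz⟩ := hy
      exact Or.inl ⟨z.1, z.2, hz⟩
    · exact Or.inr (dif_neg hy)
  refine ⟨E', ⟨fun m hm e => ?_, fun v hv y => ?_, fun v y hy => ?_, fun m hm e x γ v => ?_⟩, hlow⟩
  · rcases Nat.lt_succ_iff_lt_or_eq.1 hm with hm | rfl
    · simp only [hlow m hm e]
      exact hE.continuous m hm e
    · simp only [htop e]
      exact (hf e).continuous
  · rcases heq v y with ⟨e, x, rfl⟩ | h'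
    · rw [htop, (hf e).eq_bd v hv]
    · rw [h', hE.eq_bd v hv]
  · rcases heq v y with ⟨e, x, rfl⟩ | h'
    · rw [htop, (hf e).eq_height v x hy]
    · rw [h', hE.eq_height v y ((threshold_lt_succ n).trans hy)]
  · rcases Nat.lt_succ_iff_lt_or_eq.1 hm with hm | rfl
    · rw [← c.chr_smul, hlow m hm, hlow m hm, c.chr_smul, hE.map_smul m hm]
    · rw [← c.chr_smul, htop, htop, hsm, hfγ]

/-- The extensions over the skeleta stabilise on each cell. All thresholds are below `1`, so the
values at height `1` are never changed. -/
theorem exists_extension [T2Space K] (hY : ∀ γ : Γ, Continuous fun y : Y => γ • y)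
    (hF : IsPartialMap (Γ := Γ) bP τ F) {y₀ : Y} (hy₀ : ∀ γ : Γ, γ • y₀ = y₀)
    (h : ∀ (n : ℕ) (e : c.cw.cell n), (∀ x : Ball n, τ (c.chr e x) = 1) ∨
      ∀ j ≤ n, PairExt (P × (Fin j → I))
        (bdProd bP (Cube.boundary (Fin j))) {y : Y | ∀ γ : Γ, c.smulCell γ e = e → γ • y = y}) :
    ∃ l : K → C(P, Y), Continuous l ∧ (∀ v ∈ bP, ∀ x, l x v = F v x) ∧
      (∀ v x, τ x = 1 → l x v = F v x) ∧ ∀ (γ : Γ) x v, l (γ • x) v = γ • l x v := by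
  have h0 : c.IsSkeletalExtension bP τ F 0 F :=
    ⟨fun m hm => (Nat.not_lt_zero m hm).elim, fun _ _ _ => rfl, fun _ _ _ => rfl,
      fun m hm => (Nat.not_lt_zero m hm).elim⟩
  choose step hstep hstep' using fun (n : ℕ) (E : {E // c.IsSkeletalExtension bP τ F n E}) =>
    c.exists_isSkeletalExtension_succ hY hF E.2 hy₀ (h n)
  let S : ∀ n, {E // c.IsSkeletalExtension bP τ F n E} := fun n =>
    Nat.rec ⟨F, h0⟩ (fun n E => ⟨step n E, hstep n E⟩) n
  have hS : ∀ n, ∀ m < n, ∀ (e : c.cw.cell m) (x : Ball m) (v : P),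
      (S (n + 1)).1 v (c.chr e x) = (S n).1 v (c.chr e x) := fun n => hstep' n (S n)
  have hS' : ∀ m n, m < n → ∀ (e : c.cw.cell m) (x : Ball m) (v : P),
      (S n).1 v (c.chr e x) = (S (m + 1)).1 v (c.chr e x) := by
    intro m n hmn e x v
    induction n, hmn using Nat.le_induction with
    | base => rfl
    | succ n hn ih => rw [hS n m hn, ih]
  choose dim cell pos hpos hchr using c.exists_chr
  let E : P → K → Y := fun v y => (S (dim y + 1)).1 v y
  have hE : ∀ (n : ℕ) (e : c.cw.cell n) (x : Ball n) (v : P),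
      E v (c.chr e x) = (S (n + 1)).1 v (c.chr e x) := by
    intro n e x v
    -- An open cell is disjoint from all closed cells of smaller dimension, so the open cell that
    -- contains this point has dimension at most `n`.
    have hd : dim (c.chr e x) ≤ n := by
      by_contra hlt
      exact c.chr_ne (not_le.1 hlt) (cell (c.chr e x)) e (hpos _) x (hchr _)
    have := hS' _ _ (Nat.lt_succ_of_le hd) (cell (c.chr e x)) (pos (c.chr e x)) v
    rw [hchr] at this
    exact this.symm
  have hc : ∀ (n : ℕ) (e : c.cw.cell n), Continuous fun z : P × Ball n => E z.1 (c.chr e z.2) :=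
    fun n e => by
      simp only [hE n e]
      exact (S (n + 1)).2.continuous n (Nat.lt_succ_self n) e
  have hv : ∀ x, Continuous fun v => E v x := fun x => by
    have := (hc (dim x) (cell x)).comp (Continuous.prodMk_left (pos x))
    simpa only [Function.comp_def, hchr] using this
  refine ⟨fun x => ⟨fun v => E v x, hv x⟩, ?_, fun v hv x => ?_, fun v x hx => ?_, fun γ x v => ?_⟩
  · refine c.continuous_of_chr fun n e => ?_
    exact ContinuousMap.continuous_of_continuous_uncurry _ ((hc n e).comp continuous_swap)
  · exact (S (dim x + 1)).2.eq_bd v hv x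
  · exact (S (dim x + 1)).2.eq_height v x (by rw [hx]; exact threshold_lt_one _)
  · change E v (γ • x) = γ • E v x
    rw [← hchr x, ← c.chr_smul, hE, hE, c.chr_smul,
      (S (dim x + 1)).2.map_smul (dim x) (Nat.lt_succ_self _)]

end GCWComplex

end GCW

/-! ## Extension of natural families to the latching subspaces and their neighbourhoods -/

section Family

/-- The radial retraction to the unit ball. -/
def Ball.retract {N : ℕ} (w : Fin N → ℝ) : Ball N :=
  ⟨(max 1 ‖w‖)⁻¹ • w, by
    rw [mem_closedBall_zero_iff, norm_smul, norm_inv, Real.norm_of_nonneg (by positivity),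
      inv_mul_le_one₀ (by positivity)]
    exact le_max_right _ _⟩

theorem Ball.continuous_retract {N : ℕ} : Continuous (Ball.retract (N := N)) := by
  refine Continuous.subtype_mk (Continuous.smul (Continuous.inv₀
    (continuous_const.max continuous_norm) fun w => ?_) continuous_id) _
  positivity

theorem Ball.retract_eq {N : ℕ} {w : Fin N → ℝ} (h : ‖w‖ ≤ 1) : (Ball.retract w).1 = w := by
  simp [Ball.retract, max_eq_left h]

open scoped NNReal

variable {G : Type u} [Group G] {a : SingleObj G ⥤ Cat.{u, u}}
  {hfin : ∀ i : Idx a, ∃ d : ℕ, (nerve (Over i)).HasDimensionLT d}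

theorem LatchSection.isLatched_map_iff {K : PtTot a} (s : LatchSection hfin K) {i j : Tot a}
    (m : i ⟶ j) (h : deg hfin i.idx = deg hfin j.idx) (x : K.functor.obj i) :
    IsLatched hfin K (K.functor.map m x) ↔ IsLatched hfin K x := by
  rw [s.isLatched_iff, s.isLatched_iff, s.ht_map_of_eq m h]

theorem totMap_comp_eq {i j : Tot a} {k : Idx a} (α : k ⟶ i.idx) (m : i ⟶ j) :
    (totMap α : tot k ⟶ i) ≫ m =
      totTr m.elt rfl ≫ (totMap (gmap m.elt α ≫ m.hom) : tot (m.elt • k) ⟶ j) := by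
  rw [totTr_totMap]
  exact Tot.Hom.ext' (mul_one m.elt) (by
    change eqToHom (mul_smul m.elt (1 : G) k) ≫ gmap m.elt (eqToHom (one_smul G k) ≫ α) ≫ m.hom =
      eqToHom _ ≫ eqToHom rfl ≫ gmap m.elt α ≫ m.hom
    rw [gmap_comp, gmap_eqToHom]
    simp)

/-- Induction on the degree: a latched point other than the base point comes from a smaller degree,
and the group part of the morphism is moved onto the point, which stays non-latched. -/
theorem LatchSection.exists_normalForm {K : PtTot a} (s : LatchSection hfin K) {i : Tot a}
    (y : K.functor.obj i) : y = K.pt i ∨ ∃ (j : Idx a) (α : j ⟶ i.idx)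
      (x : K.functor.obj (tot j)), ¬ IsLatched hfin K x ∧
        K.functor.map (totMap α : tot j ⟶ i) x = y := by
  induction h : deg hfin i.idx using Nat.strong_induction_on generalizing i with
  | _ n ih =>
    subst h
    by_cases hy : IsLatched hfin K y
    · obtain hy | ⟨j, m, y', hj, rfl⟩ := hy
      · exact Or.inl hy
      · obtain rfl | ⟨k, α, x, hx, rfl⟩ := ih _ hj y' rfl
        · exact Or.inl (K.map_pt m)
        · refine Or.inr ⟨m.elt • k, gmap m.elt α ≫ m.hom, K.functor.map (totTr m.elt rfl) x, ?_, ?_⟩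
          · rwa [s.isLatched_map_iff _ (deg_smul hfin _ _).symm]
          · rw [← map_comp_apply, ← map_comp_apply]
            exact congrArg (fun m => K.functor.map m x) (totMap_comp_eq α m).symm
    · refine Or.inr ⟨i.idx, 𝟙 _, y, hy, ?_⟩
      exact (congrArg (fun m => K.functor.map m y) (totMap_id i.idx)).trans (map_id_apply _ _)

/-! ### Natural families on objects of small degree -/

variable {N : ℕ} {K X : PtTot a}

/-- A family of maps, natural on the objects of degree less than `n`, and given on the boundary. -/
structure IsFamily (hfin : ∀ i : Idx a, ∃ d : ℕ, (nerve (Over i)).HasDimensionLT d)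
    (φ : ∀ i : Tot a, Ball N → K.functor.obj i → X.functor.obj i) (n : ℕ)
    (l : ∀ i : Tot a, K.functor.obj i → C(Ball N, X.functor.obj i)) : Prop where
  continuous (i : Tot a) (hi : deg hfin i.idx < n) : Continuous (l i)
  map {i j : Tot a} (m : i ⟶ j) (hj : deg hfin j.idx < n) (x : K.functor.obj i) (v : Ball N) :
    l j (K.functor.map m x) v = X.functor.map m (l i x v)
  pt (i : Tot a) (hi : deg hfin i.idx < n) (v : Ball N) : l i (K.pt i) v = X.pt i
  bd (i : Tot a) (hi : deg hfin i.idx < n) (x : K.functor.obj i) (v : Ball N) (hv : v ∈ Ball.bd N) :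
    l i x v = φ i v x

/-- A natural family of maps given on the boundary of the ball. -/
structure IsBoundaryFamily (φ : ∀ i : Tot a, Ball N → K.functor.obj i → X.functor.obj i) : Prop where
  continuousOn (i : Tot a) : ContinuousOn (fun z : Ball N × K.functor.obj i => φ i z.1 z.2)
    (Ball.bd N ×ˢ univ)
  map {i j : Tot a} (m : i ⟶ j) (v : Ball N) (hv : v ∈ Ball.bd N) (x : K.functor.obj i) :
    φ j v (K.functor.map m x) = X.functor.map m (φ i v x)
  pt (i : Tot a) (v : Ball N) (hv : v ∈ Ball.bd N) : φ i v (K.pt i) = X.pt i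

/-- An extension of a family to the latching subspaces of the objects of degree `n`. -/
structure IsLatchFamily (φ : ∀ i : Tot a, Ball N → K.functor.obj i → X.functor.obj i) (n : ℕ)
    (l : ∀ i : Tot a, K.functor.obj i → C(Ball N, X.functor.obj i))
    (lA : ∀ i : Tot a, Latch hfin K i → C(Ball N, X.functor.obj i)) : Prop where
  of {j i : Tot a} (hi : deg hfin i.idx = n) (m : j ⟶ i) (h : deg hfin j.idx < deg hfin i.idx)
    (y : K.functor.obj j) : lA i (Latch.of m h y) = (X.functor.map m).hom.comp (l j y)
  pt (i : Tot a) (hi : deg hfin i.idx = n) :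
    lA i ⟨K.pt i, Or.inl rfl⟩ = ContinuousMap.const _ (X.pt i)

/-- The value assigned to `m y` is computed from a normal form of `m y`. Together with uniqueness of
normal forms this makes the extension to the latching subspace independent of `m` and `y`. -/
theorem IsFamily.map_totMap {φ : ∀ i : Tot a, Ball N → K.functor.obj i → X.functor.obj i} {n : ℕ}
    {l : ∀ i : Tot a, K.functor.obj i → C(Ball N, X.functor.obj i)} (hl : IsFamily hfin φ n l)
    (s : LatchSection hfin K) {i j : Tot a} (m : j ⟶ i) (hj : deg hfin j.idx < n)
    (y : K.functor.obj j) :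
    (K.functor.map m y = K.pt i ∧ (X.functor.map m).hom.comp (l j y) = ContinuousMap.const _ (X.pt i)) ∨
    ∃ (k : Idx a) (α : k ⟶ i.idx) (x : K.functor.obj (tot k)), ¬ IsLatched hfin K x ∧
      K.functor.map (totMap α : tot k ⟶ i) x = K.functor.map m y ∧
      (X.functor.map m).hom.comp (l j y) =
        (X.functor.map (totMap α : tot k ⟶ i)).hom.comp (l (tot k) x) := by
  obtain rfl | ⟨k, α, x, hx, rfl⟩ := s.exists_normalForm y
  · refine Or.inl ⟨K.map_pt m, ContinuousMap.ext fun v => ?_⟩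
    exact (congrArg (X.functor.map m) (hl.pt j hj v)).trans (X.map_pt m)
  · refine Or.inr ⟨m.elt • k, gmap m.elt α ≫ m.hom, K.functor.map (totTr m.elt rfl) x, ?_, ?_,
      ContinuousMap.ext fun v => ?_⟩
    · rwa [s.isLatched_map_iff _ (deg_smul hfin _ _).symm]
    · rw [← map_comp_apply, ← map_comp_apply]
      exact congrArg (fun m => K.functor.map m x) (totMap_comp_eq α m).symm
    · have hk : deg hfin k < n := (deg_le hfin α).trans_lt hj
      change X.functor.map m (l j (K.functor.map (totMap α : tot k ⟶ j) x) v) =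
        X.functor.map (totMap (gmap m.elt α ≫ m.hom) : tot (m.elt • k) ⟶ i)
          (l (tot (m.elt • k)) (K.functor.map (totTr m.elt rfl) x) v)
      rw [hl.map _ hj, hl.map _ (by rwa [deg_smul]), ← map_comp_apply, ← map_comp_apply]
      exact congrArg (fun m => X.functor.map m (l (tot k) x v)) (totMap_comp_eq α m)

-- A non-base latched point has a unique normal form, which dictates its value. A representation of
-- the base point can only come from a base point, because images of non-latched points are not base
-- points.
open Classical in
theorem IsFamily.exists_latch {K : PtGDiagram a} (hK : K.IsCofibrant) (hKC : K.IsCGHaus)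
    (s : LatchSection hfin K.toPtTot)
    {φ : ∀ i : Tot a, Ball N → K.toPtTot.functor.obj i → X.functor.obj i} {n : ℕ}
    {l : ∀ i : Tot a, K.toPtTot.functor.obj i → C(Ball N, X.functor.obj i)}
    (hl : IsFamily hfin φ n l) :
    ∃ lA : ∀ i : Tot a, Latch hfin K.toPtTot i → C(Ball N, X.functor.obj i),
      IsLatchFamily φ n l lA := by
  have key : ∀ (i : Tot a) (x : Latch hfin K.toPtTot i), ∃ c : C(Ball N, X.functor.obj i),
      deg hfin i.idx = n → (x.val = K.toPtTot.pt i → c = ContinuousMap.const _ (X.pt i)) ∧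
      ∀ (j : Tot a) (m : j ⟶ i) (y : K.toPtTot.functor.obj j), deg hfin j.idx < deg hfin i.idx →
        K.toPtTot.functor.map m y = x.val → c = (X.functor.map m).hom.comp (l j y) := by
    intro i x
    by_cases hi : deg hfin i.idx = n
    swap
    · exact ⟨ContinuousMap.const _ (X.pt i), fun h => (hi h).elim⟩
    by_cases hx : x.val = K.toPtTot.pt i
    · refine ⟨ContinuousMap.const _ (X.pt i), fun _ => ⟨fun _ => rfl, fun j m y hj hy => ?_⟩⟩
      obtain h | ⟨k, α, z, hz, h1, -⟩ := hl.map_totMap s m (hi ▸ hj) y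
      · exact h.2.symm
      · exact (hK.map_ne_pt hKC s _ hz (h1.trans (hy.trans hx))).elim
    · obtain h | ⟨j, m, y, hj, hy⟩ := x.prop
      · exact (hx h).elim
      refine ⟨(X.functor.map m).hom.comp (l j y), fun _ => ⟨fun h => (hx h).elim,
        fun j' m' y' hj' hy' => ?_⟩⟩
      obtain h | ⟨k, α, z, hz, h1, h2⟩ := hl.map_totMap s m (hi ▸ hj) y
      · exact (hx (hy.symm.trans h.1)).elim
      obtain h | ⟨k', α', z', hz', h1', h2'⟩ := hl.map_totMap s m' (hi ▸ hj') y'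
      · exact (hx (hy'.symm.trans h.1)).elim
      rw [h2, h2']
      obtain ⟨rfl, rfl, h3⟩ := hK.normalForm_unique hKC s α α' hz hz'
        (h1.trans (hy.trans (hy'.symm.trans h1'.symm)))
      have h4 : z = z' := by
        rw [← h3]
        exact ((congrArg (fun m => K.toPtTot.functor.map m z) (totMap_id k)).trans
          (map_id_apply _ _)).symm
      rw [h4, eqToHom_refl, Category.id_comp]
  choose lA hlA using key
  exact ⟨lA, fun hi m h y => (hlA _ _ hi).2 _ m y h rfl, fun i hi => (hlA i _ hi).1 rfl⟩

/-! ### Extension to a neighbourhood of the latching subspace -/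

section

variable {φ : ∀ i : Tot a, Ball N → K.functor.obj i → X.functor.obj i} {n : ℕ}
  {l : ∀ i : Tot a, K.functor.obj i → C(Ball N, X.functor.obj i)}
  {lA : ∀ i : Tot a, Latch hfin K i → C(Ball N, X.functor.obj i)}

theorem IsLatchFamily.continuous (h : IsLatchFamily φ n l lA) (hl : IsFamily hfin φ n l)
    {i : Tot a} (hi : deg hfin i.idx = n) : Continuous (lA i) :=
  Latch.continuous_dom fun j m hj => by
    simp only [h.of hi]
    exact (ContinuousMap.continuous_postcomp _).comp (hl.continuous j (hi ▸ hj))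

theorem IsLatchFamily.bd (h : IsLatchFamily φ n l lA) (hl : IsFamily hfin φ n l)
    (hφ : IsBoundaryFamily φ) {i : Tot a} (hi : deg hfin i.idx = n) (x : Latch hfin K i) {v : Ball N}
    (hv : v ∈ Ball.bd N) : lA i x v = φ i v x.val := by
  obtain ⟨x, rfl | ⟨j, m, y, hj, rfl⟩⟩ := x
  · rw [h.pt i hi, hφ.pt i v hv]
    rfl
  · refine (DFunLike.congr_fun (h.of hi m hj y) v).trans ?_
    refine (congrArg (X.functor.map m) (hl.bd j (hi ▸ hj) y v hv)).trans ?_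
    exact (hφ.map m v hv y).symm

theorem IsLatchFamily.map (h : IsLatchFamily φ n l lA) {i j : Tot a} (hi : deg hfin i.idx = n)
    (m : i ⟶ j) (hm : deg hfin i.idx = deg hfin j.idx) (x : Latch hfin K i) (v : Ball N) :
    lA j (Latch.map m hm x) v = X.functor.map m (lA i x v) := by
  obtain ⟨x, rfl | ⟨k, q, y, hk, rfl⟩⟩ := x
  · have : Latch.map m hm (⟨K.pt i, Or.inl rfl⟩ : Latch hfin K i) = ⟨K.pt j, Or.inl rfl⟩ :=
      Latch.ext (K.map_pt m)
    rw [this, h.pt j (hm ▸ hi), h.pt i hi]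
    exact (X.map_pt m).symm
  · have : Latch.map m hm (Latch.of q hk y) = Latch.of (q ≫ m) (hm ▸ hk) y :=
      Latch.ext (map_comp_apply _ _ _ _).symm
    refine (congrArg (fun c => lA j c v) this).trans ?_
    refine (DFunLike.congr_fun (h.of (hm ▸ hi) (q ≫ m) (hm ▸ hk) y) v).trans ?_
    refine (map_comp_apply X.functor q m _).trans ?_
    exact (congrArg (fun c : C(Ball N, X.functor.obj i) => X.functor.map m (c v))
      (h.of hi q hk y)).symm

/-- The projection to the latching subspace, defined on the points of positive height. -/
def LatchSection.proj (s : LatchSection hfin K) {i : Tot a} (x : K.functor.obj i) :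
    Latch hfin K i :=
  (s.toFun i x).cone.pr.getD ⟨K.pt i, Or.inl rfl⟩

namespace LatchSection

variable (s : LatchSection hfin K)

theorem pr_cone {i : Tot a} {x : K.functor.obj i} (h : 0 < s.ht x) :
    (s.toFun i x).cone.pr = some (s.proj x) := by
  cases e : (s.toFun i x).cone.pr with
  | none => exact (h.ne' ((s.toFun i x).cone.2.1 e)).elim
  | some y => rw [proj, e, Option.getD_some]

/-- The projection is continuous for the final topology, because the cone entering `PathCone` is
built on the latching subspace with that topology. -/
theorem continuousOn_proj {i : Tot a} :
    ContinuousOn (s.proj (i := i)) {x | 0 < s.ht x} := by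
  refine continuousOn_iff'.2 fun V hV => ⟨_, (Cone.isOpen_pr hV).preimage
    (PathCone.continuous_cone.comp (s.continuous_toFun i)), ?_⟩
  ext x
  constructor
  · rintro ⟨h1, h2⟩
    exact ⟨⟨_, h1, s.pr_cone h2⟩, h2⟩
  · rintro ⟨⟨y, hy, h1⟩, h2⟩
    refine ⟨?_, h2⟩
    have h1 : (s.toFun i x).cone.pr = some y := h1
    rw [mem_preimage, proj, h1]
    exact hy

theorem proj_map_of_eq {i j : Tot a} (m : i ⟶ j) (h : deg hfin i.idx = deg hfin j.idx)
    (x : K.functor.obj i) : s.proj (K.functor.map m x) = Latch.map m h (s.proj x) := by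
  rw [proj, ← s.map_toFun, PathCone.cone_map m h, Cone.pr_map, proj]
  cases (s.toFun i x).cone.pr with
  | none => exact Latch.ext (K.map_pt m).symm
  | some y => rfl

theorem proj_map_of_lt {i j : Tot a} (m : i ⟶ j) (h : deg hfin i.idx < deg hfin j.idx)
    (x : K.functor.obj i) : s.proj (K.functor.map m x) = Latch.of m h x := by
  rw [proj, ← s.map_toFun, PathCone.map_of_lt m h, s.path_zero]
  change (Cone.mk 1 (Latch.of m h x)).pr.getD _ = _
  rw [Cone.pr_mk one_ne_zero]
  rfl

theorem proj_pt (i : Tot a) : s.proj (K.pt i) = ⟨K.pt i, Or.inl rfl⟩ := by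
  rw [proj, s.toFun_pt]
  change (Cone.mk 1 _).pr.getD _ = _
  rw [Cone.pr_mk one_ne_zero]
  rfl

theorem path_map_of_eq {i j : Tot a} (m : i ⟶ j) (h : deg hfin i.idx = deg hfin j.idx)
    (x : K.functor.obj i) (r : ℝ≥0) :
    (s.toFun j (K.functor.map m x)).path r = K.functor.map m ((s.toFun i x).path r) := by
  rw [← s.map_toFun, PathCone.path_map m h]

theorem proj_val {i : Tot a} {x : K.functor.obj i} {r : ℝ≥0} (h : 0 < s.ht x)
    (hr : 1 ≤ (s.ht x : ℝ) * (1 + r)) : (s.toFun i x).path r = (s.proj x).val :=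
  (s.toFun i x).path_eq (s.pr_cone h) hr

variable (φ lA)

open Classical in
/-- The extension of a family to a neighbourhood of the latching subspace. -/
def extend (i : Tot a) (v : Ball N) (x : K.functor.obj i) : X.functor.obj i :=
  if ‖v.1‖ ≤ s.ht x then lA i (s.proj x) (Ball.retract ((s.ht x : ℝ)⁻¹ • v.1))
  else φ i (Ball.retract (‖v.1‖⁻¹ • v.1))
    ((s.toFun i x).path (Real.toNNReal ((1 - ‖v.1‖) / s.ht x)))

variable {φ lA}

theorem retract_mem_bd {v : Fin N → ℝ} {t : ℝ} (ht : 0 < t) (h : ‖v‖ = t) :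
    Ball.retract (t⁻¹ • v) ∈ Ball.bd N := by
  have h1 : ‖t⁻¹ • v‖ = 1 := by
    rw [norm_smul, norm_inv, Real.norm_of_nonneg ht.le, h, inv_mul_cancel₀ ht.ne']
  change ‖(Ball.retract _).1‖ = 1
  rw [Ball.retract_eq h1.le, h1]

theorem extend_of_ht_eq_one (i : Tot a) (v : Ball N) {x : K.functor.obj i} (hx : s.ht x = 1) :
    s.extend φ lA i v x = lA i (s.proj x) v := by
  have h1 : ((s.ht x : I) : ℝ) = 1 := by
    rw [hx]
    rfl
  rw [extend, h1, if_pos v.norm_le, inv_one, one_smul]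
  congr 1
  exact Subtype.ext (Ball.retract_eq v.norm_le)

/-- At `‖v‖ = 1` the path is evaluated at time `0`, where it is at `x`; if also the height is `1`,
then `x` is latched and `IsLatchFamily.bd` applies. -/
theorem extend_of_mem_bd (h : IsLatchFamily φ n l lA) (hl : IsFamily hfin φ n l)
    (hφ : IsBoundaryFamily φ) {i : Tot a} (hi : deg hfin i.idx = n) {v : Ball N}
    (hv : v ∈ Ball.bd N) (x : K.functor.obj i) : s.extend φ lA i v x = φ i v x := by
  have hv' : ‖v.1‖ = 1 := hv
  by_cases hx : s.ht x = 1
  · rw [s.extend_of_ht_eq_one i v hx, h.bd hl hφ hi _ hv, ← s.proj_val (r := 0), s.path_zero]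
    · rw [hx]
      exact one_pos
    · rw [hx]
      simp
  · rw [extend, if_neg, hv', sub_self, zero_div, Real.toNNReal_zero, s.path_zero, inv_one, one_smul]
    · congr 1
      exact Subtype.ext (Ball.retract_eq v.norm_le)
    · rw [hv']
      intro h1
      exact hx (le_antisymm (s.ht x).2.2 h1)

theorem extend_map (h : IsLatchFamily φ n l lA)
    (hφ : IsBoundaryFamily φ) {i j : Tot a} (hi : deg hfin i.idx = n) (m : i ⟶ j)
    (hm : deg hfin i.idx = deg hfin j.idx) (v : Ball N) (x : K.functor.obj i) :
    s.extend φ lA j v (K.functor.map m x) = X.functor.map m (s.extend φ lA i v x) := by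
  rw [extend, extend, s.ht_map_of_eq m hm]
  split_ifs with hv
  · rw [s.proj_map_of_eq m hm, h.map hi]
  · rw [s.path_map_of_eq m hm, hφ.map]
    exact retract_mem_bd ((s.ht x).2.1.trans_lt (not_le.1 hv)) rfl

/-- For `x` of height `t`, the ball of radius `t` carries the rescaled latching values at the
projection of `x`, and the shell outside carries the boundary family along the path of `x`. On the
sphere of radius `t` the time is `(1 - t) / t = t⁻¹ - 1`, when the path has reached the projection,
so the formulas agree. -/
theorem continuousOn_extend (h : IsLatchFamily φ n l lA) (hl : IsFamily hfin φ n l)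
    (hφ : IsBoundaryFamily φ) {i : Tot a} (hi : deg hfin i.idx = n) :
    ContinuousOn (fun z : Ball N × K.functor.obj i => s.extend φ lA i z.1 z.2)
      (univ ×ˢ {x | 0 < s.ht x}) := by
  let U : Set (Ball N × K.functor.obj i) := univ ×ˢ {x | 0 < s.ht x}
  have hτ : Continuous fun z : Ball N × K.functor.obj i => (s.ht z.2 : ℝ) :=
    continuous_subtype_val.comp (s.continuous_ht.comp continuous_snd)
  have hv : Continuous fun z : Ball N × K.functor.obj i => z.1.1 :=
    continuous_subtype_val.comp continuous_fst
  have hpos : ∀ z ∈ U, (0 : ℝ) < s.ht z.2 := fun z hz => hz.2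
  have h1 : ContinuousOn (fun z : Ball N × K.functor.obj i =>
      lA i (s.proj z.2) (Ball.retract ((s.ht z.2 : ℝ)⁻¹ • z.1.1))) U := by
    have e1 : ContinuousOn (fun z : Ball N × K.functor.obj i => lA i (s.proj z.2)) U :=
      (h.continuous hl hi).comp_continuousOn
        (s.continuousOn_proj.comp continuousOn_snd fun z hz => hz.2)
    have e2 : ContinuousOn (fun z : Ball N × K.functor.obj i =>
        Ball.retract ((s.ht z.2 : ℝ)⁻¹ • z.1.1)) U :=
      Ball.continuous_retract.comp_continuousOn
        ((hτ.continuousOn.inv₀ fun z hz => (hpos z hz).ne').smul hv.continuousOn)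
    exact (continuous_eval (F := C(Ball N, X.functor.obj i))).comp_continuousOn (e1.prodMk e2)
  have h2 : ContinuousOn (fun z : Ball N × K.functor.obj i =>
      φ i (Ball.retract (‖z.1.1‖⁻¹ • z.1.1))
        ((s.toFun i z.2).path (Real.toNNReal ((1 - ‖z.1.1‖) / s.ht z.2))))
      (U ∩ {z | (s.ht z.2 : ℝ) ≤ ‖z.1.1‖}) := by
    have e1 : ContinuousOn (fun z : Ball N × K.functor.obj i =>
        Ball.retract (‖z.1.1‖⁻¹ • z.1.1)) (U ∩ {z | (s.ht z.2 : ℝ) ≤ ‖z.1.1‖}) :=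
      Ball.continuous_retract.comp_continuousOn
        ((hv.norm.continuousOn.inv₀ fun z hz => ((hpos z hz.1).trans_le hz.2).ne').smul
          hv.continuousOn)
    have e2 : ContinuousOn (fun z : Ball N × K.functor.obj i =>
        (s.toFun i z.2).path (Real.toNNReal ((1 - ‖z.1.1‖) / s.ht z.2)))
        (U ∩ {z | (s.ht z.2 : ℝ) ≤ ‖z.1.1‖}) := by
      refine (continuous_eval (F := C(ℝ≥0, K.functor.obj i))).comp_continuousOn
        ((PathCone.continuous_path.comp ((s.continuous_toFun i).comp
          continuous_snd)).continuousOn.prodMk (continuous_real_toNNReal.comp_continuousOn ?_))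
      exact (continuous_const.sub hv.norm).continuousOn.div hτ.continuousOn
        fun z hz => (hpos z hz.1).ne'
    refine (hφ.continuousOn i).comp (e1.prodMk e2) fun z hz => ⟨?_, trivial⟩
    exact retract_mem_bd ((hpos z hz.1).trans_le hz.2) rfl
  have hU : U = U ∩ {z | ‖z.1.1‖ ≤ s.ht z.2} ∪ U ∩ {z | (s.ht z.2 : ℝ) ≤ ‖z.1.1‖} := by
    ext z
    constructor
    · intro hz
      rcases le_total ‖z.1.1‖ (s.ht z.2) with h | h
      · exact Or.inl ⟨hz, h⟩
      · exact Or.inr ⟨hz, h⟩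
    · rintro (hz | hz)
      · exact hz.1
      · exact hz.1
  have k1 : ContinuousOn (fun z : Ball N × K.functor.obj i => s.extend φ lA i z.1 z.2)
      (U ∩ {z | ‖z.1.1‖ ≤ s.ht z.2}) :=
    (h1.mono inter_subset_left).congr fun z hz => if_pos hz.2
  have k2 : ContinuousOn (fun z : Ball N × K.functor.obj i => s.extend φ lA i z.1 z.2)
      (U ∩ {z | (s.ht z.2 : ℝ) ≤ ‖z.1.1‖}) := by
    refine h2.congr fun z hz => ?_
    have hz2 : (s.ht z.2 : ℝ) ≤ ‖z.1.1‖ := hz.2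
    rcases hz2.lt_or_eq with h' | h'
    · exact if_neg (not_le.2 h')
    · have hb := retract_mem_bd (hpos z hz.1) h'.symm
      change (if _ then _ else _) = _
      rw [if_pos h'.ge, h.bd hl hφ hi _ hb]
      dsimp only
      rw [← h', s.proj_val hz.1.2]
      rw [Real.coe_toNNReal _ (div_nonneg (sub_nonneg.2 (s.ht z.2).2.2) (s.ht z.2).2.1)]
      have := (hpos z hz.1).ne'
      field_simp
      linarith
  -- Continuity is glued pointwise: where one strict inequality holds a single piece is a
  -- neighbourhood within `U`, and where equality holds both pieces contain the point.
  change ContinuousOn _ U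
  intro z hz
  rcases lt_trichotomy ‖z.1.1‖ (s.ht z.2 : ℝ) with hlt | heq | hlt
  · refine (k1 z ⟨hz, hlt.le⟩).mono_of_mem_nhdsWithin ?_
    exact Filter.inter_mem self_mem_nhdsWithin (mem_nhdsWithin_of_mem_nhds
      (Filter.mem_of_superset ((isOpen_lt hv.norm hτ).mem_nhds hlt) fun w hw => le_of_lt (α := ℝ) hw))
  · rw [hU]
    exact (k1 z ⟨hz, heq.le⟩).union (k2 z ⟨hz, heq.ge⟩)
  · refine (k2 z ⟨hz, hlt.le⟩).mono_of_mem_nhdsWithin ?_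
    exact Filter.inter_mem self_mem_nhdsWithin (mem_nhdsWithin_of_mem_nhds
      (Filter.mem_of_superset ((isOpen_lt hτ hv.norm).mem_nhds hlt) fun w hw => le_of_lt (α := ℝ) hw))

end LatchSection

end

end Family

/-! ## Families of natural transformations -/

section HomSpace

variable {G : Type u} [Group G] {a : SingleObj G ⥤ Cat.{u, u}}

theorem continuous_compactlyGenerated_induced {A : Type u} {B : Type*} [TopologicalSpace B]
    (e : A → B) :
    @Continuous A B (@TopologicalSpace.compactlyGenerated.{u} A (TopologicalSpace.induced e ‹_›)) _
      e := by
  let t : TopologicalSpace A := TopologicalSpace.induced e ‹_›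
  exact @Continuous.comp A A B (TopologicalSpace.compactlyGenerated.{u} A) t _ id e
    continuous_induced_dom (@KSpace.continuous_out A t)

namespace GDiagram

variable {K X : GDiagram a TopCat.{u}}

/-- The components of an element of `Hom(K, X)`. -/
def HomSpace.comp (f : HomSpace K X) (i : Idx a) : C(K.functor.obj i, X.functor.obj i) :=
  (NatTrans.app (F := K.functor) (G := X.functor) f i).hom

theorem HomSpace.continuous_comp (i : Idx a) :
    Continuous fun f : HomSpace K X => HomSpace.comp f i :=
  have h : Continuous fun (f : HomSpace K X) (i : Idx a) => HomSpace.comp f i :=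
    continuous_compactlyGenerated_induced _
  (continuous_apply i).comp h

/-- Being fixed under conjugation means commuting with the `G`-structures, since `φ_{g⁻¹}` is
inverse to `φ_g`. -/
theorem HomSpace.mem_fixedPoints (f : HomSpace K X) : f ∈ MulAction.fixedPoints G (HomSpace K X) ↔
    ∀ (g : G) {i j : Idx a} (h : g • i = j) (x : K.functor.obj i),
      HomSpace.comp f j (K.tr g h x) = X.tr g h (HomSpace.comp f i x) := by
  have key : ∀ (g : G) {i j : Idx a} (h : g • i = j) (x : K.functor.obj i),
      HomSpace.comp (g • f) j (K.tr g h x) = X.tr g h (HomSpace.comp f i x) := by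
    intro g i j h x
    have h' : g⁻¹ • j = i := by rw [← h, inv_smul_smul]
    have e : K.tr g h ≫ K.tr g⁻¹ h' = 𝟙 _ := by
      rw [K.tr_comp, K.tr_congr (inv_mul_cancel g) _ (one_smul G i), K.tr_one]
    have h1 := ConcreteCategory.congr_hom (conj_app K X g f h h') (K.tr g h x)
    refine h1.trans ?_
    exact congrArg (fun y => X.tr g h (HomSpace.comp f i y)) (ConcreteCategory.congr_hom e x)
  constructor
  · intro hf g i j h x
    rw [← key g h, hf g]
  · intro hf g
    refine NatTrans.ext (funext fun j => ?_)
    ext x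
    have h : g • g⁻¹ • j = j := smul_inv_smul g j
    have e : K.tr g⁻¹ (i := j) rfl ≫ K.tr g h = 𝟙 _ := by
      rw [K.tr_comp, K.tr_congr (mul_inv_cancel g) _ (one_smul G j), K.tr_one]
    have hx : K.tr g h (K.tr g⁻¹ rfl x) = x := ConcreteCategory.congr_hom e x
    change HomSpace.comp (g • f) j x = HomSpace.comp f j x
    rw [← hx, key g h, hf g h]

variable {P : Type} [TopologicalSpace P] [CompactSpace P] [T2Space P]

omit [CompactSpace P] [T2Space P] in
theorem HomSpace.continuousOn_comp_of_compact {bP : Set P} {b : P → HomSpace K X}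
    (hb : ContinuousOn b bP) {T : Type*} [TopologicalSpace T] [CompactSpace T] [T2Space T] {i : Idx a}
    {f : T → K.functor.obj i} (hf : Continuous f) :
    ContinuousOn (fun z : P × T => HomSpace.comp (b z.1) i (f z.2)) (bP ×ˢ univ) := by
  have h : ContinuousOn (fun v => (HomSpace.comp (b v) i).comp ⟨f, hf⟩) bP :=
    (ContinuousMap.continuous_precomp _).comp_continuousOn
      ((HomSpace.continuous_comp i).comp_continuousOn hb)
  exact (continuous_eval (F := C(T, X.functor.obj i))).comp_continuousOn
    ((h.comp continuousOn_fst fun z hz => hz.1).prodMk continuousOn_snd)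

/-- Evaluation need not be jointly continuous on `K_i`, but it is after restriction to compact test
spaces; since `K_i` is compactly generated and the closed set `bP` is compact, these tests suffice.
-/
theorem HomSpace.continuousOn_comp {bP : Set P} (hP : IsClosed bP) {b : P → HomSpace K X}
    (hb : ContinuousOn b bP) (i : Idx a) [CompactlyGeneratedSpace (K.functor.obj i)] :
    ContinuousOn (fun z : P × K.functor.obj i => HomSpace.comp (b z.1) i z.2) (bP ×ˢ univ) := by
  have : CompactSpace bP := isCompact_iff_compactSpace.1 hP.isCompact
  have hc : ∀ x, Continuous fun v : bP => HomSpace.comp (b v) i x := fun x =>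
    (continuous_eval_const (F := C(K.functor.obj i, X.functor.obj i)) x).comp
      ((HomSpace.continuous_comp i).comp (continuousOn_iff_continuous_domRestrict.1 hb))
  let F : K.functor.obj i → C(bP, X.functor.obj i) := fun x => ⟨_, hc x⟩
  have hF : Continuous F := by
    refine continuous_from_uCompactlyGeneratedSpace _ fun S g => ?_
    refine ContinuousMap.continuous_of_continuous_uncurry _ ?_
    have h := HomSpace.continuousOn_comp_of_compact (T := S.toTop) hb g.continuous
    exact h.comp_continuous (f := fun z : S × bP => (z.2.1, z.1)) (by fun_prop)
      fun z => ⟨z.2.2, trivial⟩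
  have h2 : Continuous fun z : bP × K.functor.obj i => HomSpace.comp (b z.1) i z.2 :=
    (continuous_eval (F := C(bP, X.functor.obj i))).comp
      ((hF.comp continuous_snd).prodMk continuous_fst)
  rw [continuousOn_iff_continuous_domRestrict]
  exact h2.comp (f := fun z : (bP ×ˢ univ : Set (P × K.functor.obj i)) => (⟨z.1.1, z.2.1⟩, z.1.2))
    (by fun_prop)

/-- Since `P` is compact Hausdorff, a map from `P` that is continuous for the compact-open
topologies is continuous for their compactly generated refinement. -/
theorem HomSpace.exists_of_family {L : ∀ i : Idx a, K.functor.obj i → C(P, X.functor.obj i)}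
    (hL : ∀ i, Continuous (L i))
    (hLm : ∀ {i j : Idx a} (α : i ⟶ j) x v, L j (K.functor.map α x) v = X.functor.map α (L i x v)) :
    ∃ F : P → HomSpace K X, Continuous F ∧ ∀ v i x, HomSpace.comp (F v) i x = L i x v := by
  have hc : ∀ i, Continuous fun z : P × K.functor.obj i => L i z.2 z.1 := fun i =>
    (continuous_eval (F := C(P, X.functor.obj i))).comp
      (((hL i).comp continuous_snd).prodMk continuous_fst)
  let F : P → (K.functor ⟶ X.functor) := fun v =>
    { app := fun i => TopCat.ofHom ⟨fun x => L i x v, (hc i).comp (Continuous.prodMk_right v)⟩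
      naturality := fun i j α => by
        ext x
        exact hLm α x v }
  refine ⟨F, ?_, fun v i x => rfl⟩
  let t : TopologicalSpace (HomSpace K X) := TopologicalSpace.induced
    (fun (f : HomSpace K X) (i : Idx a) => HomSpace.comp f i) inferInstance
  refine @continuous_compactlyGenerated_rng_of_compact (HomSpace K X) t P _ _ _ F ?_
  refine continuous_induced_rng.2 (continuous_pi fun i => ?_)
  exact ContinuousMap.continuous_of_continuous_uncurry _ (hc i)

end GDiagram

end HomSpace

/-! ## Mapping spaces out of cofibrant diagrams -/

section Cofibrant

variable {G : Type u} [Group G] {a : SingleObj G ⥤ Cat.{u, u}}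
  {hfin : ∀ i : Idx a, ∃ d : ℕ, (nerve (Over i)).HasDimensionLT d}
  {K X : PtGDiagram a} {k : ℕ}
  {φ : ∀ i : Tot a, Ball (k + 1) → K.toPtTot.functor.obj i → X.toPtTot.functor.obj i}
  {n : ℕ} {l : ∀ i : Tot a, K.toPtTot.functor.obj i → C(Ball (k + 1), X.toPtTot.functor.obj i)}
  {lA : ∀ i : Tot a, Latch hfin K.toPtTot i → C(Ball (k + 1), X.toPtTot.functor.obj i)}

theorem PtGDiagram.toPtTot_map_totTr (g : G) {i j : Idx a} (h : g • i = j)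
    (x : K.functor.obj i) : K.toPtTot.functor.map (totTr g h) x = K.tr g h x :=
  ConcreteCategory.congr_hom (K.toTot_map_totTr g h) x

/-- The single step of part (1) at one object: the neighbourhood extension serves as the partial map
for the equivariant cell induction over `K_i`, with the height of the latching section as the
control function. -/
theorem IsLatchFamily.exists_extension (hKC : K.IsCGHaus) (s : LatchSection hfin K.toPtTot)
    (hlA : IsLatchFamily φ n l lA) (hl : IsFamily hfin φ n l) (hφ : IsBoundaryFamily φ)
    (i : Idx a) (hi : deg hfin i = n) (c : GCWComplex (Stab a i) (K.functor.obj i))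
    (hc : ∀ H : Subgroup (Stab a i), K.Fixed i H ≠ {K.pt i} →
      intToEReal k ≤ connSub (conn (X.Fixed i H)) (c.dimFixed H)) :
    ∃ L : K.toPtTot.functor.obj (tot i) → C(Ball (k + 1), X.toPtTot.functor.obj (tot i)),
      Continuous L ∧ (∀ v ∈ Ball.bd (k + 1), ∀ x, L x v = φ (tot i) v x) ∧
      (∀ v x, s.ht x = 1 → L x v = lA (tot i) (s.proj x) v) ∧
      ∀ (g : G) (h : g • i = i) x v, L (K.toPtTot.functor.map (totTr g h) x) v =
        X.toPtTot.functor.map (totTr g h) (L x v) := by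
  have : T2Space (K.functor.obj i) := (hKC i).2
  have hsm : ∀ (γ : Stab a i) (x : K.functor.obj i),
      γ • x = K.toPtTot.functor.map (totTr γ.1 γ.2) x := fun γ x =>
    (K.toPtTot_map_totTr γ.1 γ.2 x).symm
  have hsmX : ∀ (γ : Stab a i) (x : X.functor.obj i),
      γ • x = X.toPtTot.functor.map (totTr γ.1 γ.2) x := fun γ x =>
    (X.toPtTot_map_totTr γ.1 γ.2 x).symm
  have hF : GCWComplex.IsPartialMap (Γ := Stab a i) (K := K.functor.obj i)
      (Y := X.functor.obj i) (Ball.bd (k + 1))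
      (fun x : K.functor.obj i => s.ht (i := tot i) x)
      (fun v (x : K.functor.obj i) => (s.extend φ lA (tot i) v x : X.functor.obj i)) :=
    { isClosed := Ball.isClosed_bd _
      continuous_height := s.continuous_ht (i := tot i)
      height_smul := fun γ x => by
        rw [hsm]
        exact s.ht_map_of_eq (totTr γ.1 γ.2) rfl x
      continuousOn_bd := (hφ.continuousOn (tot i)).congr fun z hz =>
        s.extend_of_mem_bd hlA hl hφ hi hz.1 z.2
      continuousOn_height := s.continuousOn_extend hlA hl hφ hi
      map_smul := fun γ v x _ =>
        (congrArg (s.extend φ lA (tot i) v) (hsm γ x)).trans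
          ((s.extend_map hlA hφ hi (totTr γ.1 γ.2) rfl v x).trans (hsmX γ _).symm) }
  have hcell : ∀ (q : ℕ) (e : c.cw.cell q), (∀ x : Ball q, s.ht (i := tot i) (c.chr e x) = 1) ∨
      ∀ j ≤ q, PairExt (Ball (k + 1) × (Fin j → I))
        (bdProd (Ball.bd (k + 1)) (Cube.boundary (Fin j)))
        {y : X.functor.obj i | ∀ γ : Stab a i, c.smulCell γ e = e → γ • y = y} := by
    intro q e
    let _ := c.cellAction q
    let H : Subgroup (Stab a i) := MulAction.stabilizer (Stab a i) e
    -- If `H` fixes only the base point, the cell is the base point and has height `1`, so no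
    -- condition on `X_i^H` is needed. This explains the restriction on `H` in the bound.
    by_cases hH : K.Fixed i H = {K.pt i}
    · left
      intro x
      have hx : c.chr e x ∈ K.Fixed i H := fun γ => by
        refine (c.chr_smul γ.1 e x).symm.trans ?_
        exact congrArg (fun e => c.chr e x) γ.2
      rw [hH] at hx
      rw [hx]
      exact s.ht_pt (tot i)
    · right
      intro j hj
      have hq : (q : EReal) ≤ c.dimFixed H :=
        le_iSup₂_of_le q ⟨e, fun γ hγ => hγ⟩ le_rfl
      have hn := isNConnected_of_le_connSub (hc H hH) hq
      have hfix : X.Fixed i H = {y : X.functor.obj i | ∀ γ : Stab a i, c.smulCell γ e = e → γ • y = y} := by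
        ext y
        exact ⟨fun hy γ hγ => hy ⟨γ, hγ⟩, fun hy γ => hy γ.1 γ.2⟩
      rw [← hfix]
      exact hn.pairExt (by push_cast; omega)
  obtain ⟨L, hLc, hLb, hLh, hLs⟩ := c.exists_extension (Y := X.functor.obj i) (fun γ => by
      exact (X.tr γ.1 (MulAction.mem_stabilizer_iff.1 γ.2)).hom.continuous) hF
    (y₀ := X.pt i) (fun γ => X.tr_pt γ.1 _) hcell
  refine ⟨L, hLc, fun v hv x => ?_, fun v x hx => ?_, fun g h x v => ?_⟩
  · exact (hLb v hv x).trans (s.extend_of_mem_bd hlA hl hφ hi hv x)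
  · exact (hLh v x hx).trans (s.extend_of_ht_eq_one (tot i) v hx)
  · exact (congrArg (fun y => L y v) (hsm ⟨g, h⟩ x).symm).trans
      ((hLs ⟨g, h⟩ x v).trans (hsmX ⟨g, h⟩ _))

-- The extension is chosen at one object of each `G`-orbit of degree `n`, equivariantly for its
-- stabilizer, and transported along the orbit. Naturality for morphisms from smaller degrees holds
-- because the latching values are respected.
open Classical in
theorem IsFamily.exists_succ (hK : K.IsCofibrant) (hKC : K.IsCGHaus)
    (s : LatchSection hfin K.toPtTot)
    (cw : ∀ i : Idx a, GCWComplex (Stab a i) (K.functor.obj i))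
    (hc : ∀ (i : Idx a) (H : Subgroup (Stab a i)), K.Fixed i H ≠ {K.pt i} →
      intToEReal k ≤ connSub (conn (X.Fixed i H)) ((cw i).dimFixed H))
    (hφ : IsBoundaryFamily φ) (hl : IsFamily hfin φ n l) :
    ∃ l', IsFamily hfin φ (n + 1) l' ∧ ∀ i, deg hfin i.idx < n → l' i = l i := by
  obtain ⟨lA, hlA⟩ := hl.exists_latch hK hKC s
  have hex : ∀ i : Idx a, ∃ L : K.toPtTot.functor.obj (tot i) →
      C(Ball (k + 1), X.toPtTot.functor.obj (tot i)), deg hfin i = n →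
      Continuous L ∧ (∀ v ∈ Ball.bd (k + 1), ∀ x, L x v = φ (tot i) v x) ∧
      (∀ v x, s.ht x = 1 → L x v = lA (tot i) (s.proj x) v) ∧
      ∀ (g : G) (h : g • i = i) x v, L (K.toPtTot.functor.map (totTr g h) x) v =
        X.toPtTot.functor.map (totTr g h) (L x v) := by
    intro i
    by_cases hi : deg hfin i = n
    · obtain ⟨L, hL⟩ := hlA.exists_extension hKC s hl hφ i hi (cw i) (hc i)
      exact ⟨L, fun _ => hL⟩
    · exact ⟨fun _ => ContinuousMap.const _ (X.pt i), fun h => (hi h).elim⟩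
  choose L hL using hex
  let rep : Idx a → Idx a := fun i => (Quotient.mk (MulAction.orbitRel G (Idx a)) i).out
  have hrep : ∀ i, ∃ g : G, g • rep i = i := fun i =>
    (MulAction.orbitRel G (Idx a)).symm (Quotient.mk_out i)
  have hrepg : ∀ (g : G) {i j}, g • i = j → rep j = rep i := fun g i j h =>
    congrArg Quotient.out (Quotient.sound (s := MulAction.orbitRel G (Idx a)) ⟨g, h⟩)
  choose g hg using hrep
  have hg' : ∀ i, (g i)⁻¹ • i = rep i := fun i => by rw [inv_smul_eq_iff, hg]
  have hdeg : ∀ i, deg hfin (rep i) = deg hfin i := fun i => by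
    rw [← deg_smul hfin (g i) (rep i), hg]
  have hLr : ∀ {r r' : Idx a} (_ : r' = r) (_ : deg hfin r = n) (h : G) (e : h • r = r') x v,
      L r' (K.toPtTot.functor.map (totTr h e) x) v = X.toPtTot.functor.map (totTr h e) (L r x v) := by
    rintro r _ rfl hr h e x v
    exact (hL _ hr).2.2.2 h e x v
  let l' : ∀ i : Tot a, K.toPtTot.functor.obj i → C(Ball (k + 1), X.toPtTot.functor.obj i) :=
    fun i => if deg hfin i.idx = n then
      fun x => (X.toPtTot.functor.map (totTr (g i.idx) (hg i.idx) : tot (rep i.idx) ⟶ i)).hom.comp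
        (L (rep i.idx) (K.toPtTot.functor.map (totTr (g i.idx)⁻¹ (hg' i.idx) : i ⟶ tot (rep i.idx)) x))
      else l i
  have hl1 : ∀ i : Tot a, deg hfin i.idx = n → ∀ x v, l' i x v =
      X.toPtTot.functor.map (totTr (g i.idx) (hg i.idx) : tot (rep i.idx) ⟶ i) (L (rep i.idx)
        (K.toPtTot.functor.map (totTr (g i.idx)⁻¹ (hg' i.idx) : i ⟶ tot (rep i.idx)) x) v) := by
    intro i hi x v
    simp only [l', if_pos hi]
    rfl
  have hl2 : ∀ i : Tot a, deg hfin i.idx < n → l' i = l i := fun i hi => if_neg hi.ne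
  have hgg : ∀ (F : PtTot a) (i : Tot a) (x : F.functor.obj i),
      F.functor.map (totTr (g i.idx) (hg i.idx) : tot (rep i.idx) ⟶ i)
        (F.functor.map (totTr (g i.idx)⁻¹ (hg' i.idx) : i ⟶ tot (rep i.idx)) x) = x := by
    intro F i x
    rw [← map_comp_apply]
    have e : (totTr (g i.idx)⁻¹ (hg' i.idx) : i ⟶ tot (rep i.idx)) ≫
        (totTr (g i.idx) (hg i.idx) : tot (rep i.idx) ⟶ i) = 𝟙 i :=
      (totTr_comp _ _).trans (totHom_ext (mul_inv_cancel _) (by simp))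
    exact (congrArg (fun m => F.functor.map m x) e).trans (map_id_apply _ _)
  -- the values on the latching subspace
  have hlow : ∀ {i j : Tot a} (m : i ⟶ j), deg hfin j.idx = n → deg hfin i.idx < n → ∀ x v,
      l' j (K.toPtTot.functor.map m x) v = X.toPtTot.functor.map m (l' i x v) := by
    intro i j m hj hi x v
    have hd : deg hfin i.idx < deg hfin (rep j.idx) := by rwa [hdeg, hj]
    let m' : i ⟶ tot (rep j.idx) := m ≫ (totTr (g j.idx)⁻¹ (hg' j.idx) : j ⟶ tot (rep j.idx))
    have hr : deg hfin (rep j.idx) = n := (hdeg _).trans hj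
    have h1 := (hL (rep j.idx) hr).2.2.1 v (K.toPtTot.functor.map m' x)
      (s.ht_map_of_lt m' hd x)
    rw [s.proj_map_of_lt m' hd] at h1
    have h2 := DFunLike.congr_fun (hlA.of (i := tot (rep j.idx)) hr m' hd x) v
    rw [hl1 j hj, hl2 i hi, ← map_comp_apply K.toPtTot.functor]
    refine (congrArg (X.toPtTot.functor.map _) (h1.trans h2)).trans ?_
    refine (congrArg (X.toPtTot.functor.map _) (map_comp_apply X.toPtTot.functor m _ _)).trans ?_
    exact hgg X.toPtTot j _
  -- Between objects of equal degree `m` is a group element `h`; conjugation by the chosen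
  -- translations makes it an element of the stabilizer of the representative.
  have heq : ∀ {i j : Tot a} (m : i ⟶ j), deg hfin j.idx = n → deg hfin i.idx = n → ∀ x v,
      l' j (K.toPtTot.functor.map m x) v = X.toPtTot.functor.map m (l' i x v) := by
    intro i j m hj hi x v
    obtain ⟨h, e, rfl⟩ := exists_totTr hfin m (hi.trans hj.symm)
    have hrr : rep j.idx = rep i.idx := hrepg h e
    have e' : ((g j.idx)⁻¹ * h * g i.idx) • rep i.idx = rep j.idx := by
      rw [mul_smul, mul_smul, hg, e, hg']
    have h1 := hLr hrr ((hdeg _).trans hi) ((g j.idx)⁻¹ * h * g i.idx) e'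
      (K.toPtTot.functor.map (totTr (g i.idx)⁻¹ (hg' i.idx) : i ⟶ tot (rep i.idx)) x) v
    rw [hl1 j hj, hl1 i hi]
    have c1 : (totTr (g i.idx)⁻¹ (hg' i.idx) : i ⟶ tot (rep i.idx)) ≫
        totTr ((g j.idx)⁻¹ * h * g i.idx) e' =
        (totTr h e : i ⟶ j) ≫ (totTr (g j.idx)⁻¹ (hg' j.idx) : j ⟶ tot (rep j.idx)) := by
      refine (totTr_comp _ _).trans (Eq.trans ?_ (totTr_comp _ _).symm)
      exact totHom_ext (by group) (by simp)
    have c2 : (totTr ((g j.idx)⁻¹ * h * g i.idx) e' : tot (rep i.idx) ⟶ tot (rep j.idx)) ≫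
        (totTr (g j.idx) (hg j.idx) : tot (rep j.idx) ⟶ j) =
        (totTr (g i.idx) (hg i.idx) : tot (rep i.idx) ⟶ i) ≫ (totTr h e : i ⟶ j) := by
      refine (totTr_comp _ _).trans (Eq.trans ?_ (totTr_comp _ _).symm)
      exact totHom_ext (by group) (by simp)
    have h2 : K.toPtTot.functor.map (totTr (g j.idx)⁻¹ (hg' j.idx) : j ⟶ tot (rep j.idx))
        (K.toPtTot.functor.map (totTr h e) x) =
        K.toPtTot.functor.map (totTr ((g j.idx)⁻¹ * h * g i.idx) e')
          (K.toPtTot.functor.map (totTr (g i.idx)⁻¹ (hg' i.idx) : i ⟶ tot (rep i.idx)) x) := by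
      rw [← map_comp_apply, ← map_comp_apply, c1]
    rw [h2, h1, ← map_comp_apply, c2, map_comp_apply]
  refine ⟨l', ⟨fun i hi => ?_, fun {i j} m hj x v => ?_, fun i hi v => ?_, fun i hi x v hv => ?_⟩,
    hl2⟩
  · rcases Nat.lt_succ_iff_lt_or_eq.1 hi with hi | hi
    · rw [hl2 i hi]
      exact hl.continuous i hi
    · simp only [l', if_pos hi]
      exact (ContinuousMap.continuous_postcomp _).comp ((hL _ ((hdeg _).trans hi)).1.comp
        (K.toPtTot.functor.map _).hom.continuous)
  · rcases Nat.lt_succ_iff_lt_or_eq.1 hj with hj | hj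
    · rw [hl2 j hj, hl2 i ((deg_le_of_tot hfin m).trans_lt hj)]
      exact hl.map m hj x v
    · rcases (deg_le_of_tot hfin m).lt_or_eq with hm | hm
      · exact hlow m hj (hm.trans_eq hj) x v
      · exact heq m hj (hm.trans hj) x v
  · rcases Nat.lt_succ_iff_lt_or_eq.1 hi with hi | hi
    · rw [hl2 i hi]
      exact hl.pt i hi v
    · have hr : deg hfin (rep i.idx) = n := (hdeg _).trans hi
      rw [hl1 i hi, K.toPtTot.map_pt]
      have h1 := (hL (rep i.idx) hr).2.2.1 v (K.toPtTot.pt (tot (rep i.idx))) (s.ht_pt _)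
      rw [s.proj_pt, hlA.pt (tot (rep i.idx)) hr] at h1
      exact (congrArg (X.toPtTot.functor.map _) h1).trans (X.toPtTot.map_pt _)
  · rcases Nat.lt_succ_iff_lt_or_eq.1 hi with hi | hi
    · rw [hl2 i hi]
      exact hl.bd i hi x v hv
    · have hr : deg hfin (rep i.idx) = n := (hdeg _).trans hi
      rw [hl1 i hi, (hL (rep i.idx) hr).2.1 v hv, hφ.map _ v hv]
      exact hgg X.toPtTot i _

theorem IsBoundaryFamily.exists_extension (hfin : ∀ i : Idx a, ∃ d : ℕ, (nerve (Over i)).HasDimensionLT d)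
    (hK : K.IsCofibrant) (hKC : K.IsCGHaus)
    (cw : ∀ i : Idx a, GCWComplex (Stab a i) (K.functor.obj i))
    (hc : ∀ (i : Idx a) (H : Subgroup (Stab a i)), K.Fixed i H ≠ {K.pt i} →
      intToEReal k ≤ connSub (conn (X.Fixed i H)) ((cw i).dimFixed H))
    (hφ : IsBoundaryFamily φ) : ∃ l, ∀ n, IsFamily hfin φ n l := by
  obtain ⟨s⟩ := hK.exists_latchSection (hfin := hfin) hKC
  have h0 : IsFamily hfin φ 0 fun i _ => ContinuousMap.const _ (X.toPtTot.pt i) :=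
    ⟨fun _ h => absurd h (Nat.not_lt_zero _), fun _ h => absurd h (Nat.not_lt_zero _),
      fun _ h => absurd h (Nat.not_lt_zero _), fun _ h => absurd h (Nat.not_lt_zero _)⟩
  choose step hstep hstep' using fun (n : ℕ) (l : {l // IsFamily hfin φ n l}) =>
    l.2.exists_succ hK hKC s cw hc hφ
  let S : ∀ n, {l // IsFamily hfin φ n l} := fun n =>
    Nat.rec ⟨_, h0⟩ (fun n l => ⟨step n l, hstep n l⟩) n
  have hS : ∀ n i, deg hfin i.idx < n → (S (n + 1)).1 i = (S n).1 i := fun n => hstep' n (S n)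
  have hS' : ∀ n i, deg hfin i.idx < n → (S n).1 i = (S (deg hfin i.idx + 1)).1 i := by
    intro n i hn
    induction n, hn using Nat.le_induction with
    | base => rfl
    | succ n hn ih => rw [hS n i hn, ih]
  refine ⟨fun i => (S (deg hfin i.idx + 1)).1 i, fun n => ⟨fun i hi => ?_, fun {i j} m hj x v => ?_,
    fun i hi v => ?_, fun i hi x v hv => ?_⟩⟩
  · exact (S _).2.continuous i (Nat.lt_succ_self _)
  · have := (S (deg hfin j.idx + 1)).2.map m (Nat.lt_succ_self _) x v
    rwa [hS' _ i (Nat.lt_succ_of_le (deg_le_of_tot hfin m))] at this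
  · exact (S _).2.pt i (Nat.lt_succ_self _) v
  · exact (S _).2.bd i (Nat.lt_succ_self _) x v hv

/-- The constant transformation to the base points. -/
def PtGDiagram.constHom (K X : PtGDiagram a) : PtGDiagram.PtHomSpace K X :=
  ⟨{ app := fun i => TopCat.ofHom (ContinuousMap.const _ (X.pt i))
     naturality := fun i j α => by
      ext x
      exact (X.map_pt α).symm }, fun _ => rfl⟩

theorem PtGDiagram.continuous_val : Continuous fun f : PtGDiagram.PtHomSpace K X => f.1 :=
  continuous_induced_dom

theorem PtGDiagram.continuous_of_val {T : Type*} [TopologicalSpace T]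
    {F : T → PtGDiagram.PtHomSpace K X} (hF : Continuous fun t => (F t).1) : Continuous F :=
  continuous_induced_rng.2 hF

theorem PtGDiagram.mem_fixedPoints (f : PtGDiagram.PtHomSpace K X) :
    f ∈ MulAction.fixedPoints G (PtGDiagram.PtHomSpace K X) ↔
      f.1 ∈ MulAction.fixedPoints G (GDiagram.HomSpace K.toGDiagram X.toGDiagram) :=
  ⟨fun h g => congrArg Subtype.val (h g), fun h g => Subtype.ext (h g)⟩

theorem PtGDiagram.constHom_mem_fixedPoints (K X : PtGDiagram a) :
    PtGDiagram.constHom K X ∈ MulAction.fixedPoints G (PtGDiagram.PtHomSpace K X) := by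
  rw [PtGDiagram.mem_fixedPoints, GDiagram.HomSpace.mem_fixedPoints]
  intro g i j h x
  exact (X.tr_pt g h).symm

/-- A family of fixed points of the mapping space is the same as a family of transformations natural
on the Grothendieck construction, which is the setting of the induction over degrees. -/
theorem PtGDiagram.pairExt_fixedPoints
    (hfin : ∀ i : Idx a, ∃ d : ℕ, (nerve (Over i)).HasDimensionLT d)
    (hK : K.IsCofibrant) (hKC : K.IsCGHaus)
    (cw : ∀ i : Idx a, GCWComplex (Stab a i) (K.functor.obj i))
    (hc : ∀ (i : Idx a) (H : Subgroup (Stab a i)), K.Fixed i H ≠ {K.pt i} →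
      intToEReal k ≤ connSub (conn (X.Fixed i H)) ((cw i).dimFixed H)) :
    PairExt (Ball (k + 1)) (Ball.bd (k + 1))
      (MulAction.fixedPoints G (PtGDiagram.PtHomSpace K X)) := by
  intro f hf
  let b : Ball (k + 1) → GDiagram.HomSpace K.toGDiagram X.toGDiagram := fun v => (f v).1.1
  have hb : ContinuousOn b (Ball.bd (k + 1)) :=
    (PtGDiagram.continuous_val.comp continuous_subtype_val).comp_continuousOn hf
  have hbf : ∀ v, b v ∈ MulAction.fixedPoints G _ := fun v =>
    (PtGDiagram.mem_fixedPoints (f v).1).1 (f v).2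
  let φ : ∀ i : Tot a, Ball (k + 1) → K.toPtTot.functor.obj i → X.toPtTot.functor.obj i :=
    fun i v x => (b v).comp i.idx x
  have hφ : IsBoundaryFamily φ :=
    { continuousOn := fun i => by
        have := (hKC i.idx).1
        exact GDiagram.HomSpace.continuousOn_comp (Ball.isClosed_bd _) hb i.idx
      map := fun {i j} m v _ x => by
        have h1 := (GDiagram.HomSpace.mem_fixedPoints (b v)).1 (hbf v) m.elt
          (i := i.idx) rfl x
        exact (nat_apply (E := K.functor) (B := X.functor) (b v) m.hom _).trans
          (congrArg (X.functor.map m.hom) h1)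
      pt := fun i v _ => (f v).1.2 i.idx }
  obtain ⟨l, hl⟩ := hφ.exists_extension hfin hK hKC cw hc
  obtain ⟨F, hF, hFl⟩ := GDiagram.HomSpace.exists_of_family (K := K.toGDiagram) (X := X.toGDiagram)
    (L := fun i => l (tot i)) (fun i => (hl _).continuous (tot i) (Nat.lt_succ_self _))
    (fun {i j} α x v => by
      have := (hl _).map (totMap α) (Nat.lt_succ_self _) x v
      have e1 : K.toPtTot.functor.map (totMap α) x = K.functor.map α x :=
        ConcreteCategory.congr_hom (K.toTot_map_totMap α) x
      have e2 : X.toPtTot.functor.map (totMap α) (l (tot i) x v) = X.functor.map α (l (tot i) x v) :=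
        ConcreteCategory.congr_hom (X.toTot_map_totMap α) _
      rw [e1, e2] at this
      exact this)
  have hFf : ∀ v, F v ∈ MulAction.fixedPoints G _ := fun v => by
    rw [GDiagram.HomSpace.mem_fixedPoints]
    intro g i j h x
    rw [hFl, hFl]
    have := (hl _).map (totTr g h) (Nat.lt_succ_self _) x v
    exact (congrArg (fun y => l (tot j) y v) (PtGDiagram.toPtTot_map_totTr g h x).symm).trans
      (this.trans (PtGDiagram.toPtTot_map_totTr g h _))
  refine ⟨fun v => ⟨⟨F v, fun i => ?_⟩, (PtGDiagram.mem_fixedPoints _).2 (hFf v)⟩,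
    Continuous.subtype_mk (PtGDiagram.continuous_of_val hF) _, fun v hv => ?_⟩
  · exact (hFl v i _).trans ((hl _).pt (tot i) (Nat.lt_succ_self _) v)
  · refine Subtype.ext (Subtype.ext (NatTrans.ext (funext fun i => ?_)))
    ext x
    exact (hFl v i x).trans ((hl _).bd (tot i) (Nat.lt_succ_self _) x v hv)

theorem intToEReal_mono {m n : ℤ} (h : m ≤ n) : intToEReal m ≤ intToEReal n := by
  unfold intToEReal
  exact_mod_cast h

theorem PtGDiagram.isConnectedUpTo_ptHomSpace
    (hfin : ∀ i : Idx a, ∃ d : ℕ, (nerve (Over i)).HasDimensionLT d)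
    (hK : K.IsCofibrant) (hKC : K.IsCGHaus)
    (cw : ∀ i : Idx a, GCWComplex (Stab a i) (K.functor.obj i)) (X : PtGDiagram a) :
    IsConnectedUpTo
      (⨅ (i : Idx a) (H : Subgroup (Stab a i)) (_ : K.Fixed i H ≠ {K.pt i}),
        connSub (conn (X.Fixed i H)) ((cw i).dimFixed H))
      (MulAction.fixedPoints G (PtGDiagram.PtHomSpace K X)) := by
  refine fun n hn => ⟨fun _ => ⟨⟨_, PtGDiagram.constHom_mem_fixedPoints K X⟩⟩, fun k hk y => ?_⟩
  have hc : ∀ (i : Idx a) (H : Subgroup (Stab a i)), K.Fixed i H ≠ {K.pt i} →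
      intToEReal k ≤ connSub (conn (X.Fixed i H)) ((cw i).dimFixed H) := fun i H h =>
    ((intToEReal_mono hk).trans hn).trans (iInf_le_of_le i (iInf_le_of_le H (iInf_le _ h)))
  exact (CubeExt.of_ball (PtGDiagram.pairExt_fixedPoints hfin hK hKC cw hc)).subsingleton y

end Cofibrant

/-! ## Topological simplices -/

section TopSimplex

/-- The topological simplex. -/
abbrev TopSimplex (n : ℕ) : Type := stdSimplex ℝ (Fin (n + 1))

namespace TopSimplex

/-- The boundary of the topological simplex. -/
def bd (n : ℕ) : Set (TopSimplex n) := {t | ∃ k, t k = 0}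

theorem isClosed_bd (n : ℕ) : IsClosed (bd n) := by
  have h : bd n = ⋃ k, {t | t k = 0} := by
    ext t
    simp [bd]
  rw [h]
  exact isClosed_iUnion_of_finite fun k => isClosed_eq
    ((continuous_apply k).comp continuous_subtype_val) continuous_const

/-- The simplex in coordinates. -/
def corner (n : ℕ) : Set (Fin n → ℝ) := {x | (∀ i, 0 ≤ x i) ∧ ∑ i, x i ≤ 1}

theorem convex_corner (n : ℕ) : Convex ℝ (corner n) := by
  intro x hx y hy a b ha hb hab
  refine ⟨fun i => ?_, ?_⟩
  · have h1 := hx.1 i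
    have h2 := hy.1 i
    simp only [Pi.add_apply, Pi.smul_apply, smul_eq_mul]
    positivity
  · simp only [Pi.add_apply, Pi.smul_apply, smul_eq_mul, Finset.sum_add_distrib, ← Finset.mul_sum]
    have h1 := mul_le_mul_of_nonneg_left hx.2 ha
    have h2 := mul_le_mul_of_nonneg_left hy.2 hb
    linarith

theorem isClosed_corner (n : ℕ) : IsClosed (corner n) := by
  refine IsClosed.inter (?_ : IsClosed {x : Fin n → ℝ | ∀ i, 0 ≤ x i}) (isClosed_le
    (continuous_finsetSum _ fun i _ => continuous_apply i) continuous_const)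
  simp only [ofPred_forall]
  exact isClosed_iInter fun i => isClosed_le continuous_const (continuous_apply i)

theorem isBounded_corner (n : ℕ) : Bornology.IsBounded (corner n) := by
  refine (Metric.isBounded_iff_subset_closedBall 0).2 ⟨1, fun x hx => ?_⟩
  rw [mem_closedBall_zero_iff, pi_norm_le_iff_of_nonneg zero_le_one]
  intro i
  rw [Real.norm_of_nonneg (hx.1 i)]
  exact (Finset.single_le_sum (fun j _ => hx.1 j) (Finset.mem_univ i)).trans hx.2

theorem interior_corner (n : ℕ) : interior (corner n) = {x | (∀ i, 0 < x i) ∧ ∑ i, x i < 1} := by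
  refine Subset.antisymm (fun x hx => ⟨fun i => ?_, ?_⟩) (interior_maximal ?_ ?_)
  · have h1 : corner n ⊆ (fun x : Fin n → ℝ => x i) ⁻¹' Ici 0 := fun x hx => hx.1 i
    have h2 := interior_mono h1 hx
    rw [← (isOpenMap_eval i).preimage_interior_eq_interior_preimage (continuous_apply i),
      interior_Ici] at h2
    exact h2
  -- For `n = 0` the sum is empty and the strict inequality trivial, whereas the sum functional
  -- would not be surjective.
  · obtain _ | n := n
    · simp
    have h1 : corner (n + 1) ⊆ (fun x : Fin (n + 1) → ℝ => ∑ i, x i) ⁻¹' Iic 1 := fun x hx => hx.2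
    have h2 := interior_mono h1 hx
    let f : (Fin (n + 1) → ℝ) →ₗ[ℝ] ℝ := ∑ i, LinearMap.proj i
    have hf : (fun x : Fin (n + 1) → ℝ => ∑ i, x i) = f := by
      ext x
      simp [f]
    have hs : Function.Surjective f := fun c => ⟨Pi.single 0 c, by simp [f]⟩
    rw [← IsOpenMap.preimage_interior_eq_interior_preimage
      (hf ▸ f.isOpenMap_of_finiteDimensional hs) (by fun_prop), interior_Iic] at h2
    exact h2
  · exact fun x hx => ⟨fun i => (hx.1 i).le, hx.2.le⟩
  · refine IsOpen.inter (?_ : IsOpen {x : Fin n → ℝ | ∀ i, 0 < x i}) (isOpen_lt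
      (continuous_finsetSum _ fun i _ => continuous_apply i) continuous_const)
    simp only [ofPred_forall]
    exact isOpen_iInter_of_finite fun i => isOpen_lt continuous_const (continuous_apply i)

theorem interior_corner_nonempty (n : ℕ) : (interior (corner n)).Nonempty := by
  rw [interior_corner]
  refine ⟨fun _ => 1 / (n + 1), fun _ => by positivity, ?_⟩
  rw [Finset.sum_const, Finset.card_univ, Fintype.card_fin, nsmul_eq_mul, mul_one_div,
    div_lt_one (by positivity)]
  linarith

/-- The coordinates of the topological simplex. -/
def cornerHomeo (n : ℕ) : TopSimplex n ≃ₜ corner n where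
  toFun t := ⟨Fin.tail t.1, fun i => t.2.1 _, by
    have h := t.2.2
    rw [Fin.sum_univ_succ] at h
    have := t.2.1 0
    change ∑ i : Fin n, t.1 i.succ ≤ 1
    linarith⟩
  invFun x := ⟨Fin.cons (1 - ∑ i, x.1 i) x.1, fun i => by
    refine Fin.cases ?_ (fun i => ?_) i
    · exact sub_nonneg.2 x.2.2
    · exact x.2.1 i, by
    rw [Fin.sum_univ_succ]
    simp⟩
  left_inv t := by
    refine Subtype.ext (funext fun i => ?_)
    refine Fin.cases ?_ (fun i => ?_) i
    · have h := t.2.2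
      rw [Fin.sum_univ_succ] at h
      change 1 - ∑ i : Fin n, t.1 i.succ = t.1 0
      linarith
    · rfl
  right_inv x := Subtype.ext (Fin.tail_cons (α := fun _ => ℝ) (1 - ∑ i, x.1 i) x.1)
  continuous_toFun := by
    refine Continuous.subtype_mk ?_ _
    exact continuous_pi fun i => (continuous_apply i.succ).comp continuous_subtype_val
  continuous_invFun := by
    refine Continuous.subtype_mk (continuous_pi fun i => ?_) _
    refine Fin.cases ?_ (fun i => ?_) i
    · simp only [Fin.cons_zero]
      fun_prop
    · simp only [Fin.cons_succ]
      exact (continuous_apply i).comp continuous_subtype_val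

theorem mem_bd_iff {n : ℕ} (t : TopSimplex n) : t ∈ bd n ↔ (cornerHomeo n t).1 ∈ frontier (corner n) := by
  rw [(isClosed_corner n).frontier_eq, interior_corner]
  have h := t.2.2
  rw [Fin.sum_univ_succ] at h
  constructor
  · rintro ⟨k, hk⟩
    refine ⟨(cornerHomeo n t).2, fun hx => ?_⟩
    revert hk
    refine Fin.cases (fun hk => ?_) (fun k hk => ?_) k
    · have h2 : ∑ i : Fin n, t.1 i.succ < 1 := hx.2
      have hk : t.1 0 = 0 := hk
      linarith
    · exact (hx.1 k).ne' hk
  · rintro ⟨-, hx⟩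
    by_contra hb
    refine hx ⟨fun i => lt_of_le_of_ne (t.2.1 _) fun e => hb ⟨i.succ, e.symm⟩, ?_⟩
    have h0 : 0 < t.1 0 := lt_of_le_of_ne (t.2.1 0) fun e => hb ⟨0, e.symm⟩
    change ∑ i : Fin n, t.1 i.succ < 1
    linarith

/-- In coordinates the simplex is a bounded closed convex set with nonempty interior, hence
homeomorphic to the ball with frontier going to the sphere. -/
theorem exists_homeo_ball (n : ℕ) : ∃ e : TopSimplex n ≃ₜ Ball n, ∀ t, e t ∈ Ball.bd n ↔ t ∈ bd n := by
  obtain ⟨h, -, h2, h3⟩ := exists_homeomorph_image_interior_closure_frontier_eq_unitBall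
    (convex_corner n) (interior_corner_nonempty n) (isBounded_corner n)
  rw [(isClosed_corner n).closure_eq] at h2
  have hm : ∀ x, x ∈ corner n ↔ h x ∈ Metric.closedBall (0 : Fin n → ℝ) 1 := fun x => by
    rw [← h2, h.injective.mem_set_image]
  refine ⟨(cornerHomeo n).trans (h.subtype hm), fun t => ?_⟩
  rw [mem_bd_iff, ← h.injective.mem_set_image, h3]
  exact mem_sphere_zero_iff_norm.symm

theorem pairExt {k n : ℕ} {m : ℤ} {Y : Type u} [TopologicalSpace Y] (h : IsNConnected m Y)
    (hq : ((k + n : ℕ) : ℤ) ≤ m) :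
    PairExt (Ball (k + 1) × TopSimplex n) (bdProd (Ball.bd (k + 1)) (bd n)) Y := by
  obtain ⟨e, he⟩ := exists_homeo_ball n
  refine (h.pairExt hq).of_homeomorph
    ((Homeomorph.refl _).prodCongr (e.trans (ballCube n))) fun z => ?_
  refine or_congr Iff.rfl ?_
  exact (ballCube_mem_boundary _).trans (he z.2)

/-! ### Faces of topological simplices -/

open scoped Simplicial

variable {n m p : ℕ}

/-- The map of topological simplices given by a morphism of the simplex category. -/
def map (f : ⦋m⦌ ⟶ ⦋n⦌) (t : TopSimplex m) : TopSimplex n := stdSimplex.map f t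

theorem continuous_map (f : ⦋m⦌ ⟶ ⦋n⦌) : Continuous (map f) := stdSimplex.continuous_map f

theorem map_id (t : TopSimplex n) : map (𝟙 ⦋n⦌) t = t := stdSimplex.map_id_apply t

theorem map_comp (f : ⦋m⦌ ⟶ ⦋n⦌) (g : ⦋n⦌ ⟶ ⦋p⦌) (t : TopSimplex m) :
    map (f ≫ g) t = map g (map f t) := (stdSimplex.map_comp_apply f g t).symm

theorem map_apply (f : ⦋m⦌ ⟶ ⦋n⦌) (t : TopSimplex m) (y : Fin (n + 1)) :
    map f t y = ∑ x : Fin (m + 1) with f x = y, t x := by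
  change FunOnFinite.linearMap ℝ ℝ f t y = _
  rw [FunOnFinite.linearMap_apply_apply]

theorem map_apply_apply (f : ⦋m⦌ ⟶ ⦋n⦌) [hf : Mono f] (t : TopSimplex m) (x : Fin (m + 1)) :
    map f t (f x) = t x := by
  have hf := SimplexCategory.mono_iff_injective.1 hf
  rw [map_apply, Finset.sum_eq_single x]
  · intro y hy hne
    exact (hne (hf (Finset.mem_filter.1 hy).2)).elim
  · intro hx
    exact (hx (Finset.mem_filter.2 ⟨Finset.mem_univ _, rfl⟩)).elim

theorem map_apply_eq_zero (f : ⦋m⦌ ⟶ ⦋n⦌) (t : TopSimplex m) {y : Fin (n + 1)}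
    (hy : ∀ x : Fin (m + 1), f x ≠ y) : map f t y = 0 := by
  rw [map_apply, Finset.sum_eq_zero]
  intro x hx
  exact (hy x (Finset.mem_filter.1 hx).2).elim

theorem map_injective (f : ⦋m⦌ ⟶ ⦋n⦌) [Mono f] : Function.Injective (map f) := by
  intro t t' h
  refine Subtype.ext (funext fun x => ?_)
  have := congrArg (fun s : TopSimplex n => s (f x)) h
  exact (map_apply_apply f t x).symm.trans (this.trans (map_apply_apply f t' x))

/-- The nonzero barycentric coordinates of `t` span the smallest face that contains it. -/
theorem exists_support (t : TopSimplex n) : ∃ (p : ℕ) (ε : ⦋p⦌ ⟶ ⦋n⦌) (_ : Mono ε)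
    (w : TopSimplex p), (∀ x, 0 < w x) ∧ map ε w = t := by
  let S : Finset (Fin (n + 1)) := Finset.univ.filter fun k => t k ≠ 0
  have hS : S.Nonempty := by
    by_contra h
    have h0 : ∀ k, t k = 0 := fun k => by
      by_contra hk
      exact h ⟨k, Finset.mem_filter.2 ⟨Finset.mem_univ _, hk⟩⟩
    have h1 := stdSimplex.sum_eq_one t
    rw [Finset.sum_eq_zero fun k _ => h0 k] at h1
    exact zero_ne_one h1
  obtain ⟨p, hp⟩ : ∃ p, S.card = p + 1 := ⟨S.card - 1, (Nat.sub_add_cancel hS.card_pos).symm⟩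
  let e := S.orderEmbOfFin hp
  have hsum : ∑ x, t (e x) = 1 := by
    rw [← stdSimplex.sum_eq_one t]
    refine Eq.trans ?_ (Finset.sum_filter_ne_zero (f := fun k => t k) Finset.univ)
    have : Finset.univ.map e.toEmbedding = S := by
      ext k
      have := Finset.range_orderEmbOfFin S hp
      constructor
      · intro hk
        obtain ⟨x, -, rfl⟩ := Finset.mem_map.1 hk
        exact Finset.orderEmbOfFin_mem S hp x
      · intro hk
        have : k ∈ range e := by
          rw [this]
          exact hk
        obtain ⟨x, rfl⟩ := this
        exact Finset.mem_map.2 ⟨x, Finset.mem_univ _, rfl⟩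
    change _ = ∑ k ∈ S, t k
    rw [← this, Finset.sum_map]
    rfl
  let ε : ⦋p⦌ ⟶ ⦋n⦌ := SimplexCategory.mkHom e.toOrderHom
  have hε : Mono ε := SimplexCategory.mono_iff_injective.2 e.injective
  let w : TopSimplex p := ⟨fun x => t (e x), fun x => stdSimplex.zero_le t _, hsum⟩
  refine ⟨p, ε, hε, w, fun x => ?_, ?_⟩
  · exact lt_of_le_of_ne (stdSimplex.zero_le t _)
      (Ne.symm (Finset.mem_filter.1 (Finset.orderEmbOfFin_mem S hp x)).2)
  · refine Subtype.ext (funext fun y => ?_)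
    change map ε w y = t y
    by_cases hy : y ∈ S
    · have : y ∈ range e := by
        rw [Finset.range_orderEmbOfFin S hp]
        exact hy
      obtain ⟨x, rfl⟩ := this
      exact map_apply_apply ε w x
    · have h0 : t y = 0 := by
        by_contra h
        exact hy (Finset.mem_filter.2 ⟨Finset.mem_univ _, h⟩)
      rw [h0, map_apply_eq_zero]
      intro x hx
      exact hy (hx ▸ Finset.orderEmbOfFin_mem S hp x)

/-- The smallest face containing a point lies in every face containing it, which makes values
prescribed face by face well defined. -/
theorem exists_factor (δ : ⦋m⦌ ⟶ ⦋n⦌) [hδ : Mono δ] (ε : ⦋p⦌ ⟶ ⦋n⦌) [Mono ε] {t : TopSimplex m}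
    {w : TopSimplex p} (hw : ∀ x, 0 < w x) (h : map δ t = map ε w) :
    ∃ ε' : ⦋p⦌ ⟶ ⦋m⦌, ε' ≫ δ = ε ∧ map ε' w = t := by
  have hy : ∀ x : Fin (p + 1), ∃ y : Fin (m + 1), δ y = ε x := by
    intro x
    by_contra! hy
    have h1 := map_apply_eq_zero δ t hy
    rw [h, map_apply_apply] at h1
    exact (hw x).ne' h1
  choose y hy using hy
  have hinj := SimplexCategory.mono_iff_injective.1 hδ
  have hsm : StrictMono δ.toOrderHom := δ.toOrderHom.monotone.strictMono_of_injective hinj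
  let ε' : ⦋p⦌ ⟶ ⦋m⦌ := SimplexCategory.mkHom ⟨y, fun a b hab => by
    rw [← hsm.le_iff_le]
    exact ((hy a).le.trans (ε.toOrderHom.monotone hab)).trans (hy b).ge⟩
  have h1 : ε' ≫ δ = ε := by
    ext x : 3
    exact hy x
  refine ⟨ε', h1, map_injective δ ?_⟩
  rw [← map_comp, h1, h]

theorem lt_of_mem_bd {t : TopSimplex n} (ht : t ∈ bd n) (ε : ⦋p⦌ ⟶ ⦋n⦌) [hε : Mono ε]
    {w : TopSimplex p} (hw : ∀ x, 0 < w x) (h : map ε w = t) : p < n := by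
  refine lt_of_le_of_ne (SimplexCategory.len_le_of_mono ε) ?_
  rintro rfl
  obtain rfl := SimplexCategory.eq_id_of_mono ε
  rw [map_id] at h
  obtain ⟨k, hk⟩ := ht
  exact (hw k).ne' (h ▸ hk)

theorem map_mem_bd (δ : ⦋m⦌ ⟶ ⦋n⦌) (hm : m < n) (t : TopSimplex m) : map δ t ∈ bd n := by
  have : ¬ Function.Surjective δ.toOrderHom := fun hs => by
    have := Fintype.card_le_of_surjective _ hs
    simp at this
    omega
  obtain ⟨y, hy⟩ := not_forall.1 this
  exact ⟨y, map_apply_eq_zero δ t fun x hx => hy ⟨x, hx⟩⟩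

/-- The boundary is covered by finitely many closed faces, and `P × Δ^m → P × (face)` is a quotient
map by compactness. -/
theorem continuousOn_bd {P Y : Type*} [TopologicalSpace P] [CompactSpace P] [T2Space P]
    [TopologicalSpace Y] {f : P → TopSimplex n → Y}
    (hf : ∀ (m : ℕ) (δ : ⦋m⦌ ⟶ ⦋n⦌) [Mono δ], m < n →
      Continuous fun z : P × TopSimplex m => f z.1 (map δ z.2)) :
    ContinuousOn (fun z : P × TopSimplex n => f z.1 z.2) (univ ×ˢ bd n) := by
  let ι := Σ m : Fin n, {δ : ⦋m.1⦌ ⟶ ⦋n⦌ // Mono δ}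
  have hfin : Finite ι := by
    have : ∀ m : ℕ, Finite (⦋m⦌ ⟶ ⦋n⦌) := fun m =>
      Finite.of_injective (fun δ => (δ.toOrderHom : Fin (m + 1) → Fin (n + 1))) fun δ ε h => by
        ext x : 3
        exact congrFun h x
    infer_instance
  have := Fintype.ofFinite ι
  have h := continuousOn_biUnion_finset (f := fun z : P × TopSimplex n => f z.1 z.2)
    (Finset.univ : Finset ι) (fun δ => univ ×ˢ range (map δ.2.1))
    (fun δ _ => isClosed_univ.prod (isCompact_range (continuous_map δ.2.1)).isClosed)
    (fun δ _ => by
      have := δ.2.2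
      let q : P × TopSimplex δ.1 → (univ ×ˢ range (map δ.2.1) : Set (P × TopSimplex n)) := fun z =>
        ⟨(z.1, map δ.2.1 z.2), trivial, z.2, rfl⟩
      have hq : Continuous q := (continuous_fst.prodMk
        ((continuous_map δ.2.1).comp continuous_snd)).subtype_mk _
      have hs : Function.Surjective q := by
        rintro ⟨⟨v, y⟩, -, x, hx⟩
        exact ⟨(v, x), Subtype.ext (Prod.ext rfl hx)⟩
      rw [continuousOn_iff_continuous_domRestrict]
      exact (hq.isClosedMap.isQuotientMap hq hs).continuous_iff.2 (hf _ δ.2.1 δ.1.2))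
  refine h.mono ?_
  rintro ⟨v, t⟩ ⟨-, ht⟩
  obtain ⟨p, ε, hε, w, hw, he⟩ := exists_support t
  refine mem_iUnion₂.2 ⟨⟨⟨p, lt_of_mem_bd ht ε hw he⟩, ε, hε⟩, Finset.mem_univ _, trivial, w, he⟩

end TopSimplex

end TopSimplex

/-! ## Maps out of regular simplicial sets -/

section SSet

open scoped Simplicial
open Opposite

theorem SSet.hom_ext_nonDegenerate {Z W : SSet.{u}} {F F' : Z ⟶ W}
    (h : ∀ n, ∀ z ∈ Z.nonDegenerate n, F.app (op ⦋n⦌) z = F'.app (op ⦋n⦌) z) : F = F' := by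
  ext ⟨n⟩ x
  induction n using SimplexCategory.rec with | _ n =>
  obtain ⟨m, f, _, y, rfl⟩ := Z.exists_nonDegenerate x
  have h1 := ConcreteCategory.congr_hom (F.naturality f.op) y.1
  have h2 := ConcreteCategory.congr_hom (F'.naturality f.op) y.1
  exact h1.trans ((congrArg (W.map f.op) (h m y.1 y.2)).trans h2.symm)

/-- By the Eilenberg–Zilber lemma every simplex is uniquely a degeneracy of a nondegenerate one,
which determines the map. As faces of nondegenerate simplices stay nondegenerate, compatibility with
injective operators is all that must be assumed. -/
theorem SSet.exists_hom_of_nonDegenerate {Z W : SSet.{u}}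
    (hZ : ∀ {m n : ℕ} (δ : ⦋m⦌ ⟶ ⦋n⦌) [Mono δ], ∀ z ∈ Z.nonDegenerate n,
      Z.map δ.op z ∈ Z.nonDegenerate m)
    (e : ∀ n, Z.obj (op ⦋n⦌) → W.obj (op ⦋n⦌))
    (he : ∀ {m n : ℕ} (δ : ⦋m⦌ ⟶ ⦋n⦌) [Mono δ], ∀ z ∈ Z.nonDegenerate n,
      e m (Z.map δ.op z) = W.map δ.op (e n z)) :
    ∃ F : Z ⟶ W, ∀ n, ∀ z ∈ Z.nonDegenerate n, F.app (op ⦋n⦌) z = e n z := by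
  choose d f hf y hy using fun (n : ℕ) (x : Z.obj (op ⦋n⦌)) => Z.exists_nonDegenerate x
  let F : ∀ n : ℕ, Z.obj (op ⦋n⦌) → W.obj (op ⦋n⦌) := fun n x => W.map (f n x).op (e _ (y n x).1)
  have key : ∀ {n m : ℕ} (x : Z.obj (op ⦋n⦌)) (g : ⦋n⦌ ⟶ ⦋m⦌) (_ : Epi g)
      (z : Z.nonDegenerate m), x = Z.map g.op z.1 → F n x = W.map g.op (e m z.1) := by
    intro n m x g hg z hz
    have := hf n x
    have hd := Z.unique_nonDegenerate_dim x (f n x) (y n x) (hy n x) g z hz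
    subst hd
    have h1 := Z.unique_nonDegenerate_simplex x (f n x) (y n x) (hy n x) g z hz
    have h2 := Z.unique_nonDegenerate_map x (f n x) (y n x) (hy n x) g z hz
    subst h2
    rw [← h1]
  have hF : ∀ {k n : ℕ} (θ : ⦋k⦌ ⟶ ⦋n⦌) (x : Z.obj (op ⦋n⦌)),
      F k (Z.map θ.op x) = W.map θ.op (F n x) := by
    intro k n θ x
    have hx := hy n x
    have := hf n x
    -- The composite operator is factored as a surjection followed by an injection; the face is
    -- nondegenerate by `hZ`, so this is the Eilenberg–Zilber decomposition of `Z.map θ.op x`.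
    generalize hθ : θ ≫ f n x = φ
    obtain ⟨p, π, ι, hπ, hι, rfl⟩ : ∃ (p : ℕ) (π : ⦋k⦌ ⟶ ⦋p⦌) (ι : ⦋p⦌ ⟶ ⦋d n x⦌), Epi π ∧ Mono ι ∧
        φ = π ≫ ι := by
      have h1 : Epi (Limits.factorThruImage φ) := inferInstance
      have h2 : Mono (Limits.image.ι φ) := inferInstance
      have h3 := Limits.image.fac φ
      revert h1 h2 h3
      generalize Limits.image.ι φ = ι
      generalize Limits.factorThruImage φ = π
      revert ι π
      generalize Limits.image φ = p
      induction p using SimplexCategory.rec with | _ p =>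
      exact fun ι π h1 h2 h3 => ⟨p, π, ι, h1, h2, h3.symm⟩
    have h1 : Z.map θ.op x = Z.map π.op (Z.map ι.op (y n x).1) := by
      conv_lhs => rw [hx]
      have : ∀ {q : ℕ} (α : ⦋k⦌ ⟶ ⦋q⦌) (β : ⦋q⦌ ⟶ ⦋d n x⦌), Z.map α.op (Z.map β.op (y n x).1) =
          Z.map (α ≫ β).op (y n x).1 := fun α β => by
        rw [op_comp, Z.map_comp]
        rfl
      rw [this, this, hθ]
    have h2 : ∀ {q : ℕ} (α : ⦋k⦌ ⟶ ⦋q⦌) (β : ⦋q⦌ ⟶ ⦋d n x⦌) (w : W.obj (op ⦋d n x⦌)),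
        W.map α.op (W.map β.op w) = W.map (α ≫ β).op w := fun α β w => by
      rw [op_comp, W.map_comp]
      rfl
    rw [key _ π hπ ⟨_, hZ ι _ (y n x).2⟩ h1, he ι _ (y n x).2, h2, ← hθ, ← h2]
  refine ⟨{ app := fun n => ↾(fun x => F n.unop.len x), naturality := fun n m θ => ?_ },
    fun n z hz => ?_⟩
  · ext x
    exact hF θ.unop x
  · refine (key z (𝟙 _) inferInstance ⟨z, hz⟩ ?_).trans ?_
    · rw [op_id, Z.map_id]
      rfl
    · rw [op_id, W.map_id]
      rfl

theorem functor_eq_of_isIdentity {C D : Type*} [Category C] [Category D] {F H : C ⥤ D} (η : F ⟶ H)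
    (h : ∀ x, IsIdentity (η.app x)) : F = H := by
  refine CategoryTheory.Functor.ext (fun x => (h x).1) fun x y f => ?_
  have h1 := η.naturality f
  rw [(h x).2, (h y).2] at h1
  rw [← reassoc_of% h1]
  simp

/-- If the `k`-th arrow is an identity, dropping its target and repeating its source recovers `F`,
so `F` is a degeneracy. -/
theorem not_isIdentity_of_nonDegenerate {C : Type u} [Category.{u} C] {m : ℕ}
    {F : ComposableArrows C m}
    (hF : (F : (nerve C).obj (op ⦋m⦌)) ∈ (nerve C).nonDegenerate m) (k : Fin m) :
    ¬ IsIdentity (F.map (homOfLE (Fin.castSucc_le_succ k))) := by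
  intro hk
  obtain _ | m := m
  · exact k.elim0
  have hle : ∀ l, k.succ.succAbove (k.predAbove l) ≤ l := fun l => by
    by_cases hl : l = k.succ
    · subst hl
      rw [Fin.predAbove_succ_self, Fin.succAbove_succ_self]
      exact Fin.castSucc_le_succ k
    · rw [Fin.succ_succAbove_predAbove hl]
  let θ : Fin (m + 1 + 1) ⥤ Fin (m + 1 + 1) :=
    (SimplexCategory.toCat.map (SimplexCategory.σ k ≫ SimplexCategory.δ k.succ)).toFunctor
  have hθ : ∀ l, θ.obj l ≤ l := hle
  let η : θ ⋙ F ⟶ F :=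
    { app := fun l => F.map (homOfLE (hθ l))
      naturality := fun l l' f => by
        change F.map _ ≫ F.map _ = F.map _ ≫ F.map _
        rw [← F.map_comp, ← F.map_comp]
        rfl }
  have hη : ∀ l, IsIdentity (η.app l) := by
    intro l
    by_cases hl : l = k.succ
    · subst hl
      have e : θ.obj k.succ = k.castSucc := by
        change k.succ.succAbove (k.predAbove k.succ) = _
        rw [Fin.predAbove_succ_self, Fin.succAbove_succ_self]
      obtain ⟨h1, h2⟩ := hk
      refine ⟨(congrArg F.obj e).trans h1, ?_⟩
      have : homOfLE (hθ k.succ) = eqToHom e ≫ homOfLE (Fin.castSucc_le_succ k) :=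
        Subsingleton.elim _ _
      change F.map _ = _
      rw [this, F.map_comp, h2, eqToHom_map, eqToHom_trans]
    · have e : θ.obj l = l := Fin.succ_succAbove_predAbove hl
      refine ⟨congrArg F.obj e, ?_⟩
      exact (congrArg F.map (Subsingleton.elim _ (eqToHom e))).trans (eqToHom_map F e)
  have h : θ ⋙ F = F := functor_eq_of_isIdentity η hη
  refine hF ?_
  rw [← h]
  exact (nerve C).σ_mem_degenerate k ((nerve C).δ k.succ F)

end SSet

/-! ## Chains of morphisms -/

section Chain

open scoped Simplicial
open Opposite

theorem isIdentity_of_left {C : Type*} [Category C] {i : C} {x y : Over i} {f : x ⟶ y}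
    (h : IsIdentity f.left) : IsIdentity f := by
  obtain ⟨x, ⟨⟨⟩⟩, p⟩ := x
  obtain ⟨y, ⟨⟨⟩⟩, q⟩ := y
  obtain ⟨e, he⟩ := h
  change x = y at e
  subst e
  have hw := Over.w f
  rw [he] at hw
  have hpq : q = p := by simpa using hw
  subst hpq
  exact ⟨rfl, Over.OverMorphism.ext he⟩

variable {G : Type u} [Group G] {a : SingleObj G ⥤ Cat.{u, u}}
  (hfin : ∀ i : Idx a, ∃ d : ℕ, (nerve (Over i)).HasDimensionLT d)

/-- The degrees in a chain are strictly increasing. -/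
def IsStrict {n : ℕ} (c : ComposableArrows (Idx a) n) : Prop :=
  StrictMono fun k => deg hfin (c.obj k)

variable {hfin}

/-- Nondegenerate means that no arrow is an identity, and non-identities are precisely the arrows
that raise the degree. This form of nondegeneracy is visibly inherited by faces. -/
theorem isStrict_iff_nonDegenerate {i : Idx a} {n : ℕ} (w : ComposableArrows (Over i) n) :
    IsStrict hfin (w ⋙ Over.forget i) ↔
      (w : (nerve (Over i)).obj (op ⦋n⦌)) ∈ (nerve (Over i)).nonDegenerate n := by
  constructor
  · intro h
    refine not_isIdentity_nonDegenerate w fun k hk => ?_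
    obtain ⟨e, -⟩ := hk.left
    exact (h (Fin.castSucc_lt_succ (i := k))).ne (congrArg (deg hfin) e)
  · intro h
    have hk := not_isIdentity_of_nonDegenerate h
    obtain _ | n := n
    · intro p q h
      exact absurd h (by omega)
    · rw [IsStrict, Fin.strictMono_iff_lt_succ]
      intro k
      exact deg_lt hfin (w.map (homOfLE (Fin.castSucc_le_succ k))).left
        fun e => hk k (isIdentity_of_left e)

/-- The restriction of a chain. -/
def pull {m n : ℕ} (δ : ⦋m⦌ ⟶ ⦋n⦌) (c : ComposableArrows (Idx a) n) : ComposableArrows (Idx a) m :=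
  (nerve (Idx a)).map δ.op c

theorem IsStrict.pull {m n : ℕ} (δ : ⦋m⦌ ⟶ ⦋n⦌) [hδ : Mono δ] {c : ComposableArrows (Idx a) n}
    (hc : IsStrict hfin c) : IsStrict hfin (pull δ c) := by
  have hinj := SimplexCategory.mono_iff_injective.1 hδ
  exact hc.comp (δ.toOrderHom.monotone.strictMono_of_injective hinj)

/-- The last object of a chain. -/
abbrev top {n : ℕ} (c : ComposableArrows (Idx a) n) : Idx a := c.obj (Fin.last n)

/-- The map from the last object of a restriction. -/
def topMap {m n : ℕ} (δ : ⦋m⦌ ⟶ ⦋n⦌) (c : ComposableArrows (Idx a) n) : top (pull δ c) ⟶ top c :=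
  c.map (homOfLE (Fin.le_last (δ.toOrderHom (Fin.last m))))

/-- A chain as a chain over its last object. -/
def liftChain {n : ℕ} (c : ComposableArrows (Idx a) n) : ComposableArrows (Over (top c)) n where
  obj k := Over.mk (c.map (homOfLE (Fin.le_last k)))
  map f := Over.homMk (c.map f) (by
    change c.map _ ≫ c.map _ = c.map _
    rw [← c.map_comp]
    rfl)

/-- A chain over `i` is the push-forward of the chain over its own last object along the last
structure map. By naturality, only chains over their last objects need to be considered. -/
theorem eq_liftChain {i : Idx a} {n : ℕ} (w : ComposableArrows (Over i) n) :
    liftChain (w ⋙ Over.forget i) ⋙ Over.map (w.obj (Fin.last n)).hom = w := by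
  have h : ∀ k, (w.map (homOfLE (Fin.le_last k))).left ≫ (w.obj (Fin.last n)).hom = (w.obj k).hom :=
    fun k => Over.w _
  refine functor_eq_of_isIdentity
    { app := fun k => Over.homMk (𝟙 (w.obj k).left) ((Category.id_comp _).trans (h k).symm)
      naturality := fun k l f => ?_ } fun k => isIdentity_of_left ⟨rfl, rfl⟩
  ext
  exact (Category.comp_id _).trans (Category.id_comp _).symm

instance (n : ℕ) : MulAction G (ComposableArrows (Idx a) n) where
  smul g c := c ⋙ act a g
  one_smul c := by
    change c ⋙ act a 1 = c
    rw [act_one]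
    rfl
  mul_smul h g c := by
    change c ⋙ act a (h * g) = (c ⋙ act a g) ⋙ act a h
    rw [act_mul]
    rfl

theorem smul_top {n : ℕ} {g : G} {c c' : ComposableArrows (Idx a) n} (h : g • c = c') :
    g • top c = top c' := congrArg top h

theorem smul_pull {m n : ℕ} (δ : ⦋m⦌ ⟶ ⦋n⦌) {g : G} {c c' : ComposableArrows (Idx a) n}
    (h : g • c = c') : g • pull δ c = pull δ c' := congrArg (pull δ) h

theorem IsStrict.smul {n : ℕ} {c : ComposableArrows (Idx a) n} (hc : IsStrict hfin c) (g : G) :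
    IsStrict hfin (g • c) := fun k l hkl => by
  change deg hfin (g • c.obj k) < deg hfin (g • c.obj l)
  rw [deg_smul, deg_smul]
  exact hc hkl

theorem nerveOver_tr_liftChain {n : ℕ} {g : G} {c c' : ComposableArrows (Idx a) n} (h : g • c = c') :
    ((nerveOver a).tr g (smul_top h)).app (op ⦋n⦌) (liftChain c) = liftChain c' := by
  subst h
  have : (nerveOver a).tr g (i := top c) rfl = ((nerveOver a).φ g).app (top c) := by
    rw [GDiagram.tr]
    simp
  exact congrArg (fun f : (nerveOver a).functor.obj (top c) ⟶ (nerveOver a).functor.obj (g • top c) =>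
    f.app (op ⦋n⦌) (liftChain c)) this

theorem nerve_map_liftChain {m n : ℕ} (δ : ⦋m⦌ ⟶ ⦋n⦌) (c : ComposableArrows (Idx a) n) :
    (nerve (Over (top c))).map δ.op (liftChain c) =
      ((nerveOver a).functor.map (topMap δ c)).app (op ⦋m⦌) (liftChain (pull δ c)) :=
  (eq_liftChain (i := top c) ((nerve (Over (top c))).map δ.op (liftChain c))).symm

end Chain

/-! ## Families of maps indexed by chains -/

section ChainFamily

open scoped Simplicial

variable {G : Type u} [Group G] {a : SingleObj G ⥤ Cat.{u, u}}
  {hfin : ∀ i : Idx a, ∃ d : ℕ, (nerve (Over i)).HasDimensionLT d}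
  {X : GDiagram a TopCat.{u}} {k : ℕ}

theorem GDiagram.tr_tr_apply (X : GDiagram a TopCat.{u}) {g g' : G} {i j l : Idx a} (h : g • i = j)
    (h' : g' • j = l) (x : X.functor.obj i) :
    X.tr g' h' (X.tr g h x) = X.tr (g' * g) (by rw [mul_smul, h, h']) x :=
  ConcreteCategory.congr_hom (X.tr_comp h h') x

theorem topMap_comp {m n p : ℕ} (ε : ⦋p⦌ ⟶ ⦋m⦌) (δ : ⦋m⦌ ⟶ ⦋n⦌) (c : ComposableArrows (Idx a) n) :
    topMap ε (pull δ c) ≫ topMap δ c = topMap (ε ≫ δ) c :=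
  (c.map_comp _ _).symm

theorem GDiagram.map_topMap_tr (X : GDiagram a TopCat.{u}) {m n : ℕ} (δ : ⦋m⦌ ⟶ ⦋n⦌) {g : G}
    {c c' : ComposableArrows (Idx a) n} (h : g • c = c') (x : X.functor.obj (top (pull δ c))) :
    X.tr g (smul_top h) (X.functor.map (topMap δ c) x) =
      X.functor.map (topMap δ c') (X.tr g (smul_top (smul_pull δ h)) x) := by
  subst h
  have h1 := X.map_tr g (topMap δ c) (j := top (pull δ (g • c))) (j' := top (g • c)) rfl rfl
  have e : eqToHom rfl ≫ (act a g).map (topMap δ c) ≫ eqToHom rfl = topMap δ (g • c) :=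
    (Category.id_comp _).trans (Category.comp_id _)
  exact (ConcreteCategory.congr_hom h1 x).trans
    (congrArg (fun f : top (pull δ (g • c)) ⟶ top (g • c) => X.functor.map f (X.tr g rfl x)) e)

variable (X k) in
/-- A family of maps indexed by chains. -/
abbrev ChainFamily : Type u := ∀ (n : ℕ) (c : ComposableArrows (Idx a) n),
  Ball (k + 1) → TopSimplex n → X.functor.obj (top c)

/-- A compatible family on the boundary of the ball. -/
structure ChainFamily.IsBoundary (ψ : ChainFamily X k) : Prop where
  continuousOn {n : ℕ} (c : ComposableArrows (Idx a) n) :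
    ContinuousOn (fun z : Ball (k + 1) × TopSimplex n => ψ n c z.1 z.2) (Ball.bd (k + 1) ×ˢ univ)
  map {m n : ℕ} (δ : ⦋m⦌ ⟶ ⦋n⦌) (c : ComposableArrows (Idx a) n) (v) (hv : v ∈ Ball.bd (k + 1)) (t) :
    ψ n c v (TopSimplex.map δ t) = X.functor.map (topMap δ c) (ψ m (pull δ c) v t)
  smul {n : ℕ} {g : G} {c c' : ComposableArrows (Idx a) n} (h : g • c = c') (v)
    (hv : v ∈ Ball.bd (k + 1)) (t) : ψ n c' v t = X.tr g (smul_top h) (ψ n c v t)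

variable (hfin) in
/-- A compatible family on the strict chains of length less than `N`, extending `ψ`. -/
structure ChainFamily.IsExtension (ψ : ChainFamily X k) (N : ℕ) (E : ChainFamily X k) : Prop where
  continuous {n : ℕ} (hn : n < N) {c : ComposableArrows (Idx a) n} (hc : IsStrict hfin c) :
    Continuous fun z : Ball (k + 1) × TopSimplex n => E n c z.1 z.2
  bd {n : ℕ} (hn : n < N) {c : ComposableArrows (Idx a) n} (hc : IsStrict hfin c) (v)
    (hv : v ∈ Ball.bd (k + 1)) (t) : E n c v t = ψ n c v t
  map {m n : ℕ} (hn : n < N) (δ : ⦋m⦌ ⟶ ⦋n⦌) [Mono δ] (hm : m < n) {c : ComposableArrows (Idx a) n}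
    (hc : IsStrict hfin c) (v t) :
    E n c v (TopSimplex.map δ t) = X.functor.map (topMap δ c) (E m (pull δ c) v t)
  smul {n : ℕ} (hn : n < N) {g : G} {c c' : ComposableArrows (Idx a) n} (h : g • c = c')
    (hc : IsStrict hfin c) (v t) : E n c' v t = X.tr g (smul_top h) (E n c v t)

theorem ChainFamily.IsExtension.map_of_mono {ψ E : ChainFamily X k} {N m n : ℕ}
    (hE : IsExtension hfin ψ N E) (hn : n < N) (δ : ⦋m⦌ ⟶ ⦋n⦌) [Mono δ]
    {c : ComposableArrows (Idx a) n} (hc : IsStrict hfin c) (v t) :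
    E n c v (TopSimplex.map δ t) = X.functor.map (topMap δ c) (E m (pull δ c) v t) := by
  obtain hm | rfl := (SimplexCategory.len_le_of_mono δ).lt_or_eq
  · exact hE.map hn δ hm hc v t
  · obtain rfl := SimplexCategory.eq_id_of_mono δ
    rw [TopSimplex.map_id]
    have e : topMap (𝟙 _) c = 𝟙 (top c) := c.map_id _
    exact ((congrArg (fun f : top c ⟶ top c => X.functor.map f (E _ c v t)) e).trans
      (map_id_apply _ _)).symm

/-- An element that fixes the chain fixes its last object and the corresponding nondegenerate
`n`-simplex over it, so `n` is at most the dimension of the fixed simplicial set. -/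
theorem isNConnected_fixed_of_isStrict
    (hX : ∀ (i : Idx a) (H : Subgroup (Stab a i)), intToEReal k ≤
      connSub (conn (X.Fixed i H)) (simplicialDim ((nerveOver a).fixedSubcomplex i H)))
    {n : ℕ} {c : ComposableArrows (Idx a) n} (hc : IsStrict hfin c) :
    IsNConnected (k + n) (X.Fixed (top c)
      ((MulAction.stabilizer G c).subgroupOf (Stab a (top c)))) := by
  refine isNConnected_of_le_connSub (hX _ _) ?_
  let H := (MulAction.stabilizer G c).subgroupOf (Stab a (top c))
  let w : ((nerveOver a).fixedSubcomplex (top c) H : SSet.{u}).obj (Opposite.op ⦋n⦌) :=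
    ⟨liftChain c, fun γ hγ => nerveOver_tr_liftChain hγ⟩
  exact le_iSup₂_of_le n ⟨w, (SSet.Subcomplex.mem_nonDegenerate_iff _ w).2
    ((isStrict_iff_nonDegenerate (liftChain c)).1 hc)⟩ le_rfl

-- On the boundary of `Ball (k + 1) × Δ^n` the values are forced, by `ψ` and by the faces of the
-- chain. They are fixed by the stabilizer of the chain, so the extension exists in a `(k +
-- n)`-connected fixed point space.
open Classical in
theorem ChainFamily.IsExtension.exists_extension {ψ E : ChainFamily X k} {n : ℕ}
    (hψ : ψ.IsBoundary) (hE : IsExtension hfin ψ n E)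
    (hX : ∀ (i : Idx a) (H : Subgroup (Stab a i)), intToEReal k ≤
      connSub (conn (X.Fixed i H)) (simplicialDim ((nerveOver a).fixedSubcomplex i H)))
    (c : ComposableArrows (Idx a) n) (hc : IsStrict hfin c) :
    ∃ L : Ball (k + 1) → TopSimplex n → X.functor.obj (top c),
      (Continuous fun z : Ball (k + 1) × TopSimplex n => L z.1 z.2) ∧
      (∀ v ∈ Ball.bd (k + 1), ∀ t, L v t = ψ n c v t) ∧
      (∀ (m : ℕ) (δ : ⦋m⦌ ⟶ ⦋n⦌) [Mono δ], m < n → ∀ v t,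
        L v (TopSimplex.map δ t) = X.functor.map (topMap δ c) (E m (pull δ c) v t)) ∧
      ∀ (g : G) (h : g • c = c) v t, X.tr g (smul_top h) (L v t) = L v t := by
  -- For `v` inside the ball the prescribed value at `t` is read off on the smallest face containing
  -- `t`; consistency with larger proper faces follows from `exists_factor`.
  choose p ε hε w hw hεw using TopSimplex.exists_support (n := n)
  let B : Ball (k + 1) → TopSimplex n → X.functor.obj (top c) := fun v t =>
    if v ∈ Ball.bd (k + 1) then ψ n c v t
    else X.functor.map (topMap (ε t) c) (E (p t) (pull (ε t) c) v (w t))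
  have hB1 : ∀ v ∈ Ball.bd (k + 1), ∀ t, B v t = ψ n c v t := fun v hv t => if_pos hv
  have hB2 : ∀ (m : ℕ) (δ : ⦋m⦌ ⟶ ⦋n⦌) [Mono δ], m < n → ∀ v t,
      B v (TopSimplex.map δ t) = X.functor.map (topMap δ c) (E m (pull δ c) v t) := by
    intro m δ hδ hm v t
    by_cases hv : v ∈ Ball.bd (k + 1)
    · rw [hB1 v hv, hψ.map δ c v hv, hE.bd hm (hc.pull δ) v hv]
    · refine (if_neg hv).trans ?_
      have hlt := TopSimplex.lt_of_mem_bd (TopSimplex.map_mem_bd δ hm t)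
        (ε (TopSimplex.map δ t)) (hw _) (hεw _)
      have hm1 := hε (TopSimplex.map δ t)
      have hw1 := hw (TopSimplex.map δ t)
      have he1 := hεw (TopSimplex.map δ t)
      revert hlt hm1 hw1 he1
      generalize w (TopSimplex.map δ t) = w'
      generalize ε (TopSimplex.map δ t) = ε₁
      revert w' ε₁
      generalize p (TopSimplex.map δ t) = q
      intro w' ε₁ hlt hm1 hw1 he1
      obtain ⟨ε', rfl, rfl⟩ := TopSimplex.exists_factor δ ε₁ hw1 he1.symm
      have hm2 : Mono ε' := mono_of_mono ε' δ
      have e : X.functor.map (topMap (ε' ≫ δ) c) (E q (pull (ε' ≫ δ) c) v w') =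
          X.functor.map (topMap δ c) (X.functor.map (topMap ε' (pull δ c))
            (E q (pull ε' (pull δ c)) v w')) := by
        rw [← topMap_comp]
        exact map_comp_apply X.functor _ _ _
      exact e.trans (congrArg (X.functor.map (topMap δ c)) (hE.map_of_mono hm ε' (hc.pull δ) v w').symm)
  have hB3 : ∀ (g : G) (h : g • c = c) v t, (v, t) ∈ bdProd (Ball.bd (k + 1)) (TopSimplex.bd n) →
      X.tr g (smul_top h) (B v t) = B v t := by
    intro g h v t hvt
    by_cases hv : v ∈ Ball.bd (k + 1)
    · rw [hB1 v hv, ← hψ.smul h v hv]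
    · have ht : t ∈ TopSimplex.bd n := hvt.resolve_left hv
      have hlt := TopSimplex.lt_of_mem_bd ht (ε t) (hw _) (hεw _)
      simp only [B, if_neg hv]
      have := hε t
      rw [X.map_topMap_tr (ε t) h, ← hE.smul hlt (smul_pull (ε t) h) (hc.pull (ε t))]
  have hBc : ContinuousOn (fun z : Ball (k + 1) × TopSimplex n => B z.1 z.2)
      (bdProd (Ball.bd (k + 1)) (TopSimplex.bd n)) := by
    have h1 : ContinuousOn (fun z : Ball (k + 1) × TopSimplex n => B z.1 z.2)
        (Ball.bd (k + 1) ×ˢ univ) := (hψ.continuousOn c).congr fun z hz => hB1 z.1 hz.1 z.2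
    have h2 : ContinuousOn (fun z : Ball (k + 1) × TopSimplex n => B z.1 z.2)
        (univ ×ˢ TopSimplex.bd n) := TopSimplex.continuousOn_bd fun m δ hδ hm => by
      simp only [hB2 m δ hm]
      exact (X.functor.map (topMap δ c)).hom.continuous.comp (hE.continuous hm (hc.pull δ))
    have h3 := h1.union_of_isClosed h2 ((Ball.isClosed_bd _).prod isClosed_univ)
      (isClosed_univ.prod (TopSimplex.isClosed_bd n))
    refine h3.mono ?_
    rintro z (hz | hz)
    · exact Or.inl ⟨hz, trivial⟩
    · exact Or.inr ⟨trivial, hz⟩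
  have hconn := isNConnected_fixed_of_isStrict hX hc
  -- `k + n ≥ 0`, so the fixed point space is nonempty; `y₀` only fills in values off the boundary.
  obtain ⟨y₀⟩ := hconn.1 (by omega)
  let f : Ball (k + 1) × TopSimplex n → X.Fixed (top c)
      ((MulAction.stabilizer G c).subgroupOf (Stab a (top c))) := fun z =>
    if h : z ∈ bdProd (Ball.bd (k + 1)) (TopSimplex.bd n) then
      ⟨B z.1 z.2, fun γ => hB3 γ.1.1 γ.2 z.1 z.2 h⟩ else y₀
  have hf : ∀ z ∈ bdProd (Ball.bd (k + 1)) (TopSimplex.bd n), (f z).1 = B z.1 z.2 := fun z hz => by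
    simp only [f, dif_pos hz]
  obtain ⟨F, hF, hFf⟩ := TopSimplex.pairExt hconn (k := k) (n := n) (by push_cast; rfl) f
    (IsInducing.subtypeVal.continuousOn_iff.2 (hBc.congr hf))
  have hF' : ∀ v t, (v, t) ∈ bdProd (Ball.bd (k + 1)) (TopSimplex.bd n) →
      (F (v, t)).1 = B v t := fun v t h => (congrArg Subtype.val (hFf h)).trans (hf _ h)
  refine ⟨fun v t => (F (v, t)).1, continuous_subtype_val.comp hF, fun v hv t => ?_,
    fun m δ hδ hm v t => ?_, fun g h v t => ?_⟩
  · exact (hF' v t (Or.inl hv)).trans (hB1 v hv t)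
  · exact (hF' v _ (Or.inr (TopSimplex.map_mem_bd δ hm t))).trans (hB2 m δ hm v t)
  · exact (F (v, t)).2 ⟨⟨g, smul_top h⟩, h⟩

/-- The extension is chosen on one chain per `G`-orbit and translated; it is well defined because
the values are fixed by the stabilizer of the representative. -/
theorem ChainFamily.IsExtension.exists_succ {ψ E : ChainFamily X k} {n : ℕ}
    (hψ : ψ.IsBoundary) (hE : IsExtension hfin ψ n E)
    (hX : ∀ (i : Idx a) (H : Subgroup (Stab a i)), intToEReal k ≤
      connSub (conn (X.Fixed i H)) (simplicialDim ((nerveOver a).fixedSubcomplex i H))) :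
    ∃ E', IsExtension hfin ψ (n + 1) E' ∧ ∀ m < n, E' m = E m := by
  have hex : ∀ c : ComposableArrows (Idx a) n,
      ∃ L : Ball (k + 1) → TopSimplex n → X.functor.obj (top c), IsStrict hfin c →
      (Continuous fun z : Ball (k + 1) × TopSimplex n => L z.1 z.2) ∧
      (∀ v ∈ Ball.bd (k + 1), ∀ t, L v t = ψ n c v t) ∧
      (∀ (m : ℕ) (δ : ⦋m⦌ ⟶ ⦋n⦌) [Mono δ], m < n → ∀ v t,
        L v (TopSimplex.map δ t) = X.functor.map (topMap δ c) (E m (pull δ c) v t)) ∧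
      ∀ (g : G) (h : g • c = c) v t, X.tr g (smul_top h) (L v t) = L v t := by
    intro c
    by_cases hc : IsStrict hfin c
    · obtain ⟨L, hL⟩ := hE.exists_extension hψ hX c hc
      exact ⟨L, fun _ => hL⟩
    · exact ⟨E n c, fun h => (hc h).elim⟩
  choose L hL using hex
  let rep : ComposableArrows (Idx a) n → ComposableArrows (Idx a) n := fun c =>
    (Quotient.mk (MulAction.orbitRel G (ComposableArrows (Idx a) n)) c).out
  have hrep : ∀ c, ∃ g : G, g • rep c = c := fun c =>
    (MulAction.orbitRel G (ComposableArrows (Idx a) n)).symm (Quotient.mk_out c)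
  have hrepg : ∀ (g : G) {c c'}, g • c = c' → rep c' = rep c := fun g c c' h =>
    congrArg Quotient.out
      (Quotient.sound (s := MulAction.orbitRel G (ComposableArrows (Idx a) n)) ⟨g, h⟩)
  choose g hg using hrep
  have hg' : ∀ c, (g c)⁻¹ • c = rep c := fun c => by rw [inv_smul_eq_iff, hg]
  have hst : ∀ {c}, IsStrict hfin c → IsStrict hfin (rep c) := fun {c} hc => by
    rw [← hg' c]
    exact hc.smul _
  have hLr : ∀ {r r'} (_ : r' = r) (_ : IsStrict hfin r) (h : G) (e : h • r = r') v t,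
      X.tr h (smul_top e) (L r v t) = L r' v t := by
    rintro r _ rfl hr h e v t
    exact (hL _ hr).2.2.2 h e v t
  let E₁ : ∀ c : ComposableArrows (Idx a) n, Ball (k + 1) → TopSimplex n → X.functor.obj (top c) :=
    fun c v t => X.tr (g c) (smul_top (hg c)) (L (rep c) v t)
  let E' : ChainFamily X k := Function.update E n E₁
  have hn : E' n = E₁ := Function.update_self n E₁ E
  have hlt : ∀ m < n, E' m = E m := fun m hm => Function.update_of_ne hm.ne _ _
  refine ⟨E', ⟨fun {m} hm {c} hc => ?_, fun {m} hm {c} hc v hv t => ?_,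
    fun {m' m} hm δ _ hm' {c} hc v t => ?_, fun {m} hm {g₀ c c'} h hc v t => ?_⟩, hlt⟩
  · rcases Nat.lt_succ_iff_lt_or_eq.1 hm with hm | rfl
    · rw [hlt m hm]
      exact hE.continuous hm hc
    · rw [hn]
      exact (X.tr _ _).hom.continuous.comp (hL _ (hst hc)).1
  · rcases Nat.lt_succ_iff_lt_or_eq.1 hm with hm | rfl
    · rw [hlt m hm]
      exact hE.bd hm hc v hv t
    · rw [hn]
      simp only [E₁]
      rw [(hL _ (hst hc)).2.1 v hv, ← hψ.smul (hg c) v hv]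
  · rcases Nat.lt_succ_iff_lt_or_eq.1 hm with hm | rfl
    · rw [hlt m hm, hlt m' (hm'.trans hm)]
      exact hE.map hm δ hm' hc v t
    · rw [hn, hlt m' hm']
      simp only [E₁]
      rw [(hL _ (hst hc)).2.2.1 m' δ hm', X.map_topMap_tr δ (hg c),
        ← hE.smul hm' (smul_pull δ (hg c)) ((hst hc).pull δ)]
  · rcases Nat.lt_succ_iff_lt_or_eq.1 hm with hm | rfl
    · rw [hlt m hm]
      exact hE.smul hm h hc v t
    · rw [hn]
      simp only [E₁]
      have e : ((g c')⁻¹ * g₀ * g c) • rep c = rep c' := by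
        rw [mul_smul, mul_smul, hg, h, hg']
      rw [← hLr (hrepg g₀ h) (hst hc) _ e, X.tr_tr_apply, X.tr_tr_apply,
        X.tr_congr (show g c' * ((g c')⁻¹ * g₀ * g c) = g₀ * g c by group)]

theorem ChainFamily.IsBoundary.exists_extension
    (hfin : ∀ i : Idx a, ∃ d : ℕ, (nerve (Over i)).HasDimensionLT d) {ψ : ChainFamily X k}
    (hψ : ψ.IsBoundary)
    (hX : ∀ (i : Idx a) (H : Subgroup (Stab a i)), intToEReal k ≤
      connSub (conn (X.Fixed i H)) (simplicialDim ((nerveOver a).fixedSubcomplex i H))) :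
    ∃ E, ∀ N, IsExtension hfin ψ N E := by
  have h0 : IsExtension hfin ψ 0 ψ :=
    ⟨fun h => absurd h (Nat.not_lt_zero _), fun h => absurd h (Nat.not_lt_zero _),
      fun h => absurd h (Nat.not_lt_zero _), fun h => absurd h (Nat.not_lt_zero _)⟩
  choose step hstep hstep' using fun (n : ℕ) (E : {E // IsExtension hfin ψ n E}) =>
    E.2.exists_succ hψ hX
  let S : ∀ n, {E // IsExtension hfin ψ n E} := fun n =>
    Nat.rec ⟨_, h0⟩ (fun n E => ⟨step n E, hstep n E⟩) n
  have hS : ∀ n, ∀ m < n, (S (n + 1)).1 m = (S n).1 m := fun n => hstep' n (S n)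
  have hS' : ∀ n m, m < n → (S n).1 m = (S (m + 1)).1 m := by
    intro n m hm
    induction n, hm using Nat.le_induction with
    | base => rfl
    | succ n hn ih => rw [hS n m hn, ih]
  refine ⟨fun n => (S (n + 1)).1 n, fun N => ⟨fun {n} _ {c} hc => ?_, fun {n} _ {c} hc v hv t => ?_,
    fun {m n} _ δ _ hm {c} hc v t => ?_, fun {n} _ {g c c'} h hc v t => ?_⟩⟩
  · exact (S _).2.continuous (Nat.lt_succ_self _) hc
  · exact (S _).2.bd (Nat.lt_succ_self _) hc v hv t
  · have := (S (n + 1)).2.map (Nat.lt_succ_self _) δ hm hc v t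
    rwa [hS' (n + 1) m (hm.trans (Nat.lt_succ_self _))] at this
  · exact (S _).2.smul (Nat.lt_succ_self _) h hc v t

end ChainFamily

/-! ## Points of geometric realizations -/

section Realize

open scoped Simplicial
open Opposite

/-- The map from the topological simplex to the realization given by a simplex. -/
def realize (Z : SSet.{u}) {n : ℕ} (z : Z.obj (op ⦋n⦌)) : C(TopSimplex n, SSet.toTop.obj Z) :=
  (SSet.toTop.obj Z).toSSetObjEquiv (op ⦋n⦌) ((sSetTopAdj.unit.app Z).app (op ⦋n⦌) z)

theorem toTop_map_realize {Z W : SSet.{u}} (F : Z ⟶ W) {n : ℕ} (z : Z.obj (op ⦋n⦌))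
    (t : TopSimplex n) : SSet.toTop.map F (realize Z z t) = realize W (F.app (op ⦋n⦌) z) t := by
  have h := sSetTopAdj.unit.naturality F
  have h1 := ConcreteCategory.congr_hom (NatTrans.congr_app h (op ⦋n⦌)) z
  exact (congrArg (fun s => (SSet.toTop.obj W).toSSetObjEquiv (op ⦋n⦌) s t) h1).symm

theorem realize_map (Z : SSet.{u}) {m n : ℕ} (δ : ⦋m⦌ ⟶ ⦋n⦌) (z : Z.obj (op ⦋n⦌))
    (t : TopSimplex m) : realize Z (Z.map δ.op z) t = realize Z z (TopSimplex.map δ t) := by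
  have h1 := ConcreteCategory.congr_hom ((sSetTopAdj.unit.app Z).naturality δ.op) z
  exact (congrArg (fun s => (SSet.toTop.obj Z).toSSetObjEquiv (op ⦋m⦌) s t) h1).trans
    (TopCat.toSSetObjEquiv_naturality_apply δ _ t)

theorem toTop_desc_realize {Z : SSet.{u}} {Y : TopCat.{u}} (f : SSet.toTop.obj Z ⟶ Y) {n : ℕ}
    (z : Z.obj (op ⦋n⦌)) (t : TopSimplex n) : f (realize Z z t) =
      Y.toSSetObjEquiv (op ⦋n⦌) ((sSetTopAdj.homEquiv Z Y f).app (op ⦋n⦌) z) t := by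
  rw [Adjunction.homEquiv_unit]
  rfl

theorem toTop_hom_ext {Z : SSet.{u}} {Y : TopCat.{u}} {f f' : SSet.toTop.obj Z ⟶ Y}
    (h : ∀ n, ∀ z ∈ Z.nonDegenerate n, ∀ t, f (realize Z z t) = f' (realize Z z t)) : f = f' := by
  refine (sSetTopAdj.homEquiv Z Y).injective (SSet.hom_ext_nonDegenerate fun n z hz => ?_)
  refine (Y.toSSetObjEquiv (op ⦋n⦌)).injective (ContinuousMap.ext fun t => ?_)
  rw [← toTop_desc_realize, ← toTop_desc_realize, h n z hz t]

/-- By adjunction a map out of the realization is a simplicial map to the singular set, which may be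
given on nondegenerate simplices. -/
theorem exists_toTop_desc {Z : SSet.{u}} {Y : TopCat.{u}} [Nonempty Y]
    (hZ : ∀ {m n : ℕ} (δ : ⦋m⦌ ⟶ ⦋n⦌) [Mono δ], ∀ z ∈ Z.nonDegenerate n,
      Z.map δ.op z ∈ Z.nonDegenerate m)
    (e : ∀ n, Z.obj (op ⦋n⦌) → TopSimplex n → Y)
    (hec : ∀ n, ∀ z ∈ Z.nonDegenerate n, Continuous (e n z))
    (he : ∀ {m n : ℕ} (δ : ⦋m⦌ ⟶ ⦋n⦌) [Mono δ], ∀ z ∈ Z.nonDegenerate n, ∀ t,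
      e m (Z.map δ.op z) t = e n z (TopSimplex.map δ t)) :
    ∃ f : SSet.toTop.obj Z ⟶ Y, ∀ n, ∀ z ∈ Z.nonDegenerate n, ∀ t, f (realize Z z t) = e n z t := by
  classical
  let y : Y := Classical.arbitrary Y
  let e' : ∀ n, Z.obj (op ⦋n⦌) → (TopCat.toSSet.obj Y).obj (op ⦋n⦌) := fun n z =>
    (Y.toSSetObjEquiv (op ⦋n⦌)).symm
      (if h : Continuous (e n z) then ⟨e n z, h⟩ else ContinuousMap.const _ y)
  have he' : ∀ n, ∀ z ∈ Z.nonDegenerate n, ∀ t,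
      Y.toSSetObjEquiv (op ⦋n⦌) (e' n z) t = e n z t := fun n z hz t => by
    simp only [e', Equiv.apply_symm_apply, dif_pos (hec n z hz)]
    rfl
  obtain ⟨F, hF⟩ := SSet.exists_hom_of_nonDegenerate hZ e' fun {m n} δ _ z hz => by
    refine (Y.toSSetObjEquiv (op ⦋m⦌)).injective (ContinuousMap.ext fun t => ?_)
    refine (he' m _ (hZ δ z hz) t).trans ((he δ z hz t).trans ?_)
    exact (he' n z hz _).symm.trans (TopCat.toSSetObjEquiv_naturality_apply δ _ t).symm
  refine ⟨(sSetTopAdj.homEquiv Z Y).symm F, fun n z hz t => ?_⟩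
  rw [toTop_desc_realize, Equiv.apply_symm_apply, hF n z hz, he' n z hz]

end Realize

/-! ## Fixed points of homotopy limits -/

section Holim

open scoped Simplicial
open Opposite

variable {G : Type u} [Group G] {a : SingleObj G ⥤ Cat.{u, u}}
  {hfin : ∀ i : Idx a, ∃ d : ℕ, (nerve (Over i)).HasDimensionLT d} {k : ℕ}

theorem GDiagram.whisker_tr {C D : Type*} [Category C] [Category D] (Z : GDiagram a C) (F : C ⥤ D)
    (g : G) {i j : Idx a} (h : g • i = j) : (Z.whisker F).tr g h = F.map (Z.tr g h) :=
  (F.map_comp _ _).symm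

theorem classifyingOver_tr (g : G) {i j : Idx a} (h : g • i = j) :
    (classifyingOver a).tr g h = SSet.toTop.map ((nerveOver a).tr g h) :=
  (nerveOver a).whisker_tr _ _ _

/-- The structure map of the last object of a chain over `j`. -/
def lastHom {j : Idx a} {n : ℕ} (w : ComposableArrows (Over j) n) : top (w ⋙ Over.forget j) ⟶ j :=
  (w.obj (Fin.last n)).hom

theorem topMap_lastHom {j : Idx a} {m n : ℕ} (δ : ⦋m⦌ ⟶ ⦋n⦌) (w : ComposableArrows (Over j) n) :
    topMap δ (w ⋙ Over.forget j) ≫ lastHom w = lastHom ((nerve (Over j)).map δ.op w) :=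
  Over.w (w.map (homOfLE (Fin.le_last (δ.toOrderHom (Fin.last m)))))

/-- The family of maps given by natural transformations. -/
def GDiagram.HomSpace.toChainFamily {X : GDiagram a TopCat.{u}} (b : Ball (k + 1) → Holim X) :
    ChainFamily X k := fun _ c v t =>
  HomSpace.comp (b v) (top c) (realize ((nerveOver a).functor.obj (top c)) (liftChain c) t)

theorem GDiagram.HomSpace.comp_realize_map {X : GDiagram a TopCat.{u}} (f : Holim X) {i j : Idx a}
    (α : i ⟶ j) {n : ℕ} (w : ((nerveOver a).functor.obj i).obj (op ⦋n⦌)) (t) :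
    HomSpace.comp f j (realize _ (((nerveOver a).functor.map α).app (op ⦋n⦌) w) t) =
      X.functor.map α (HomSpace.comp f i (realize _ w t)) := by
  rw [← toTop_map_realize]
  exact ConcreteCategory.congr_hom
    (NatTrans.naturality (F := (classifyingOver a).functor) (G := X.functor) f α) (realize _ w t)

theorem GDiagram.HomSpace.comp_realize_tr {X : GDiagram a TopCat.{u}} {f : Holim X}
    (hf : f ∈ MulAction.fixedPoints G (Holim X)) {g : G} {i j : Idx a}
    (h : g • i = j) {n : ℕ} (w : ((nerveOver a).functor.obj i).obj (op ⦋n⦌)) (t) :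
    HomSpace.comp f j (realize _ (((nerveOver a).tr g h).app (op ⦋n⦌) w) t) =
      X.tr g h (HomSpace.comp f i (realize _ w t)) := by
  rw [← toTop_map_realize]
  exact (congrArg (fun m : (classifyingOver a).functor.obj i ⟶ (classifyingOver a).functor.obj j =>
    HomSpace.comp f j (m (realize _ w t))) (classifyingOver_tr g h).symm).trans
      ((HomSpace.mem_fixedPoints f).1 hf g h _)

theorem GDiagram.HomSpace.isBoundary_toChainFamily {X : GDiagram a TopCat.{u}}
    {b : Ball (k + 1) → Holim X} (hb : ContinuousOn b (Ball.bd (k + 1)))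
    (hbf : ∀ v, b v ∈ MulAction.fixedPoints G (Holim X)) : (toChainFamily b).IsBoundary where
  continuousOn c := HomSpace.continuousOn_comp_of_compact hb
    (realize ((nerveOver a).functor.obj (top c)) (liftChain c)).continuous
  map {m n} δ c v _ t := by
    refine Eq.trans ?_ (comp_realize_map (b v) (topMap δ c) (liftChain (pull δ c)) t)
    refine congrArg (HomSpace.comp (b v) (top c)) ((realize_map _ δ _ t).symm.trans ?_)
    exact congrArg (fun w => realize ((nerveOver a).functor.obj (top c)) w t)
      (nerve_map_liftChain δ c)
  smul {n g c c'} h v _ t := by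
    refine Eq.trans ?_ (comp_realize_tr (hbf v) (smul_top h) (liftChain c) t)
    exact congrArg (fun w => HomSpace.comp (b v) (top c')
      (realize ((nerveOver a).functor.obj (top c')) w t)) (nerveOver_tr_liftChain h).symm

theorem nonDegenerate_nerveOver_map (hfin : ∀ i : Idx a, ∃ d : ℕ, (nerve (Over i)).HasDimensionLT d)
    (j : Idx a) {m n : ℕ} (δ : ⦋m⦌ ⟶ ⦋n⦌) [Mono δ] {w : (nerve (Over j)).obj (op ⦋n⦌)}
    (hw : w ∈ (nerve (Over j)).nonDegenerate n) :
    (nerve (Over j)).map δ.op w ∈ (nerve (Over j)).nonDegenerate m :=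
  (isStrict_iff_nonDegenerate (hfin := hfin) _).1 (((isStrict_iff_nonDegenerate w).2 hw).pull δ)

-- A simplex of `N(I/j)` takes the value of its underlying chain, pushed forward to `j` by the last
-- structure map. The ball is put into the mapping space `C(Ball, X_j)`, so that the universal
-- property of the realization applies without forming a product with it.
open Classical in
theorem ChainFamily.IsExtension.exists_desc {X : PtGDiagram a} {ψ E : ChainFamily X.toGDiagram k}
    (hE : ∀ N, IsExtension hfin ψ N E) (j : Idx a) :
    ∃ L : SSet.toTop.obj (nerve (Over j)) ⟶ TopCat.of C(Ball (k + 1), X.functor.obj j),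
      ∀ (n : ℕ) (w : ComposableArrows (Over j) n), IsStrict hfin (w ⋙ Over.forget j) → ∀ t v,
        (L (realize (nerve (Over j)) (n := n) w t) : C(Ball (k + 1), X.functor.obj j)) v =
          X.functor.map (lastHom w) (E n (w ⋙ Over.forget j) v t) := by
  have hc : ∀ (n : ℕ) (w : ComposableArrows (Over j) n), IsStrict hfin (w ⋙ Over.forget j) →
      Continuous fun z : TopSimplex n × Ball (k + 1) =>
        X.functor.map (lastHom w) (E n (w ⋙ Over.forget j) z.2 z.1) := fun n w hw =>
    (X.functor.map (lastHom w)).hom.continuous.comp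
      (((hE (n + 1)).continuous (Nat.lt_succ_self n) hw).comp continuous_swap)
  let e : ∀ n, ComposableArrows (Over j) n → TopSimplex n → C(Ball (k + 1), X.functor.obj j) :=
    fun n w t => if hw : IsStrict hfin (w ⋙ Over.forget j) then
      ⟨fun v => X.functor.map (lastHom w) (E n (w ⋙ Over.forget j) v t),
        (hc n w hw).comp (Continuous.prodMk_right t)⟩
      else ContinuousMap.const _ (X.pt j)
  have he : ∀ n (w : ComposableArrows (Over j) n) (_ : IsStrict hfin (w ⋙ Over.forget j)) t v,
      e n w t v = X.functor.map (lastHom w) (E n (w ⋙ Over.forget j) v t) := fun n w hw t v => by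
    simp only [e, dif_pos hw]
    rfl
  have : Nonempty (TopCat.of C(Ball (k + 1), X.functor.obj j)) :=
    ⟨ContinuousMap.const _ (X.pt j)⟩
  obtain ⟨L, hL⟩ := exists_toTop_desc (Z := nerve (Over j))
    (Y := TopCat.of C(Ball (k + 1), X.functor.obj j))
    (fun δ _ z hz => nonDegenerate_nerveOver_map hfin j δ hz) e (fun n w hw => by
      have hw := (isStrict_iff_nonDegenerate (hfin := hfin) w).2 hw
      refine ContinuousMap.continuous_of_continuous_uncurry _ ?_
      exact (hc n w hw).congr fun z => (he n w hw z.1 z.2).symm)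
    (fun {m n} δ _ w hw t => by
      have hw' := (isStrict_iff_nonDegenerate (hfin := hfin) w).2 hw
      refine ContinuousMap.ext fun v => ?_
      refine (he m ((nerve (Over j)).map δ.op w) (hw'.pull δ) t v).trans (Eq.trans ?_ (he n w hw' _ v).symm)
      rw [(hE (n + 1)).map_of_mono (Nat.lt_succ_self n) δ hw']
      refine Eq.trans ?_ (map_comp_apply X.functor _ _ _)
      exact (congrArg (fun f : top (pull δ (w ⋙ Over.forget j)) ⟶ j => X.functor.map f
        (E m (pull δ (w ⋙ Over.forget j)) v t)) (topMap_lastHom δ w)).symm)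
  refine ⟨L, fun n w hw t v => ?_⟩
  exact (congrArg (fun f : C(Ball (k + 1), X.functor.obj j) => f v)
    (hL n w ((isStrict_iff_nonDegenerate w).1 hw) t)).trans (he n w hw t v)

/-- The boundary family is restricted to strict chains, extended there, and reassembled. Naturality,
invariance and agreement on the boundary are equalities of maps out of realizations, hence checked
on nondegenerate simplices. -/
theorem PtGDiagram.pairExt_fixedPoints_holim
    (hfin : ∀ i : Idx a, ∃ d : ℕ, (nerve (Over i)).HasDimensionLT d) {X : PtGDiagram a}
    (hX : ∀ (i : Idx a) (H : Subgroup (Stab a i)), intToEReal k ≤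
      connSub (conn (X.Fixed i H)) (simplicialDim ((nerveOver a).fixedSubcomplex i H))) :
    PairExt (Ball (k + 1)) (Ball.bd (k + 1)) (MulAction.fixedPoints G (Holim X.toGDiagram)) := by
  intro f hf
  let b : Ball (k + 1) → Holim X.toGDiagram := fun v => (f v).1
  have hb : ContinuousOn b (Ball.bd (k + 1)) := continuous_subtype_val.comp_continuousOn hf
  have hbf : ∀ v, b v ∈ MulAction.fixedPoints G _ := fun v => (f v).2
  obtain ⟨E, hE⟩ := (GDiagram.HomSpace.isBoundary_toChainFamily hb hbf).exists_extension hfin hX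
  choose L hL using ChainFamily.IsExtension.exists_desc hE
  let ev : ∀ (v : Ball (k + 1)) (j : Idx a),
      TopCat.of C(Ball (k + 1), X.functor.obj j) ⟶ X.functor.obj j := fun v j =>
    TopCat.ofHom ⟨fun q : C(Ball (k + 1), X.functor.obj j) => q v, continuous_eval_const v⟩
  have hmap : ∀ {i j : Idx a} (α : i ⟶ j) (v),
      SSet.toTop.map ((nerveOver a).functor.map α) ≫ L j ≫ ev v j =
        L i ≫ ev v i ≫ X.functor.map α := by
    intro i j α v
    refine toTop_hom_ext (Z := nerve (Over i)) fun n w hw t => ?_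
    have hw := (isStrict_iff_nonDegenerate (hfin := hfin) w).2 hw
    refine (congrArg (fun x => ev v j (L j x))
      (toTop_map_realize ((nerveOver a).functor.map α) w t)).trans ?_
    refine (hL j n (w ⋙ Over.map α) hw t v).trans ?_
    refine Eq.trans ?_ (congrArg (X.functor.map α) (hL i n w hw t v)).symm
    exact map_comp_apply X.functor (lastHom w) α _
  have htr : ∀ (g : G) {i j : Idx a} (h : g • i = j) (v),
      SSet.toTop.map ((nerveOver a).tr g h) ≫ L j ≫ ev v j = L i ≫ ev v i ≫ X.tr g h := by
    rintro g i _ rfl v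
    refine toTop_hom_ext (Z := nerve (Over i)) fun n w hw t => ?_
    have hw := (isStrict_iff_nonDegenerate (hfin := hfin) w).2 hw
    have e1 : ((nerveOver a).tr g (i := i) rfl).app (op ⦋n⦌) w = w ⋙ Over.post (act a g) := by
      rw [GDiagram.tr]
      simp
      rfl
    refine (congrArg (fun x => ev v (g • i) (L (g • i) x))
      (toTop_map_realize ((nerveOver a).tr g (i := i) rfl) w t)).trans ?_
    refine (congrArg (fun w => ev v (g • i) (L (g • i) (realize (nerve (Over (g • i))) w t)))
      e1).trans ?_
    refine (hL (g • i) n (w ⋙ Over.post (act a g)) (hw.smul g) t v).trans ?_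
    refine Eq.trans ?_ (congrArg (X.tr g (i := i) rfl) (hL i n w hw t v)).symm
    have e2 : eqToHom rfl ≫ (act a g).map (lastHom w) ≫ eqToHom rfl =
        lastHom (j := g • i) (w ⋙ Over.post (act a g)) :=
      (Category.id_comp _).trans (Category.comp_id _)
    let c : ComposableArrows (Idx a) n := w ⋙ Over.forget i
    have e3 := ConcreteCategory.congr_hom
      (X.map_tr g (lastHom w) (j := top (g • c)) (j' := g • i) rfl rfl) (E n c v t)
    refine Eq.trans ?_ e3.symm
    refine (congrArg (X.functor.map (lastHom (j := g • i) (w ⋙ Over.post (act a g))))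
      ((hE (n + 1)).smul (Nat.lt_succ_self n) (c := c) rfl hw v t)).trans ?_
    exact (congrArg (fun f : top (g • c) ⟶ g • i => X.functor.map f (X.tr g rfl (E n c v t)))
      e2).symm
  have hbd : ∀ v ∈ Ball.bd (k + 1), ∀ i, L i ≫ ev v i =
      NatTrans.app (F := (classifyingOver a).functor) (G := X.functor) (b v) i := by
    intro v hv i
    refine toTop_hom_ext (Z := nerve (Over i)) fun n w hw t => ?_
    have hw := (isStrict_iff_nonDegenerate (hfin := hfin) w).2 hw
    refine (hL i n w hw t v).trans ?_
    rw [(hE (n + 1)).bd (Nat.lt_succ_self n) hw v hv]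
    refine (GDiagram.HomSpace.comp_realize_map (b v) (lastHom w) _ t).symm.trans ?_
    exact congrArg (fun w => GDiagram.HomSpace.comp (b v) i
      (realize ((nerveOver a).functor.obj i) w t)) (eq_liftChain w)
  obtain ⟨F, hF, hFL⟩ := GDiagram.HomSpace.exists_of_family (K := classifyingOver a)
    (X := X.toGDiagram) (P := Ball (k + 1)) (L := fun i x => L i x) (fun i => (L i).hom.continuous)
    (fun {i j} α x v => ConcreteCategory.congr_hom (hmap α v) x)
  refine ⟨fun v => ⟨F v, (GDiagram.HomSpace.mem_fixedPoints _).2 fun g {i j} h x => ?_⟩,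
    hF.subtype_mk _, fun v hv => Subtype.ext (NatTrans.ext (funext fun i => ?_))⟩
  · rw [hFL, hFL]
    refine Eq.trans ?_ (ConcreteCategory.congr_hom (htr g h v) x)
    exact congrArg (fun m : (classifyingOver a).functor.obj i ⟶ (classifyingOver a).functor.obj j =>
      ev v j (L j (m x))) (classifyingOver_tr g h)
  · ext x
    exact (hFL v i x).trans (ConcreteCategory.congr_hom (hbd v hv i) x)

/-- The constant transformation to the base points. -/
def PtGDiagram.constHolim (X : PtGDiagram a) : Holim X.toGDiagram :=
  { app := fun i => TopCat.ofHom (ContinuousMap.const _ (X.pt i))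
    naturality := fun i j α => by
      ext x
      exact (X.map_pt α).symm }

theorem PtGDiagram.constHolim_mem_fixedPoints (X : PtGDiagram a) :
    X.constHolim ∈ MulAction.fixedPoints G (Holim X.toGDiagram) := by
  rw [GDiagram.HomSpace.mem_fixedPoints]
  intro g i j h x
  exact (X.tr_pt g h).symm

theorem PtGDiagram.isConnectedUpTo_holim
    (hfin : ∀ i : Idx a, ∃ d : ℕ, (nerve (Over i)).HasDimensionLT d) (X : PtGDiagram a) :
    IsConnectedUpTo
      (⨅ (i : Idx a) (H : Subgroup (Stab a i)),
        connSub (conn (X.Fixed i H)) (simplicialDim ((nerveOver a).fixedSubcomplex i H)))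
      (MulAction.fixedPoints G (Holim X.toGDiagram)) := by
  refine fun n hn => ⟨fun _ => ⟨⟨_, X.constHolim_mem_fixedPoints⟩⟩, fun k hk y => ?_⟩
  have hX : ∀ (i : Idx a) (H : Subgroup (Stab a i)), intToEReal k ≤
      connSub (conn (X.Fixed i H)) (simplicialDim ((nerveOver a).fixedSubcomplex i H)) := fun i H =>
    ((intToEReal_mono hk).trans hn).trans (iInf_le_of_le i (iInf_le_of_le H le_rfl))
  exact (CubeExt.of_ball (PtGDiagram.pairExt_fixedPoints_holim hfin hX)).subsingleton y

end Holim

/-! ### The connectivity theorem -/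

theorem mainTheorem10 {G : Type u} [Group G] (a : SingleObj G ⥤ Cat.{u, u})
    (hfin : ∀ i : Idx a, ∃ d : ℕ, (nerve (Over i)).HasDimensionLT d) :
    (∀ K : PtGDiagram a, K.IsCGHaus → K.IsCofibrant →
      ∀ (cw : ∀ i : Idx a, GCWComplex (Stab a i) (K.functor.obj i)) (X : PtGDiagram a),
        IsConnectedUpTo
          (⨅ (i : Idx a) (H : Subgroup (Stab a i)) (_ : K.Fixed i H ≠ {K.pt i}),
            connSub (conn (X.Fixed i H)) ((cw i).dimFixed H))
          (MulAction.fixedPoints G (PtGDiagram.PtHomSpace K X))) ∧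
    (∀ X : PtGDiagram a,
        IsConnectedUpTo
          (⨅ (i : Idx a) (H : Subgroup (Stab a i)),
            connSub (conn (X.Fixed i H)) (simplicialDim ((nerveOver a).fixedSubcomplex i H)))
          (MulAction.fixedPoints G (Holim X.toGDiagram))) :=
  ⟨fun _ hKC hK cw X => PtGDiagram.isConnectedUpTo_ptHomSpace hfin hK hKC cw X,
    fun X => X.isConnectedUpTo_holim hfin⟩

end
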